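/- Let $\Omega=\mathbb T^2\times(-1,1)$ with $\mathbb T=\mathbb R/\mathbb Z$, $\Gamma=\mathbb T^2\times\{-1,1\}$, $N=(0,0,\pm1)$ on $y_3=\pm1$, and $\sigma(y_3)=(1-y_3)(1+y_3)$. Repeated indices are summed over $1,2,3$. For $I=(i_0,\dots,i_4)\in\mathbb N^5$ put $$\partial_*^I=\partial_t^{i_0}(\sigma\partial_3)^{i_4}\partial_1^{i_1}\partial_2^{i_2}\partial_3^{i_3},\qquad \langle I\rangle=i_0+i_1+i_2+2i_3+i_4,\qquad \|f(t)\|_{m,*}^2=\sum_{\langle I\rangle\le m}\|\partial_*^If(t,\cdot)\|_{L^2(\Omega)}^2,$$ and write $\|\cdot\|_0$, $|\cdot|_0$ for the norms of $L^2(\Omega)$ and $L^2(\Gamma)$. Let $T>0$, $c_0>0$, let $R$ (the density as a function of the pressure) be a smooth strictly increasing function on $\mathbb R$, let $b_0$ be a vector field on $\overline\Omega$, and let $\eta,v,q$ be functions on $[0,T]\times\overline\Omega$ (where $\eta$ is lifted to the universal cover, with $\eta(t,y)-y$ periodic in $y_1,y_2$, and its norms are taken over $[0,1]^2\times(-1,1)$).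 Put $J=\det[\partial\eta]$, $A=[\partial\eta]^{-1}$ with $A^{li}=\partial y^l/\partial x^i$, $x=\eta(t,y)$, $\nabla_A^i=A^{li}\partial_l$, $\mathrm{div}_A X=A^{li}\partial_lX_i$, $\rho_0=R(q(0,\cdot))$ and $Q=q+\frac12|J^{-1}(b_0\cdot\partial)\eta|^2$. Suppose that $J>0$, that $b_0$, $\eta$, $v$, $q$ and $J^{-1}(b_0\cdot\partial)\eta$ are of class $C^8$ up to the boundary of their domains, and that they solve the free-boundary compressible ideal MHD system in Lagrangian coordinates $$\begin{cases}\partial_t\eta=v,\quad R(q)\,\partial_tv=J^{-1}(b_0\cdot\partial)\big(J^{-1}(b_0\cdot\partial)\eta\big)-\nabla_AQ,\quad \dfrac{JR'(q)}{\rho_0}\partial_tq+\mathrm{div}_Av=0,\quad \mathrm{div}\,b_0=0&\text{in }[0,T]\times\Omega,\\ Q=0,\quad b_0^3=0&\text{on }[0,T]\times\Gamma,\\ \eta|_{t=0}=\mathrm{Id},\quad -\dfrac{\partial Q}{\partial N}\Big|_{t=0}\ge c_0\ \text{ on }\Gamma.\end{cases}$$ Suppose further that $-\partial Q/\partial N\ge\frac34c_0$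 on $[0,T]\times\Gamma$, and that for constants $A_0>1$ and $0<\rho_1<\rho_2$ one has, at all values $p=q(t,y)$ of the pressure, $\rho_1\le R(p)\le\rho_2$, $R'(p)\ge A_0^{-1}$ and $|R^{(m)}(p)|\le A_0$ for $1\le m\le 8$. Let $$\mathcal E(t)=\|\eta\|_{8,*}^2+\|v\|_{8,*}^2+\|J^{-1}(b_0\cdot\partial)\eta\|_{8,*}^2+\|Q\|_{8,*}^2+\sum_{\langle I\rangle=8}\big|A^{3i}\partial_*^I\eta_i\big|_0^2 .$$ Then $$\Big(\|\partial_3^4v\|_0^2+\big\|\partial_3^4\big(J^{-1}(b_0\cdot\partial)\eta\big)\big\|_0^2+\|\partial_3^4q\|_0^2+\frac{c_0}4\big|A^{3i}\partial_3^4\eta_i\big|_0^2\Big)\Big|_{t=T}\le C\Big(P_0(\mathcal E(0))+P_1(\mathcal E(T))\int_0^TP_2(\mathcal E(t))\,dt\Big),$$ where the constant $C>0$ and the polynomials $P_0,P_1,P_2$ with nonnegative coefficients depend only on $A_0,\rho_1,\rho_2$ (in particular not on $T$, $c_0$, $R$ or the solution). -/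

import Mathlib

open scoped ContDiff

noncomputable section

namespace FreeMHD

/-- Points `(t, y)` of space-time. The third spatial coordinate `y 2` is the normal one. -/
abbrev SpaceTime : Type := ℝ × (Fin 3 → ℝ)

/-- The closure of `ℝ² × (-1, 1)`, the universal cover of the closure of `Ω = 𝕋² × (-1, 1)`,
where `𝕋 = ℝ / ℤ`. Functions on `Ω` are functions on it with period `1` in `y 0` and `y 1`. -/
def slab : Set (Fin 3 → ℝ) := {y | y 2 ∈ Set.Icc (-1 : ℝ) 1}

/-- The closed space-time domain `[0, T] × closure Ω` (lifted to the universal cover). -/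
def cyl (T : ℝ) : Set SpaceTime := Set.Icc 0 T ×ˢ slab

/-- A (closed) fundamental cell of `Ω`; integrals over `Ω` are integrals over it. -/
def cell : Set (Fin 3 → ℝ) := Set.Icc ![0, 0, -1] ![1, 1, 1]

/-- The integral over `Γ = 𝕋² × {-1, 1}`. -/
def integralBdry (g : (Fin 3 → ℝ) → ℝ) : ℝ :=
  ∑ s ∈ ({-1, 1} : Finset ℝ), ∫ y' in Set.Icc (0 : Fin 2 → ℝ) 1, g ![y' 0, y' 1, s]

/-- Derivative in the direction `e`, up to the boundary of `[0, T] × closure Ω`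
(one-sided at `t = 0`, `t = T` and `y 2 = ±1`). -/
def dirDeriv (T : ℝ) (e : SpaceTime) (f : SpaceTime → ℝ) : SpaceTime → ℝ :=
  fun z => fderivWithin ℝ f (cyl T) z e

/-- `∂_t`. -/
def dt (T : ℝ) (f : SpaceTime → ℝ) : SpaceTime → ℝ := dirDeriv T (1, 0) f

/-- The Lagrangian spatial derivative `∂_{l+1}` for `l = 0, 1, 2`. -/
def dx (T : ℝ) (l : Fin 3) (f : SpaceTime → ℝ) : SpaceTime → ℝ :=
  dirDeriv T (0, Pi.single l 1) f

/-- `σ ∂_3` with `σ(y_3) = (1 - y_3)(1 + y_3)`. -/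
def sigmaD3 (T : ℝ) (f : SpaceTime → ℝ) : SpaceTime → ℝ :=
  fun z => ((1 - z.2 2) * (1 + z.2 2)) * dx T 2 f z

/-- `∂_*^I = ∂_t^{i₀} (σ∂₃)^{i₄} ∂₁^{i₁} ∂₂^{i₂} ∂₃^{i₃}`. -/
def dstar (T : ℝ) (I : Fin 5 → ℕ) (f : SpaceTime → ℝ) : SpaceTime → ℝ :=
  (dt T)^[I 0] ((sigmaD3 T)^[I 4] ((dx T 0)^[I 1] ((dx T 1)^[I 2] ((dx T 2)^[I 3] f))))

/-- `⟨I⟩ = i₀ + i₁ + i₂ + 2 i₃ + i₄`. -/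
def weight (I : Fin 5 → ℕ) : ℕ := I 0 + I 1 + I 2 + 2 * I 3 + I 4

/-- The multi-indices `I ∈ ℕ⁵` with `⟨I⟩ ≤ m`. -/
def indicesLE (m : ℕ) : Finset (Fin 5 → ℕ) :=
  (Fintype.piFinset fun _ => Finset.range (m + 1)).filter fun I => weight I ≤ m

/-- The multi-indices `I ∈ ℕ⁵` with `⟨I⟩ = m`. -/
def indicesEq (m : ℕ) : Finset (Fin 5 → ℕ) :=
  (Fintype.piFinset fun _ => Finset.range (m + 1)).filter fun I => weight I = m

theorem mem_indicesLE {m : ℕ} {I : Fin 5 → ℕ} : I ∈ indicesLE m ↔ weight I ≤ m := by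
  rw [indicesLE, Finset.mem_filter, Fintype.mem_piFinset]
  refine ⟨fun h => h.2, fun h => ⟨fun i => Finset.mem_range.2 ?_, h⟩⟩
  unfold weight at h
  fin_cases i <;> simp <;> omega

theorem mem_indicesEq {m : ℕ} {I : Fin 5 → ℕ} : I ∈ indicesEq m ↔ weight I = m := by
  rw [indicesEq, Finset.mem_filter, Fintype.mem_piFinset]
  refine ⟨fun h => h.2, fun h => ⟨fun i => Finset.mem_range.2 ?_, h⟩⟩
  unfold weight at h
  fin_cases i <;> simp <;> omega

/-- `‖f(t)‖_{L²(Ω)}²`. -/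
def l2Sq (f : SpaceTime → ℝ) (t : ℝ) : ℝ := ∫ y in cell, f (t, y) ^ 2

/-- `|f(t)|_{L²(Γ)}²`. -/
def bdrySq (f : SpaceTime → ℝ) (t : ℝ) : ℝ := integralBdry fun y => f (t, y) ^ 2

/-- `‖f(t)‖_{m,*}²`. -/
def starSq (T : ℝ) (m : ℕ) (f : SpaceTime → ℝ) (t : ℝ) : ℝ :=
  ∑ I ∈ indicesLE m, l2Sq (dstar T I f) t

/-- The deformation gradient, with entries `∂_l η_i` (row `i`, column `l`). -/
def gradη (T : ℝ) (η : SpaceTime → Fin 3 → ℝ) (z : SpaceTime) : Matrix (Fin 3) (Fin 3) ℝ :=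
  Matrix.of fun i l => dx T l (fun w => η w i) z

/-- `J = det [∂η]`. -/
def jac (T : ℝ) (η : SpaceTime → Fin 3 → ℝ) (z : SpaceTime) : ℝ := (gradη T η z).det

/-- `A = [∂η]⁻¹`, with entries `A^{li} = ∂y^l / ∂x^i` (row `l`, column `i`). -/
def invGrad (T : ℝ) (η : SpaceTime → Fin 3 → ℝ) (z : SpaceTime) : Matrix (Fin 3) (Fin 3) ℝ :=
  (gradη T η z)⁻¹

/-- `∇_A^i f = A^{li} ∂_l f`. -/
def gradA (T : ℝ) (η : SpaceTime → Fin 3 → ℝ) (i : Fin 3) (f : SpaceTime → ℝ)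
    (z : SpaceTime) : ℝ :=
  ∑ l, invGrad T η z l i * dx T l f z

/-- `div_A X = A^{li} ∂_l X_i`. -/
def divA (T : ℝ) (η : SpaceTime → Fin 3 → ℝ) (X : SpaceTime → Fin 3 → ℝ) (z : SpaceTime) : ℝ :=
  ∑ i, gradA T η i (fun w => X w i) z

/-- `J⁻¹ (b₀ · ∂) f`. -/
def magD (T : ℝ) (b₀ : (Fin 3 → ℝ) → Fin 3 → ℝ) (η : SpaceTime → Fin 3 → ℝ)
    (f : SpaceTime → ℝ) (z : SpaceTime) : ℝ :=
  (jac T η z)⁻¹ * ∑ l, b₀ z.2 l * dx T l f z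

/-- The magnetic field `b = J⁻¹ (b₀ · ∂) η`. -/
def mag (T : ℝ) (b₀ : (Fin 3 → ℝ) → Fin 3 → ℝ) (η : SpaceTime → Fin 3 → ℝ)
    (z : SpaceTime) (i : Fin 3) : ℝ :=
  magD T b₀ η (fun w => η w i) z

/-- The total pressure `Q = q + |b|² / 2`. -/
def totalP (T : ℝ) (b₀ : (Fin 3 → ℝ) → Fin 3 → ℝ) (η : SpaceTime → Fin 3 → ℝ)
    (q : SpaceTime → ℝ) (z : SpaceTime) : ℝ :=
  q z + 1 / 2 * ∑ i, mag T b₀ η z i ^ 2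

/-- `∂Q / ∂N` on `Γ`, where `N = (0, 0, ±1)` on `y_3 = ±1`, that is `N = (0, 0, y_3)`. -/
def normalDeriv (T : ℝ) (f : SpaceTime → ℝ) (z : SpaceTime) : ℝ := z.2 2 * dx T 2 f z

/-- `A^{3i} ∂_*^I η_i`. -/
def bdryUnknown (T : ℝ) (η : SpaceTime → Fin 3 → ℝ) (I : Fin 5 → ℕ) (z : SpaceTime) : ℝ :=
  ∑ i, invGrad T η z 2 i * dstar T I (fun w => η w i) z

/-- The energy functional `𝓔(t)`. -/
def energy (T : ℝ) (b₀ : (Fin 3 → ℝ) → Fin 3 → ℝ) (η v : SpaceTime → Fin 3 → ℝ)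
    (q : SpaceTime → ℝ) (t : ℝ) : ℝ :=
  (∑ i, starSq T 8 (fun z => η z i) t) + (∑ i, starSq T 8 (fun z => v z i) t)
    + (∑ i, starSq T 8 (fun z => mag T b₀ η z i) t) + starSq T 8 (totalP T b₀ η q) t
    + ∑ I ∈ indicesEq 8, bdrySq (bdryUnknown T η I) t

/-- `(η, v, q)` is a classical solution, of class `C⁸` up to the boundary, of the free-boundary
compressible ideal MHD system in Lagrangian coordinates on `[0, T] × Ω`, with initial magnetic field
`b₀` and density `R(q)`. The initial density is `ρ₀ = R(q(0, ·))`. The functions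
`v`, `q`, `b₀` live on `𝕋² × [-1, 1]`; the flow map is lifted to the universal cover, so that
`η(t, y) - y` is periodic. -/
structure IsSolution (T c₀ : ℝ) (R : ℝ → ℝ) (b₀ : (Fin 3 → ℝ) → Fin 3 → ℝ)
    (η v : SpaceTime → Fin 3 → ℝ) (q : SpaceTime → ℝ) : Prop where
  smooth_b₀ : ContDiffOn ℝ 8 b₀ slab
  smooth_η : ContDiffOn ℝ 8 η (cyl T)
  smooth_v : ContDiffOn ℝ 8 v (cyl T)
  smooth_q : ContDiffOn ℝ 8 q (cyl T)
  smooth_b : ContDiffOn ℝ 8 (mag T b₀ η) (cyl T)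
  periodic_b₀ : ∀ k : Fin 3, k ≠ 2 → ∀ y ∈ slab, b₀ (y + Pi.single k 1) = b₀ y
  periodic_η : ∀ k : Fin 3, k ≠ 2 → ∀ z ∈ cyl T,
    η (z.1, z.2 + Pi.single k 1) = η z + Pi.single k 1
  periodic_v : ∀ k : Fin 3, k ≠ 2 → ∀ z ∈ cyl T, v (z.1, z.2 + Pi.single k 1) = v z
  periodic_q : ∀ k : Fin 3, k ≠ 2 → ∀ z ∈ cyl T, q (z.1, z.2 + Pi.single k 1) = q z
  /-- the flow map is nondegenerate and orientation preserving -/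
  jac_pos : ∀ z ∈ cyl T, 0 < jac T η z
  initial_η : ∀ y ∈ slab, η (0, y) = y
  /-- `∂_t η = v` -/
  flow : ∀ z ∈ cyl T, ∀ i, dt T (fun w => η w i) z = v z i
  /-- `R ∂_t v = J⁻¹(b₀·∂)(J⁻¹(b₀·∂)η) - ∇_A Q` -/
  momentum : ∀ z ∈ cyl T, ∀ i,
    R (q z) * dt T (fun w => v w i) z
      = magD T b₀ η (fun w => mag T b₀ η w i) z - gradA T η i (totalP T b₀ η q) z
  /-- `(J R'(q) / ρ₀) ∂_t q + div_A v = 0` -/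
  continuity : ∀ z ∈ cyl T,
    jac T η z * deriv R (q z) / R (q (0, z.2)) * dt T q z + divA T η v z = 0
  /-- `div b₀ = 0` -/
  div_b₀ : ∀ y ∈ slab, ∑ l, fderivWithin ℝ (fun x => b₀ x l) slab y (Pi.single l 1) = 0
  /-- `b₀³ = 0` on `Γ` -/
  normal_b₀ : ∀ y : Fin 3 → ℝ, (y 2 = -1 ∨ y 2 = 1) → b₀ y 2 = 0
  /-- `Q = 0` on `[0, T] × Γ` -/
  boundary_Q : ∀ t ∈ Set.Icc 0 T, ∀ y : Fin 3 → ℝ, (y 2 = -1 ∨ y 2 = 1) →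
    totalP T b₀ η q (t, y) = 0
  /-- `-∂Q/∂N ≥ c₀` on `Γ` at `t = 0` -/
  sign_initial : ∀ y : Fin 3 → ℝ, (y 2 = -1 ∨ y 2 = 1) →
    c₀ ≤ -normalDeriv T (totalP T b₀ η q) (0, y)

/-- The fluid is an isentropic liquid: the density is a smooth strictly increasing function `R` of
the pressure, and on the range of the pressure `q` one has `ρ₁ ≤ R ≤ ρ₂`, `R' ≥ A₀⁻¹` and
`|R^{(m)}| ≤ A₀` for `1 ≤ m ≤ 8`. -/
structure IsLiquid (T A₀ ρ₁ ρ₂ : ℝ) (R : ℝ → ℝ) (q : SpaceTime → ℝ) : Prop where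
  smooth : ContDiff ℝ ∞ R
  strictMono : StrictMono R
  density_bounds : ∀ z ∈ cyl T, ρ₁ ≤ R (q z) ∧ R (q z) ≤ ρ₂
  deriv_lower : ∀ z ∈ cyl T, A₀⁻¹ ≤ deriv R (q z)
  deriv_upper : ∀ z ∈ cyl T, ∀ m : ℕ, 1 ≤ m → m ≤ 8 → |iteratedDeriv m R (q z)| ≤ A₀

/-- The Rayleigh-Taylor sign condition on `[0, T]`: `-∂Q/∂N ≥ (3/4) c₀` on `Γ`. -/
def SignCondition (T c₀ : ℝ) (b₀ : (Fin 3 → ℝ) → Fin 3 → ℝ)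
    (η : SpaceTime → Fin 3 → ℝ) (q : SpaceTime → ℝ) : Prop :=
  ∀ t ∈ Set.Icc 0 T, ∀ y : Fin 3 → ℝ, (y 2 = -1 ∨ y 2 = 1) →
    3 / 4 * c₀ ≤ -normalDeriv T (totalP T b₀ η q) (t, y)

end FreeMHD

end

noncomputable section

namespace FreeMHD

/-! ### The closed space-time cylinder as a set of unique differentiability -/

section Domain

/-! Four normal derivatives have weight eight, exactly the order controlled by the energy, so each
commutator has to be paid for by structure in the equations. Write a = J A^{3·} = ∂₁η × ∂₂η, W = ∇_A
Q, V = ∂₃⁴v, B = ∂₃⁴b.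

Volume. Conservation of mass R(q) J = ρ₀ (`Rj_mul_JF`) gives J order eight, although it is built
from first derivatives of η. Since J = a·∂₃η and a contains tangential derivatives only, a·∂₃⁴η
equals ∂₃³J up to lower terms and gains one order (`HT_UF`). Hence the transversal part Y = J⁻¹
(a·V) ∂₃η of V has square-integrable derivatives in time and along b₀. The remainder Z = V − Y is a
combination of ∂₁η and ∂₂η (`ZF_eq`).

Pressure. The momentum equation expresses W through ∂_t v and (b₀·∂)b. As b₀³ vanishes on Γ, b₀³∂₃
is dominated by σ∂₃, so both operators have weight one (`H_b0F_mul_D_three`). Together with ∂_l Q =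
∂_l η · W, this shows that the good unknown ∂₃⁴Q − ∂₃⁴η·W has square-integrable tangential
derivatives (`T1_QQ`), and therefore that ∂_l η · ∂₃⁴W is square integrable for l = 1, 2. Since Z
meets ∂₃⁴W only in these two directions, the pressure term needs no integration by parts and leaves
no boundary term.

Energy. The density is ½(ρ₀|Z|² + J|B|² + κβ²) with β = b·B and κ = R'J/R. In its time derivative
the top-order magnetic terms form a perfect derivative along b₀, which integrates to zero. The
induction equation also leaves −β ∂₃⁴∂_t J. This is cancelled by the time derivative of ½κβ²,
because ∂₃⁴∂_t J = κ∂_tβ up to order zero (`H_dn_four_D_zero_JF`); the latter follows from mass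
conservation and from the fact that ∂₃⁴q + β, which is ∂₃⁴Q up to lower terms, has a
square-integrable time derivative. Coercivity then returns V, B and ∂₃⁴q.

Boundary. The trace of A^{3i}∂₃⁴η_i = J⁻¹ a·∂₃⁴η is bounded independently of that energy identity.
On Γ, where b₀³ = 0, the relations Jb = (b₀·∂)η, RJ = ρ₀ and Q = q + ½|b|² can be solved for ∂₃³J
(`exists_dn_three_JF`). The trace thus agrees with that of a function g with ∂₃g = ∂₁x + ∂₂y + e,
where x, y, e are of order zero together with their time derivatives. Writing the boundary integral
of g² as the integral of ∂₃(y₃g²) and integrating by parts tangentially leaves a volume integral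
whose time derivative is controlled (`Dv.good`). The factor c₀ is itself bounded by the initial
energy (`c₀_le`).

Uniformity. Every function is treated as a family indexed by all admissible solutions, and every
bound is polynomial in 1 + 𝓔(0) + 𝓔(t) with constants common to the family. For T ≤ 1 the
fundamental theorem of calculus in time concludes; for T ≥ 1 a crude bound by the energies suffices,
because the time integral is then at least one. -/

theorem slab_mem_nhds_zero : slab ∈ nhds (0 : Fin 3 → ℝ) := by
  have h : Continuous fun y : Fin 3 → ℝ => y 2 := continuous_apply 2
  have : Set.Icc (-1 : ℝ) 1 ∈ nhds ((0 : Fin 3 → ℝ) 2) := by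
    simp
  exact h.continuousAt.preimage_mem_nhds this

theorem convex_slab : Convex ℝ slab :=
  (convex_Icc (-1 : ℝ) 1).linear_preimage (LinearMap.proj (R := ℝ) (φ := fun _ : Fin 3 => ℝ) 2)

theorem convex_cyl (T : ℝ) : Convex ℝ (cyl T) := (convex_Icc 0 T).prod convex_slab

theorem interior_cyl_nonempty {T : ℝ} (hT : 0 < T) : (interior (cyl T)).Nonempty := by
  refine ⟨(T / 2, 0), mem_interior_iff_mem_nhds.2 ?_⟩
  exact prod_mem_nhds (Icc_mem_nhds (by linarith) (by linarith)) slab_mem_nhds_zero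

theorem uniqueDiffOn_cyl {T : ℝ} (hT : 0 < T) : UniqueDiffOn ℝ (cyl T) :=
  uniqueDiffOn_convex (convex_cyl T) (interior_cyl_nonempty hT)

theorem mem_closure_interior_cyl {T : ℝ} (hT : 0 < T) {z : SpaceTime} (hz : z ∈ cyl T) :
    z ∈ closure (interior (cyl T)) := by
  rw [(convex_cyl T).closure_interior_eq_closure_of_nonempty_interior (interior_cyl_nonempty hT)]
  exact subset_closure hz

end Domain

/-! ### One-sided differential calculus on the closed cylinder -/

section Restricted

variable {T : ℝ}

open Classical in
/-- Extension by zero of a function on the closed space-time domain. -/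
def ext (f : cyl T → ℝ) : SpaceTime → ℝ := fun z => if h : z ∈ cyl T then f ⟨z, h⟩ else 0

/-- Restriction to the closed space-time domain. -/
def res (T : ℝ) (f : SpaceTime → ℝ) : cyl T → ℝ := fun z => f z

theorem ext_of_mem (f : cyl T → ℝ) {z : SpaceTime} (hz : z ∈ cyl T) : ext f z = f ⟨z, hz⟩ := by
  simp [ext, hz]

theorem ext_coe (f : cyl T → ℝ) (z : cyl T) : ext f z = f z := ext_of_mem f z.2

theorem ext_res_eqOn (f : SpaceTime → ℝ) : Set.EqOn (ext (res T f)) f (cyl T) :=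
  fun _ hz => ext_of_mem _ hz

/-- `C^n` regularity up to the boundary. -/
def Sm (n : ℕ) (f : cyl T → ℝ) : Prop := ContDiffOn ℝ n (ext f) (cyl T)

protected theorem Sm.congr {n : ℕ} {f : cyl T → ℝ} {g : SpaceTime → ℝ} (hg : ContDiffOn ℝ n g (cyl T))
    (h : ∀ z : cyl T, f z = g z) : Sm n f :=
  ContDiffOn.congr hg fun z hz => by rw [ext_of_mem _ hz, h]

protected theorem Sm.mono {m n : ℕ} {f : cyl T → ℝ} (h : Sm n f) (hmn : m ≤ n) : Sm m f :=
  ContDiffOn.of_le h (by exact_mod_cast hmn)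

protected theorem Sm.continuousOn {n : ℕ} {f : cyl T → ℝ} (h : Sm n f) : ContinuousOn (ext f) (cyl T) :=
  ContDiffOn.continuousOn h

protected theorem Sm.differentiableOn {f : cyl T → ℝ} (h : Sm 1 f) : DifferentiableOn ℝ (ext f) (cyl T) :=
  ContDiffOn.differentiableOn h (by norm_num)

protected theorem Sm.add {n : ℕ} {f g : cyl T → ℝ} (hf : Sm n f) (hg : Sm n g) : Sm n (f + g) :=
  Sm.congr (ContDiffOn.add hf hg) fun z => by simp [ext_coe]

protected theorem Sm.mul {n : ℕ} {f g : cyl T → ℝ} (hf : Sm n f) (hg : Sm n g) : Sm n (f * g) :=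
  Sm.congr (ContDiffOn.mul hf hg) fun z => by simp [ext_coe]

protected theorem Sm.neg {n : ℕ} {f : cyl T → ℝ} (hf : Sm n f) : Sm n (-f) :=
  Sm.congr (ContDiffOn.neg hf) fun z => by simp [ext_coe]

protected theorem Sm.inv {n : ℕ} {f : cyl T → ℝ} (hf : Sm n f) (h0 : ∀ z, f z ≠ 0) : Sm n f⁻¹ :=
  Sm.congr (ContDiffOn.inv hf fun z hz => by rw [ext_of_mem _ hz]; exact h0 _)
    fun z => by simp [ext_coe]

protected theorem Sm.const (n : ℕ) (c : ℝ) : Sm n (fun _ : cyl T => c) :=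
  Sm.congr contDiffOn_const fun _ => rfl

protected theorem Sm.comp {n : ℕ} {φ : ℝ → ℝ} (hφ : ContDiff ℝ n φ) {f : cyl T → ℝ} (hf : Sm n f) :
    Sm n (fun z => φ (f z)) :=
  Sm.congr (hφ.comp_contDiffOn hf) fun z => by simp [ext_coe]

/-- Directional derivative up to the boundary. -/
def pd (e : SpaceTime) (f : cyl T → ℝ) : cyl T → ℝ := res T (dirDeriv T e (ext f))

/-- Functions on the subtype turn identities valid on the closed cylinder into equalities of
functions, open to `ring` and rewriting. This lemma leads back to the operators of the statement:
`fderivWithin` sees only values on the cylinder. -/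
theorem pd_res (e : SpaceTime) (f : SpaceTime → ℝ) : pd e (res T f) = res T (dirDeriv T e f) := by
  funext z
  change fderivWithin ℝ _ _ _ _ = fderivWithin ℝ _ _ _ _
  rw [fderivWithin_congr (ext_res_eqOn f) (ext_res_eqOn f z.2)]

theorem pd_eq_of_hasFDerivWithinAt (hT : 0 < T) {e : SpaceTime} {f : cyl T → ℝ} {z : cyl T}
    {L : SpaceTime →L[ℝ] ℝ} (h : HasFDerivWithinAt (ext f) L (cyl T) z) : pd e f z = L e := by
  change fderivWithin ℝ _ _ _ _ = _
  rw [h.fderivWithin (uniqueDiffOn_cyl hT z z.2)]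

protected theorem Sm.hasFDerivWithinAt {f : cyl T → ℝ} (h : Sm 1 f) (z : cyl T) :
    HasFDerivWithinAt (ext f) (fderivWithin ℝ (ext f) (cyl T) z) (cyl T) z :=
  (h.differentiableOn z z.2).hasFDerivWithinAt

theorem hasFDerivWithinAt_ext {f : cyl T → ℝ} {g : SpaceTime → ℝ} {z : cyl T}
    {L : SpaceTime →L[ℝ] ℝ} (h : HasFDerivWithinAt g L (cyl T) z) (hfg : ∀ w : cyl T, f w = g w) :
    HasFDerivWithinAt (ext f) L (cyl T) z :=
  h.congr (fun w hw => by rw [ext_of_mem _ hw, hfg]) (by rw [ext_coe, hfg])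

protected theorem Sm.pd (hT : 0 < T) {n : ℕ} {f : cyl T → ℝ} (h : Sm (n + 1) f) (e : SpaceTime) :
    Sm n (pd e f) := by
  refine Sm.congr (g := fun z => fderivWithin ℝ (ext f) (cyl T) z e) ?_ fun _ => rfl
  exact (ContDiffOn.fderivWithin h (uniqueDiffOn_cyl hT) (by norm_cast)).clm_apply contDiffOn_const

theorem pd_add (hT : 0 < T) {e : SpaceTime} {f g : cyl T → ℝ} (hf : Sm 1 f) (hg : Sm 1 g) :
    pd e (f + g) = pd e f + pd e g := by
  funext z
  exact pd_eq_of_hasFDerivWithinAt hT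
    (hasFDerivWithinAt_ext ((hf.hasFDerivWithinAt z).add (hg.hasFDerivWithinAt z))
      fun w => by simp [ext_coe])

theorem pd_mul (hT : 0 < T) {e : SpaceTime} {f g : cyl T → ℝ} (hf : Sm 1 f) (hg : Sm 1 g) :
    pd e (f * g) = pd e f * g + f * pd e g := by
  funext z
  rw [pd_eq_of_hasFDerivWithinAt hT
    (hasFDerivWithinAt_ext ((hf.hasFDerivWithinAt z).mul (hg.hasFDerivWithinAt z))
      fun w => by simp [ext_coe])]
  simp [ext_coe, pd, res, dirDeriv]
  ring

theorem pd_const (e : SpaceTime) (c : ℝ) : pd e (fun _ : cyl T => c) = 0 := by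
  have : (fun _ : cyl T => c) = res T fun _ => c := rfl
  rw [this, pd_res]
  funext z
  simp [res, dirDeriv]

theorem pd_comp (hT : 0 < T) {e : SpaceTime} {φ : ℝ → ℝ} {f : cyl T → ℝ} (hf : Sm 1 f)
    {φ' : cyl T → ℝ} (hφ : ∀ z, HasDerivAt φ (φ' z) (f z)) :
    pd e (fun z => φ (f z)) = φ' * pd e f := by
  funext z
  have h1 : HasDerivAt φ (φ' z) (ext f z) := by rw [ext_coe]; exact hφ z
  rw [pd_eq_of_hasFDerivWithinAt hT
    (hasFDerivWithinAt_ext (h1.comp_hasFDerivWithinAt _ (hf.hasFDerivWithinAt z))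
      fun w => by simp [ext_coe])]
  simp [pd, res, dirDeriv]

theorem pd_inv (hT : 0 < T) {e : SpaceTime} {f : cyl T → ℝ} (hf : Sm 1 f) (h0 : ∀ z, f z ≠ 0) :
    pd e f⁻¹ = -(pd e f * f⁻¹ * f⁻¹) := by
  have := pd_comp hT (e := e) hf (φ := fun x => x⁻¹) (φ' := fun z => -((f z) ^ 2)⁻¹)
    fun z => hasDerivAt_inv (h0 z)
  have h2 : (fun z => (f z)⁻¹) = f⁻¹ := rfl
  rw [h2] at this
  rw [this]
  funext z
  have := h0 z
  simp only [Pi.mul_apply, Pi.neg_apply, Pi.inv_apply]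
  field_simp

theorem pd_pd_eq (hT : 0 < T) {f : cyl T → ℝ} (hf : Sm 2 f) (e e' : SpaceTime) (z : cyl T) :
    pd e (pd e' f) z = fderivWithin ℝ (fderivWithin ℝ (ext f) (cyl T)) (cyl T) z e e' := by
  have h1 : DifferentiableOn ℝ (fderivWithin ℝ (ext f) (cyl T)) (cyl T) :=
    (ContDiffOn.fderivWithin (m := 1) hf (uniqueDiffOn_cyl hT) (by norm_num)).differentiableOn
      (by norm_num)
  have h2 := (h1 z z.2).hasFDerivWithinAt
  have h3 := h2.clm_apply (hasFDerivWithinAt_const e' (z : SpaceTime) (cyl T))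
  rw [pd_eq_of_hasFDerivWithinAt hT (hasFDerivWithinAt_ext (f := pd e' f) h3 fun w => rfl)]
  simp

/-- Symmetry of second derivatives holds up to the boundary because the cylinder, being convex with
nonempty interior, lies in the closure of that interior. -/
theorem pd_comm (hT : 0 < T) {f : cyl T → ℝ} (hf : Sm 2 f) (e e' : SpaceTime) :
    pd e (pd e' f) = pd e' (pd e f) := by
  funext z
  rw [pd_pd_eq hT hf, pd_pd_eq hT hf]
  exact ContDiffWithinAt.isSymmSndFDerivWithinAt (n := 2) (hf z z.2) (by simp)
    (uniqueDiffOn_cyl hT) (mem_closure_interior_cyl hT z.2) z.2 e e'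

theorem zero_mem_cyl {z : SpaceTime} (hz : z ∈ cyl T) : ((0 : ℝ), z.2) ∈ cyl T :=
  ⟨⟨le_rfl, hz.1.1.trans hz.1.2⟩, hz.2⟩

/-- The value at time zero, as a function constant in time. -/
def atZero (f : cyl T → ℝ) : cyl T → ℝ := fun z => f ⟨(0, z.1.2), zero_mem_cyl z.2⟩

theorem mapsTo_atZero : Set.MapsTo (fun z : SpaceTime => ((0 : ℝ), z.2)) (cyl T) (cyl T) :=
  fun _ hz => zero_mem_cyl hz

protected theorem Sm.atZero {n : ℕ} {f : cyl T → ℝ} (hf : Sm n f) : Sm n (atZero f) :=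
  Sm.congr (ContDiffOn.comp hf (contDiffOn_const.prodMk contDiffOn_snd) mapsTo_atZero)
    fun _ => (ext_of_mem f _).symm

theorem pd_atZero (hT : 0 < T) {f : cyl T → ℝ} (hf : Sm 1 f) (e : SpaceTime) :
    pd e (atZero f) = atZero (pd (0, e.2) f) := by
  funext z
  have h1 : HasFDerivWithinAt (fun w : SpaceTime => ((0 : ℝ), w.2))
      ((0 : SpaceTime →L[ℝ] ℝ).prod (ContinuousLinearMap.snd ℝ ℝ (Fin 3 → ℝ))) (cyl T) z :=
    (hasFDerivWithinAt_const _ _ _).prodMk hasFDerivWithinAt_snd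
  have h2 := HasFDerivWithinAt.comp (g := ext f) (z : SpaceTime)
    (hf.hasFDerivWithinAt ⟨(0, z.1.2), zero_mem_cyl z.2⟩) h1 mapsTo_atZero
  rw [pd_eq_of_hasFDerivWithinAt hT (hasFDerivWithinAt_ext (f := atZero f) h2
    fun w => (ext_of_mem f _).symm)]
  simp [atZero, pd, res, dirDeriv]

theorem pd_zero_dir (f : cyl T → ℝ) : pd 0 f = 0 := by
  funext z
  simp [pd, res, dirDeriv]

/-- The normal coordinate `y₃`. -/
def ycoord : cyl T → ℝ := fun z => z.1.2 2

protected theorem Sm.ycoord (n : ℕ) : Sm n (ycoord : cyl T → ℝ) :=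
  Sm.congr (g := fun z => z.2 2)
    ((contDiff_apply ℝ ℝ (2 : Fin 3)).comp contDiff_snd).contDiffOn fun _ => rfl

theorem pd_ycoord (hT : 0 < T) (e : SpaceTime) : pd e (ycoord : cyl T → ℝ) = fun _ => e.2 2 := by
  funext z
  have h1 : HasFDerivWithinAt (fun w : SpaceTime => w.2 2)
      ((ContinuousLinearMap.proj (R := ℝ) (φ := fun _ : Fin 3 => ℝ) 2).comp
        (ContinuousLinearMap.snd ℝ ℝ (Fin 3 → ℝ))) (cyl T) z :=
    ((ContinuousLinearMap.proj (R := ℝ) (φ := fun _ : Fin 3 => ℝ) 2).comp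
        (ContinuousLinearMap.snd ℝ ℝ (Fin 3 → ℝ))).hasFDerivWithinAt
  rw [pd_eq_of_hasFDerivWithinAt hT (hasFDerivWithinAt_ext (f := ycoord) h1 fun w => rfl)]
  simp

end Restricted

open MeasureTheory Set
open scoped ENNReal

/-! ### Projection onto the fundamental cell -/

section Clamp

/-- The corners of the fundamental cell. -/
abbrev lo : Fin 3 → ℝ := ![0, 0, -1]

abbrev hi : Fin 3 → ℝ := ![1, 1, 1]

theorem lo_le_hi (i : Fin 3) : lo i ≤ hi i := by fin_cases i <;> simp

theorem lo_add_one_le_hi (i : Fin 3) : lo i + 1 ≤ hi i := by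
  fin_cases i <;> norm_num [lo, hi]

/-- The nearest-point projection onto the cell, coordinate by coordinate. -/
def clampY (y : Fin 3 → ℝ) : Fin 3 → ℝ := fun i => max (lo i) (min (hi i) (y i))

theorem continuous_clampY : Continuous clampY := by
  unfold clampY
  fun_prop

theorem clampY_mem (y : Fin 3 → ℝ) : clampY y ∈ cell :=
  ⟨fun _ => le_max_left _ _, fun i => max_le (lo_le_hi i) (min_le_left _ _)⟩

theorem clampY_of_mem {y : Fin 3 → ℝ} (hy : y ∈ cell) : clampY y = y := by
  funext i
  simp only [clampY]
  rw [min_eq_right (hy.2 i), max_eq_right (hy.1 i)]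

/-- `lmarginal` varies one coordinate of an arbitrary point, while the one-dimensional estimate runs
along a line inside the cell; after projection the two agree. -/
theorem clampY_update_clampY (y : Fin 3 → ℝ) (i : Fin 3) (x : ℝ) :
    clampY (Function.update (clampY y) i x) = clampY (Function.update y i x) := by
  funext j
  rcases eq_or_ne j i with rfl | hj
  · simp [clampY]
  · have := congrFun (clampY_of_mem (clampY_mem y)) j
    simpa [clampY, Function.update_of_ne hj] using this

theorem cell_subset_slab : cell ⊆ slab := fun y hy => by
  have h1 := hy.1 2
  have h2 := hy.2 2
  exact ⟨by simpa using h1, by simpa using h2⟩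

theorem isCompact_cell : IsCompact cell := isCompact_Icc

theorem measurableSet_cell : MeasurableSet cell := measurableSet_Icc

theorem mem_cyl_of_cell {T t : ℝ} (ht : t ∈ Icc 0 T) {y : Fin 3 → ℝ} (hy : y ∈ cell) :
    (t, y) ∈ cyl T := ⟨ht, cell_subset_slab hy⟩

/-- Projection of space-time onto `[0, T] × cell`. -/
def clamp (T : ℝ) (z : SpaceTime) : SpaceTime := (max 0 (min T z.1), clampY z.2)

theorem continuous_clamp (T : ℝ) : Continuous (clamp T) := by
  unfold clamp
  exact (by fun_prop : Continuous fun z : SpaceTime => max 0 (min T z.1)).prodMk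
    (continuous_clampY.comp continuous_snd)

theorem clamp_mem {T : ℝ} (hT : 0 < T) (z : SpaceTime) : clamp T z ∈ cyl T :=
  mem_cyl_of_cell ⟨le_max_left _ _, max_le hT.le (min_le_left _ _)⟩ (clampY_mem _)

theorem clamp_of_mem {T t : ℝ} (ht : t ∈ Icc 0 T) {y : Fin 3 → ℝ} (hy : y ∈ cell) :
    clamp T (t, y) = (t, y) := by
  simp only [clamp]
  rw [min_eq_right ht.2, max_eq_right ht.1, clampY_of_mem hy]

theorem clamp_of_time {T t : ℝ} (ht : t ∈ Icc 0 T) (y : Fin 3 → ℝ) :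
    clamp T (t, y) = (t, clampY y) := by
  simp only [clamp]
  rw [min_eq_right ht.2, max_eq_right ht.1]

variable {T : ℝ}

/-- Composing with the projection yields a function continuous on all of space-time and unchanged
over the cell, which settles measurability, joint integrability and continuity in the parameter. -/
protected theorem Sm.continuous_clamp (hT : 0 < T) {n : ℕ} {f : cyl T → ℝ} (hf : Sm n f) :
    Continuous fun z => ext f (clamp T z) :=
  hf.continuousOn.comp_continuous (FreeMHD.continuous_clamp T) (clamp_mem hT)

end Clamp

/-! ### Integrals over the cell: differentiation in time and the divergence theorem -/

section CellIntegral

variable {T : ℝ}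

/-- The integral over `Ω` at time `t`. -/
def cint (f : cyl T → ℝ) (t : ℝ) : ℝ := ∫ y in cell, ext f (t, y)

theorem cint_eq_clamp (f : cyl T → ℝ) {t : ℝ} (ht : t ∈ Icc 0 T) :
    cint f t = ∫ y in cell, ext f (clamp T (t, y)) :=
  setIntegral_congr_fun measurableSet_cell fun y hy => by simp only [clamp_of_mem ht hy]

protected theorem Sm.integrableOn {n : ℕ} {f : cyl T → ℝ} (hf : Sm n f) {t : ℝ} (ht : t ∈ Icc 0 T) :
    IntegrableOn (fun y => ext f (t, y)) cell := by
  refine ContinuousOn.integrableOn_compact isCompact_cell ?_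
  exact hf.continuousOn.comp (by fun_prop) fun y hy => mem_cyl_of_cell ht hy

theorem cint_add {n : ℕ} {f g : cyl T → ℝ} (hf : Sm n f) (hg : Sm n g) {t : ℝ}
    (ht : t ∈ Icc 0 T) : cint (f + g) t = cint f t + cint g t := by
  unfold cint
  rw [← integral_add (hf.integrableOn ht) (hg.integrableOn ht)]
  refine setIntegral_congr_fun measurableSet_cell fun y hy => ?_
  simp only [ext_of_mem _ (mem_cyl_of_cell ht hy), Pi.add_apply]

theorem cint_const_mul (c : ℝ) (f : cyl T → ℝ) {t : ℝ} (ht : t ∈ Icc 0 T) :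
    cint ((fun _ => c) * f) t = c * cint f t := by
  unfold cint
  rw [← integral_const_mul]
  refine setIntegral_congr_fun measurableSet_cell fun y hy => ?_
  simp only [ext_of_mem _ (mem_cyl_of_cell ht hy), Pi.mul_apply]

theorem cint_mono {n : ℕ} {f g : cyl T → ℝ} (hf : Sm n f) (hg : Sm n g) {t : ℝ}
    (ht : t ∈ Icc 0 T) (h : ∀ z : cyl T, z.1.1 = t → z.1.2 ∈ cell → f z ≤ g z) :
    cint f t ≤ cint g t := by
  refine setIntegral_mono_on (hf.integrableOn ht) (hg.integrableOn ht) measurableSet_cell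
    fun y hy => ?_
  rw [ext_of_mem _ (mem_cyl_of_cell ht hy), ext_of_mem _ (mem_cyl_of_cell ht hy)]
  exact h _ rfl hy

theorem cint_nonneg {f : cyl T → ℝ} {t : ℝ} (ht : t ∈ Icc 0 T) (h : ∀ z, 0 ≤ f z) :
    0 ≤ cint f t :=
  setIntegral_nonneg measurableSet_cell fun y hy => by
    rw [ext_of_mem _ (mem_cyl_of_cell ht hy)]; exact h _

theorem cint_congr {f g : cyl T → ℝ} {t : ℝ} (ht : t ∈ Icc 0 T)
    (h : ∀ z : cyl T, z.1.1 = t → z.1.2 ∈ cell → f z = g z) : cint f t = cint g t := by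
  refine setIntegral_congr_fun measurableSet_cell fun y hy => ?_
  simp only [ext_of_mem _ (mem_cyl_of_cell ht hy)]
  exact h _ rfl hy

protected theorem Sm.continuousOn_cint (hT : 0 < T) {n : ℕ} {f : cyl T → ℝ} (hf : Sm n f) :
    ContinuousOn (cint f) (Icc 0 T) := by
  have h : Continuous fun t => ∫ y in cell, ext f (clamp T (t, y)) :=
    continuous_parametric_integral_of_continuous (f := fun t y => ext f (clamp T (t, y)))
      (hf.continuous_clamp hT) isCompact_cell
  exact h.continuousOn.congr fun t ht => cint_eq_clamp f ht

/-- The unit vector of the time direction. -/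
abbrev eT : SpaceTime := (1, 0)

/-- The unit vectors of the space directions. -/
abbrev eX (i : Fin 3) : SpaceTime := (0, Pi.single i 1)

protected theorem Sm.hasDerivWithinAt_comp {f : cyl T → ℝ} (hf : Sm 1 f) {s : Set ℝ} {γ : ℝ → SpaceTime}
    {e : SpaceTime} {x : ℝ} (hγ : HasDerivWithinAt γ e s x) (hs : MapsTo γ s (cyl T))
    (hx : x ∈ s) : HasDerivWithinAt (fun x => ext f (γ x)) (ext (pd e f) (γ x)) s x := by
  have h := (hf.hasFDerivWithinAt ⟨γ x, hs hx⟩).comp_hasDerivWithinAt (f := γ) x hγ hs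
  rw [ext_of_mem _ (hs hx)]
  exact h

/-- The fundamental theorem of calculus on each line of constant `y`, followed by Fubini. One-sided
derivatives at the end times are harmless, since only interior times need a genuine derivative. -/
theorem cint_sub_cint_zero (hT : 0 < T) {f : cyl T → ℝ} (hf : Sm 1 f) :
    cint f T - cint f 0 = ∫ t in (0 : ℝ)..T, cint (pd eT f) t := by
  have h0 : (0 : ℝ) ∈ Icc 0 T := ⟨le_rfl, hT.le⟩
  have h1 : T ∈ Icc 0 T := ⟨hT.le, le_rfl⟩
  have hd : Sm 0 (pd eT f) := hf.pd hT _
  have hF : ∀ y ∈ cell, ∫ t in (0 : ℝ)..T, ext (pd eT f) (clamp T (t, y))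
      = ext f (T, y) - ext f (0, y) := by
    intro y hy
    have hm : MapsTo (fun t : ℝ => ((t, y) : SpaceTime)) (Icc 0 T) (cyl T) :=
      fun t ht => mem_cyl_of_cell ht hy
    have hγ : ∀ t, HasDerivAt (fun t : ℝ => ((t, y) : SpaceTime)) eT t := fun t =>
      (hasDerivAt_id t).prodMk (hasDerivAt_const t y)
    refine intervalIntegral.integral_eq_sub_of_hasDerivAt_of_le (f := fun t => ext f (t, y))
      hT.le ?_ ?_ ?_
    · exact hf.continuousOn.comp (by fun_prop) hm
    · intro t ht
      have h2 := hf.hasDerivWithinAt_comp (hγ t).hasDerivWithinAt hm (Ioo_subset_Icc_self ht)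
      rw [clamp_of_mem (Ioo_subset_Icc_self ht) hy]
      exact h2.hasDerivAt (Icc_mem_nhds ht.1 ht.2)
    · exact ((hd.continuous_clamp hT).comp (by fun_prop : Continuous fun t : ℝ =>
        ((t, y) : SpaceTime))).intervalIntegrable _ _
  have hsw : ∫ t in (0 : ℝ)..T, cint (pd eT f) t
      = ∫ y in cell, ∫ t in (0 : ℝ)..T, ext (pd eT f) (clamp T (t, y)) := by
    have e1 : ∫ t in (0 : ℝ)..T, cint (pd eT f) t
        = ∫ t in (0 : ℝ)..T, ∫ y in cell, ext (pd eT f) (clamp T (t, y)) := by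
      refine intervalIntegral.integral_congr fun t ht => ?_
      rw [uIcc_of_le hT.le] at ht
      exact cint_eq_clamp _ ht
    rw [e1]
    simp only [intervalIntegral.integral_of_le hT.le]
    refine integral_integral_swap (f := fun t y => ext (pd eT f) (clamp T (t, y))) ?_
    have hc := hd.continuous_clamp hT
    have : IntegrableOn (fun z : ℝ × (Fin 3 → ℝ) => ext (pd eT f) (clamp T z)) (Icc 0 T ×ˢ cell)
        (volume.prod volume) :=
      hc.continuousOn.integrableOn_compact (isCompact_Icc.prod isCompact_cell)
    rw [Measure.prod_restrict]
    exact this.mono_set (prod_mono_left Ioc_subset_Icc_self)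
  rw [hsw, setIntegral_congr_fun measurableSet_cell hF,
    integral_sub (hf.integrableOn h1) (hf.integrableOn h0)]
  rfl

theorem cell_eq : cell = Icc lo hi := rfl

theorem interior_cell_mem_nhds {y : Fin 3 → ℝ}
    (hy : y ∈ Set.pi univ fun i => Ioo (lo i) (hi i)) : cell ∈ nhds y := by
  rw [cell_eq]
  exact Filter.mem_of_superset
    ((isOpen_set_pi finite_univ fun i _ => isOpen_Ioo).mem_nhds hy)
    fun x hx => ⟨fun i => (hx i trivial).1.le, fun i => (hx i trivial).2.le⟩

/-- The divergence theorem for a field with one nonzero component. -/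
theorem cint_pd_space (hT : 0 < T) {f : cyl T → ℝ} (hf : Sm 1 f) {t : ℝ} (ht : t ∈ Icc 0 T)
    (i : Fin 3) : cint (pd (eX i) f) t
      = (∫ x in Icc (lo ∘ i.succAbove) (hi ∘ i.succAbove), ext f (t, i.insertNth (hi i) x))
        - ∫ x in Icc (lo ∘ i.succAbove) (hi ∘ i.succAbove), ext f (t, i.insertNth (lo i) x) := by
  have hslice : ∀ y ∈ Set.pi univ fun i => Ioo (lo i) (hi i),
      HasFDerivAt (fun y => ext f (t, y)) ((fderivWithin ℝ (ext f) (cyl T) (t, y)).comp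
        ((0 : (Fin 3 → ℝ) →L[ℝ] ℝ).prod (ContinuousLinearMap.id ℝ _))) y := by
    intro y hy
    have hn := interior_cell_mem_nhds hy
    have hyc : y ∈ cell := mem_of_mem_nhds hn
    have h1 : HasFDerivWithinAt (fun y : Fin 3 → ℝ => ((t, y) : SpaceTime))
        ((0 : (Fin 3 → ℝ) →L[ℝ] ℝ).prod (ContinuousLinearMap.id ℝ _)) cell y :=
      (hasFDerivWithinAt_const _ _ _).prodMk (hasFDerivWithinAt_id _ _)
    have h2 := HasFDerivWithinAt.comp (g := ext f) y
      (hf.hasFDerivWithinAt ⟨(t, y), mem_cyl_of_cell ht hyc⟩) h1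
      (fun x hx => mem_cyl_of_cell ht hx)
    exact h2.hasFDerivAt hn
  have hsl : ContinuousOn (fun y => ext f (t, y)) cell :=
    hf.continuousOn.comp (by fun_prop) fun y hy => mem_cyl_of_cell ht hy
  have hpd : ∀ y ∈ cell, ext (pd (eX i) f) (t, y)
      = fderivWithin ℝ (ext f) (cyl T) (t, y) (0, Pi.single i 1) := fun y hy =>
    ext_of_mem _ (mem_cyl_of_cell ht hy)
  -- The vector field has `f` in slot `i` and zero elsewhere. Differentiability is needed only in
  -- the open box, so one-sided derivatives on the faces suffice.
  have key := integral_divergence_of_hasFDerivAt_off_countable' (E := ℝ) lo hi lo_le_hi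
    (fun j y => if j = i then ext f (t, y) else 0)
    (fun j y => if j = i then (fderivWithin ℝ (ext f) (cyl T) (t, y)).comp
        ((0 : (Fin 3 → ℝ) →L[ℝ] ℝ).prod (ContinuousLinearMap.id ℝ _)) else 0) ∅ countable_empty
    (fun j => by
      by_cases hj : j = i
      · simpa [hj] using (cell_eq ▸ hsl)
      · simpa [hj] using continuousOn_const)
    (fun y hy j => by
      by_cases hj : j = i
      · simpa [hj] using hslice y hy.1
      · simpa [hj] using hasFDerivAt_const (0 : ℝ) y)
    (by
      have := (hf.pd hT (eX i) : Sm 0 _).integrableOn ht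
      refine this.congr_fun (fun y hy => ?_) measurableSet_cell
      simp only
      rw [hpd y hy, Finset.sum_eq_single i (fun j _ hj => by simp [hj]) (by simp)]
      simp)
  have e1 : cint (pd (eX i) f) t = ∫ y in Icc lo hi, ∑ j, (if j = i then
      (fderivWithin ℝ (ext f) (cyl T) (t, y)).comp
        ((0 : (Fin 3 → ℝ) →L[ℝ] ℝ).prod (ContinuousLinearMap.id ℝ _)) else 0)
        (Pi.single j 1) := by
    refine setIntegral_congr_fun measurableSet_cell fun y hy => ?_
    rw [hpd y hy, Finset.sum_eq_single i (fun j _ hj => by simp [hj]) (by simp)]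
    simp
  rw [e1, key, Finset.sum_eq_single i (fun j _ hj => by simp [hj]) (by simp)]
  simp

end CellIntegral

/-! ### Tangential periodicity and boundary integrals -/

section Periodic

variable {T : ℝ}

/-- Translation of space-time by a space vector. -/
abbrev shift (k : Fin 3) (z : SpaceTime) : SpaceTime := (z.1, z.2 + Pi.single k 1)

theorem shift_mem_cyl {k : Fin 3} (hk : k ≠ 2) {z : SpaceTime} (hz : z ∈ cyl T) :
    shift k z ∈ cyl T := by
  refine ⟨hz.1, ?_⟩
  have : (z.2 + Pi.single k 1 : Fin 3 → ℝ) 2 = z.2 2 := by simp [hk.symm]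
  change (z.2 + Pi.single k 1 : Fin 3 → ℝ) 2 ∈ Icc (-1 : ℝ) 1
  rw [this]
  exact hz.2

/-- Periodicity with period `1` in the tangential space variables. -/
def Pr (f : cyl T → ℝ) : Prop :=
  ∀ k : Fin 3, k ≠ 2 → ∀ z ∈ cyl T, ext f (shift k z) = ext f z

protected theorem Pr.of_res {f : SpaceTime → ℝ}
    (h : ∀ k : Fin 3, k ≠ 2 → ∀ z ∈ cyl T, f (z.1, z.2 + Pi.single k 1) = f z) :
    Pr (res T f) := fun k hk z hz => by
  rw [ext_of_mem _ (shift_mem_cyl hk hz), ext_of_mem _ hz]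
  exact h k hk z hz

theorem Pr.apply {f : cyl T → ℝ} (h : Pr f) {k : Fin 3} (hk : k ≠ 2) (z : cyl T) :
    f ⟨shift k z, shift_mem_cyl hk z.2⟩ = f z := by
  have := h k hk z z.2
  rwa [ext_of_mem _ (shift_mem_cyl hk z.2), ext_coe] at this

protected theorem Pr.intro {f : cyl T → ℝ}
    (h : ∀ (k : Fin 3) (hk : k ≠ 2) (z : cyl T), f ⟨shift k z, shift_mem_cyl hk z.2⟩ = f z) :
    Pr f := fun k hk z hz => by
  rw [ext_of_mem _ (shift_mem_cyl hk hz), ext_of_mem _ hz]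
  exact h k hk ⟨z, hz⟩

protected theorem Pr.add {f g : cyl T → ℝ} (hf : Pr f) (hg : Pr g) : Pr (f + g) :=
  Pr.intro fun k hk z => by simp only [Pi.add_apply, hf.apply hk, hg.apply hk]

protected theorem Pr.mul {f g : cyl T → ℝ} (hf : Pr f) (hg : Pr g) : Pr (f * g) :=
  Pr.intro fun k hk z => by simp only [Pi.mul_apply, hf.apply hk, hg.apply hk]

protected theorem Pr.neg {f : cyl T → ℝ} (hf : Pr f) : Pr (-f) :=
  Pr.intro fun k hk z => by simp only [Pi.neg_apply, hf.apply hk]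

protected theorem Pr.inv {f : cyl T → ℝ} (hf : Pr f) : Pr f⁻¹ :=
  Pr.intro fun k hk z => by simp only [Pi.inv_apply, hf.apply hk]

protected theorem Pr.const (c : ℝ) : Pr (fun _ : cyl T => c) := Pr.intro fun _ _ _ => rfl

protected theorem Pr.ycoord : Pr (ycoord : cyl T → ℝ) :=
  Pr.intro fun k hk z => by simp [ycoord, hk.symm]

/-- The derivatives of a function that is periodic up to a constant are periodic. -/
theorem Pr.pd_of_shift (hT : 0 < T) {f : cyl T → ℝ} (hf : Sm 1 f) (c : Fin 3 → ℝ)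
    (h : ∀ (k : Fin 3) (hk : k ≠ 2) (z : cyl T),
      f ⟨shift k z, shift_mem_cyl hk z.2⟩ = f z + c k) (e : SpaceTime) : Pr (pd e f) := by
  refine Pr.intro fun k hk z => ?_
  have h1 : HasFDerivWithinAt (shift k) (ContinuousLinearMap.id ℝ SpaceTime) (cyl T) z := by
    have : shift k = fun z => z + (0, Pi.single k 1) := by
      funext z
      ext <;> simp
    rw [this]
    exact (hasFDerivWithinAt_id _ _).add_const _
  have h2 := HasFDerivWithinAt.comp (g := ext f) (z : SpaceTime)
    (hf.hasFDerivWithinAt ⟨shift k z, shift_mem_cyl hk z.2⟩) h1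
    (fun w hw => shift_mem_cyl hk hw)
  have h3 := h2.sub_const (c k)
  rw [pd_eq_of_hasFDerivWithinAt hT (f := f) (z := z) (hasFDerivWithinAt_ext h3 fun w => ?_)]
  · rfl
  · simp only [Function.comp]
    rw [ext_of_mem _ (shift_mem_cyl hk w.2), h k hk w, add_sub_cancel_right]

protected theorem Pr.pd (hT : 0 < T) {f : cyl T → ℝ} (hf : Sm 1 f) (h : Pr f) (e : SpaceTime) :
    Pr (pd e f) :=
  Pr.pd_of_shift hT hf 0 (fun k hk z => by simpa using h.apply hk z) e

theorem insertNth_mem_cell {i : Fin 3} {x : Fin 2 → ℝ}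
    (hx : x ∈ Icc (lo ∘ i.succAbove) (hi ∘ i.succAbove)) {c : ℝ} (hc : c ∈ Icc (lo i) (hi i)) :
    (i.insertNth c x : Fin 3 → ℝ) ∈ cell := by
  rw [cell_eq, Fin.insertNth_mem_Icc]
  exact ⟨hc, hx⟩

/-- In a tangential direction the cell has length exactly one period, so the two opposite faces
cancel. -/
theorem cint_pd_tangential (hT : 0 < T) {f : cyl T → ℝ} (hf : Sm 1 f) (hp : Pr f) {t : ℝ}
    (ht : t ∈ Icc 0 T) {i : Fin 3} (hi2 : i ≠ 2) : cint (pd (eX i) f) t = 0 := by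
  rw [cint_pd_space hT hf ht, sub_eq_zero]
  refine setIntegral_congr_fun measurableSet_Icc fun x hx => ?_
  have hc : (t, (i.insertNth (lo i) x : Fin 3 → ℝ)) ∈ cyl T :=
    mem_cyl_of_cell ht (insertNth_mem_cell hx ⟨le_rfl, lo_le_hi i⟩)
  have h1 := hp i hi2 _ hc
  have h2 : (i.insertNth (hi i) x : Fin 3 → ℝ) = i.insertNth (lo i) x + Pi.single i 1 := by
    funext j
    refine Fin.succAboveCases i ?_ (fun j => ?_) j
    · have : hi i = lo i + 1 := by
        fin_cases i
        · simp
        · simp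
        · exact absurd rfl hi2
      simp [this]
    · simp [Fin.succAbove_ne]
  rw [h2]
  exact h1

theorem cint_pd_normal_eq_zero (hT : 0 < T) {f : cyl T → ℝ} (hf : Sm 1 f) {t : ℝ}
    (ht : t ∈ Icc 0 T) (h0 : ∀ z : cyl T, (z.1.2 2 = -1 ∨ z.1.2 2 = 1) → f z = 0) :
    cint (pd (eX 2) f) t = 0 := by
  rw [cint_pd_space hT hf ht]
  have hz : ∀ c : ℝ, (c = -1 ∨ c = 1) →
      ∫ x in Icc (lo ∘ (2 : Fin 3).succAbove) (hi ∘ (2 : Fin 3).succAbove),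
        ext f (t, (2 : Fin 3).insertNth c x) = 0 := by
    intro c hc
    rw [setIntegral_congr_fun (g := fun _ => (0 : ℝ)) measurableSet_Icc]
    · simp
    · intro x hx
      have hcm : c ∈ Icc (lo 2) (hi 2) := by rcases hc with rfl | rfl <;> simp
      simp only
      rw [ext_of_mem _ (mem_cyl_of_cell ht (insertNth_mem_cell hx hcm))]
      exact h0 _ (by simpa using hc)
  rw [hz _ (by simp), hz _ (by simp), sub_zero]

/-- The outward normal is `(0, 0, y₃)`, so the integral of `f` over both faces is the flux of the
field `(0, 0, y₃ f)`. -/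
theorem integralBdry_eq_cint (hT : 0 < T) {f : cyl T → ℝ} (hf : Sm 1 f) {t : ℝ}
    (ht : t ∈ Icc 0 T) :
    integralBdry (fun y => ext f (t, y)) = cint (pd (eX 2) (ycoord * f)) t := by
  rw [cint_pd_space hT ((Sm.ycoord 1).mul hf) ht]
  have hl : lo ∘ (2 : Fin 3).succAbove = (0 : Fin 2 → ℝ) := by
    funext j; fin_cases j <;> rfl
  have hh : hi ∘ (2 : Fin 3).succAbove = (1 : Fin 2 → ℝ) := by
    funext j; fin_cases j <;> rfl
  have hins : ∀ (c : ℝ) (x : Fin 2 → ℝ),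
      ((2 : Fin 3).insertNth c x : Fin 3 → ℝ) = ![x 0, x 1, c] := by
    intro c x
    funext j
    fin_cases j <;> rfl
  have hz : ∀ c : ℝ, (c = -1 ∨ c = 1) →
      ∫ x in Icc (lo ∘ (2 : Fin 3).succAbove) (hi ∘ (2 : Fin 3).succAbove),
        ext (ycoord * f) (t, (2 : Fin 3).insertNth c x)
      = c * ∫ x in Icc (0 : Fin 2 → ℝ) 1, ext f (t, ![x 0, x 1, c]) := by
    intro c hc
    rw [← integral_const_mul]
    rw [show Icc (0 : Fin 2 → ℝ) 1
      = Icc (lo ∘ (2 : Fin 3).succAbove) (hi ∘ (2 : Fin 3).succAbove) by rw [hl, hh]]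
    refine setIntegral_congr_fun measurableSet_Icc fun x hx => ?_
    have hcm : c ∈ Icc (lo 2) (hi 2) := by rcases hc with rfl | rfl <;> simp
    have hm := mem_cyl_of_cell ht (insertNth_mem_cell hx hcm)
    rw [← hins, ext_of_mem _ hm, ext_of_mem _ hm]
    simp [ycoord]
  rw [hz _ (by simp), hz _ (by simp), integralBdry, Finset.sum_pair (by norm_num)]
  simp
  ring

end Periodic

/-! ### Anisotropic Sobolev and product inequalities -/

section Sobolev

/-- Integrating `(u²)' = 2uu'` bounds `u(x)²` by `u(s)²` plus the integral of `u² + u'²`. Averaging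
over `s` gives the factor 2 once the interval has length at least one. -/
theorem sq_le_integral_of_hasDerivAt {α β : ℝ} (hαβ : α + 1 ≤ β) {u u' : ℝ → ℝ}
    (hu : Continuous u) (hu' : Continuous u')
    (hd : ∀ x ∈ Ioo α β, HasDerivAt u (u' x) x) {x : ℝ} (hx : x ∈ Icc α β) :
    u x ^ 2 ≤ 2 * ∫ s in α..β, (u s ^ 2 + u' s ^ 2) := by
  have hle : α ≤ β := by linarith
  have hg : Continuous fun s => u s ^ 2 + u' s ^ 2 := by fun_prop
  have hG : ∀ a b, IntervalIntegrable (fun s => u s ^ 2 + u' s ^ 2) volume a b :=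
    fun a b => hg.intervalIntegrable a b
  have hK : ∀ a b, IntervalIntegrable (fun s => 2 * u s * u' s) volume a b :=
    fun a b => (by fun_prop : Continuous fun s => 2 * u s * u' s).intervalIntegrable a b
  set I := ∫ s in α..β, (u s ^ 2 + u' s ^ 2) with hI
  have hftc : ∀ a b, α ≤ a → a ≤ b → b ≤ β →
      ∫ s in a..b, 2 * u s * u' s = u b ^ 2 - u a ^ 2 := by
    intro a b ha hab hb
    refine intervalIntegral.integral_eq_sub_of_hasDerivAt_of_le (f := fun s => u s ^ 2) hab
      (by fun_prop) (fun s hs => ?_) (hK a b)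
    have := (hd s ⟨lt_of_le_of_lt ha hs.1, lt_of_lt_of_le hs.2 hb⟩).pow 2
    simpa [Pi.pow_def] using this
  have hsub : ∀ a b, α ≤ a → a ≤ b → b ≤ β → ∫ s in a..b, (u s ^ 2 + u' s ^ 2) ≤ I := by
    intro a b ha hab hb
    exact intervalIntegral.integral_mono_interval ha hab hb
      (Filter.Eventually.of_forall fun s => by positivity) (hG α β)
  have hdiff : ∀ s ∈ Icc α β, u x ^ 2 ≤ u s ^ 2 + I := by
    intro s hs
    rcases le_total s x with h | h
    · have h1 := hftc s x hs.1 h hx.2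
      have h2 : ∫ r in s..x, 2 * u r * u' r ≤ ∫ r in s..x, (u r ^ 2 + u' r ^ 2) :=
        intervalIntegral.integral_mono_on h (hK s x) (hG s x)
          fun r _ => by nlinarith [sq_nonneg (u r - u' r)]
      have h3 := hsub s x hs.1 h hx.2
      linarith
    · have h1 := hftc x s hx.1 h hs.2
      have h2 : ∫ r in x..s, -(u r ^ 2 + u' r ^ 2) ≤ ∫ r in x..s, 2 * u r * u' r :=
        intervalIntegral.integral_mono_on h (hG x s).neg (hK x s)
          fun r _ => by nlinarith [sq_nonneg (u r + u' r)]
      rw [intervalIntegral.integral_neg] at h2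
      have h3 := hsub x s hx.1 h hs.2
      linarith
  have hint : ∫ _ in α..β, u x ^ 2 ≤ ∫ s in α..β, (u s ^ 2 + I) :=
    intervalIntegral.integral_mono_on hle (by simp)
      ((by fun_prop : Continuous fun s => u s ^ 2 + I).intervalIntegrable _ _) hdiff
  have hu2 : ∫ s in α..β, u s ^ 2 ≤ I :=
    intervalIntegral.integral_mono_on hle
      ((by fun_prop : Continuous fun s => u s ^ 2).intervalIntegrable _ _) (hG _ _)
      fun s _ => by nlinarith [sq_nonneg (u' s)]
  rw [intervalIntegral.integral_add
    ((by fun_prop : Continuous fun s => u s ^ 2).intervalIntegrable _ _) (by simp)] at hint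
  simp only [intervalIntegral.integral_const, smul_eq_mul] at hint
  have hI0 : 0 ≤ I := intervalIntegral.integral_nonneg hle fun s _ => by positivity
  have h4 : (β - α) * u x ^ 2 ≤ (β - α) * (2 * I) := by nlinarith
  exact le_of_mul_le_mul_left h4 (by linarith)

variable {T : ℝ}

/-- Lebesgue measure on the edges of the cell. -/
abbrev edge (i : Fin 3) : Measure ℝ := volume.restrict (Icc (lo i) (hi i))

theorem pi_edge : Measure.pi edge = (volume : Measure (Fin 3 → ℝ)).restrict cell := by
  rw [cell_eq, ← pi_univ_Icc, volume_pi, Measure.restrict_pi_pi]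

/-- The density `f(t, ·)²` on the cell, extended by projecting to the cell. -/
def dens (f : cyl T → ℝ) (t : ℝ) (y : Fin 3 → ℝ) : ℝ≥0∞ :=
  ENNReal.ofReal (ext f (clamp T (t, y)) ^ 2)

theorem measurable_dens (hT : 0 < T) {n : ℕ} {f : cyl T → ℝ} (hf : Sm n f) (t : ℝ) :
    Measurable (dens f t) := by
  have h : Continuous fun y : Fin 3 → ℝ => ext f (clamp T (t, y)) :=
    (hf.continuous_clamp hT).comp (by fun_prop)
  exact (ENNReal.continuous_ofReal.comp (h.pow 2)).measurable

theorem lintegral_dens (hT : 0 < T) {n : ℕ} {f : cyl T → ℝ} (hf : Sm n f) {t : ℝ}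
    (ht : t ∈ Icc 0 T) : ∫⁻ y, dens f t y ∂Measure.pi edge = ENNReal.ofReal (cint (f * f) t) := by
  rw [cint_eq_clamp _ ht, pi_edge, ofReal_integral_eq_lintegral_ofReal]
  · refine lintegral_congr fun y => ?_
    rw [dens, ext_of_mem _ (clamp_mem hT _), ext_of_mem _ (clamp_mem hT _), Pi.mul_apply, sq]
  · exact (((hf.mul hf).continuous_clamp hT).comp
      (by fun_prop : Continuous fun y : Fin 3 → ℝ => ((t, y) : SpaceTime))).continuousOn
      |>.integrableOn_compact isCompact_cell
  · refine Filter.Eventually.of_forall fun y => ?_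
    simp only [Pi.zero_apply]
    rw [ext_of_mem _ (clamp_mem hT _), Pi.mul_apply]
    exact mul_self_nonneg _

/-- The one-dimensional inequality along the line through the point in direction `i`; integration
over that line is the marginal in the single variable `i`. -/
theorem dens_le_lmarginal (hT : 0 < T) {f : cyl T → ℝ} (hf : Sm 1 f) {t : ℝ} (ht : t ∈ Icc 0 T)
    (i : Fin 3) :
    dens f t ≤ 2 • lmarginal edge {i} (dens f t + dens (pd (eX i) f) t) := by
  intro y
  have hd : Sm 0 (pd (eX i) f) := hf.pd hT _
  set c := clampY y with hc
  have hcc : c ∈ cell := clampY_mem y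
  have hup : ∀ x ∈ Icc (lo i) (hi i), Function.update c i x ∈ cell := by
    intro x hx
    rw [cell_eq]
    refine ⟨fun j => ?_, fun j => ?_⟩
    · rcases eq_or_ne j i with rfl | hj
      · simpa using hx.1
      · rw [Function.update_of_ne hj]; exact hcc.1 j
    · rcases eq_or_ne j i with rfl | hj
      · simpa using hx.2
      · rw [Function.update_of_ne hj]; exact hcc.2 j
  have hcu : Continuous fun x : ℝ => ((t, Function.update c i x) : SpaceTime) :=
    continuous_const.prodMk (continuous_const.update i continuous_id)
  have hγ : ∀ x, HasDerivAt (fun x : ℝ => ((t, Function.update c i x) : SpaceTime)) (eX i) x :=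
    fun x => (hasDerivAt_const x t).prodMk (hasDerivAt_update c i x)
  have key := sq_le_integral_of_hasDerivAt (lo_add_one_le_hi i)
    ((hf.continuous_clamp hT).comp hcu) ((hd.continuous_clamp hT).comp hcu)
    (fun x hx => by
      have hx' := Ioo_subset_Icc_self hx
      have h1 := hf.hasDerivWithinAt_comp (s := Icc (lo i) (hi i)) (hγ x).hasDerivWithinAt
        (fun r hr => mem_cyl_of_cell ht (hup r hr)) hx'
      have h2 := h1.hasDerivAt (Icc_mem_nhds hx.1 hx.2)
      simp only [Function.comp]
      rw [clamp_of_mem ht (hup x hx')]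
      refine h2.congr_of_eventuallyEq ?_
      filter_upwards [Icc_mem_nhds hx.1 hx.2] with r hr
      simp only [Function.comp, clamp_of_mem ht (hup r hr)])
    (show c i ∈ Icc (lo i) (hi i) from ⟨hcc.1 i, hcc.2 i⟩)
  simp only [Function.comp, Function.update_eq_self] at key
  rw [lmarginal_singleton]
  have e0 : dens f t y = ENNReal.ofReal (ext f (clamp T (t, c)) ^ 2) := by
    rw [dens, clamp_of_time ht, clamp_of_time ht, hc, clampY_of_mem (clampY_mem y)]
  rw [e0]
  refine (ENNReal.ofReal_le_ofReal key).trans (le_of_eq ?_)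
  rw [ENNReal.ofReal_mul (by norm_num), intervalIntegral.integral_of_le (lo_le_hi i),
    ← integral_Icc_eq_integral_Ioc, ofReal_integral_eq_lintegral_ofReal]
  · simp only [ENNReal.ofReal_ofNat, Pi.smul_apply, nsmul_eq_mul, Nat.cast_ofNat]
    congr 1
    refine lintegral_congr fun x => ?_
    rw [ENNReal.ofReal_add (sq_nonneg _) (sq_nonneg _), Pi.add_apply, dens, dens]
    simp only [clamp_of_time ht, hc, clampY_update_clampY]
  · exact ((((hf.continuous_clamp hT).comp hcu).pow 2).add
      (((hd.continuous_clamp hT).comp hcu).pow 2)).continuousOn.integrableOn_compact isCompact_Icc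
  · exact Filter.Eventually.of_forall fun x => by positivity

theorem lmarginal_nsmul (s : Finset (Fin 3)) (c : ℕ) {f : (Fin 3 → ℝ) → ℝ≥0∞}
    (hf : Measurable f) : lmarginal edge s (c • f) = c • lmarginal edge s f := by
  funext x
  simp only [lmarginal, Pi.smul_apply, nsmul_eq_mul]
  exact lintegral_const_mul _ (hf.comp measurable_updateFinset)

theorem lmarginal_add (s : Finset (Fin 3)) {f g : (Fin 3 → ℝ) → ℝ≥0∞}
    (hf : Measurable f) : lmarginal edge s (f + g) = lmarginal edge s f + lmarginal edge s g := by
  funext x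
  simp only [lmarginal, Pi.add_apply]
  exact lintegral_add_left (hf.comp measurable_updateFinset) _

/-- Directions are spent one at a time: each new one adds a variable to the marginal and multiplies
the constant. -/
theorem lmarginal_step {s : Finset (Fin 3)} {i : Fin 3} (hi' : i ∉ s) {a b : ℕ}
    {f g h : (Fin 3 → ℝ) → ℝ≥0∞} (hh : Measurable h)
    (hfg : f ≤ a • lmarginal edge s g) (hgh : g ≤ b • lmarginal edge {i} h) :
    f ≤ (a * b) • lmarginal edge (insert i s) h := by
  have h1 : lmarginal edge s g ≤ b • lmarginal edge (insert i s) h := by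
    refine (lmarginal_mono hgh).trans (le_of_eq ?_)
    rw [lmarginal_nsmul _ _ (hh.lmarginal _), Finset.insert_eq, Finset.union_comm,
      lmarginal_union _ _ hh (Finset.disjoint_singleton_right.2 hi')]
  refine hfg.trans ?_
  rw [mul_smul]
  exact nsmul_le_nsmul_right h1 a

/-- A marginal does not depend on the variables it integrates out. As `s` and `t` are complementary,
the two factors depend on disjoint sets of variables and Tonelli separates them. -/
theorem lintegral_lmarginal_mul (s t : Finset (Fin 3)) (hst : Disjoint s t)
    (hu : s ∪ t = Finset.univ) {f g : (Fin 3 → ℝ) → ℝ≥0∞} (hf : Measurable f)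
    (hg : Measurable g) :
    ∫⁻ y, lmarginal edge s f y * lmarginal edge t g y ∂Measure.pi edge
      = (∫⁻ y, f y ∂Measure.pi edge) * ∫⁻ y, g y ∂Measure.pi edge := by
  have hm : Measurable fun y => lmarginal edge s f y * lmarginal edge t g y :=
    (hf.lmarginal _).mul (hg.lmarginal _)
  have hupd : ∀ (r : Finset (Fin 3)) (k : (Fin 3 → ℝ) → ℝ≥0∞) (x : Fin 3 → ℝ) (w : r → ℝ),
      lmarginal edge r k (Function.updateFinset x r w) = lmarginal edge r k x := by
    intro r k x w
    refine lmarginal_congr _ _ fun i hi => ?_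
    simp [Function.updateFinset, hi]
  have hin : lmarginal edge s (fun y => lmarginal edge s f y * lmarginal edge t g y)
      = fun y => lmarginal edge s f y * ∫⁻ y, g y ∂Measure.pi edge := by
    funext x
    rw [lmarginal]
    simp only [hupd]
    refine (lintegral_const_mul _ ((hg.lmarginal edge).comp measurable_updateFinset)).trans ?_
    congr 1
    have := congrFun (lmarginal_union edge g hg hst) x
    rw [hu, lmarginal_univ] at this
    exact this.symm
  rw [lintegral_eq_lmarginal_univ (0 : Fin 3 → ℝ), ← hu, Finset.union_comm,
    lmarginal_union _ _ hm hst.symm, hin]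
  refine (lintegral_mul_const _ ((hf.lmarginal edge).comp measurable_updateFinset)).trans ?_
  congr 1
  have := congrFun (lmarginal_union edge f hf hst.symm) 0
  rw [Finset.union_comm, hu, lmarginal_univ] at this
  exact this.symm

/-- A Hölder-free product estimate: one factor pays with derivatives in the directions `s`, the
other with derivatives in the remaining directions. -/
theorem lintegral_mul_le (s t : Finset (Fin 3)) (hst : Disjoint s t)
    (hu : s ∪ t = Finset.univ) {a b : ℕ} {f g F G : (Fin 3 → ℝ) → ℝ≥0∞} (hF : Measurable F)
    (hG : Measurable G) (hf : f ≤ a • lmarginal edge s F) (hg : g ≤ b • lmarginal edge t G) :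
    ∫⁻ y, f y * g y ∂Measure.pi edge
      ≤ (a * b : ℕ) * ((∫⁻ y, F y ∂Measure.pi edge) * ∫⁻ y, G y ∂Measure.pi edge) := by
  rw [← lintegral_lmarginal_mul s t hst hu hF hG]
  refine le_trans ?_ (lintegral_const_mul _ ((hF.lmarginal edge).mul (hG.lmarginal edge))).le
  refine lintegral_mono fun y => (mul_le_mul' (hf y) (hg y)).trans (le_of_eq ?_)
  simp only [Pi.smul_apply, Pi.mul_apply, nsmul_eq_mul, Nat.cast_mul]
  ring

/-- The integral of `f² + (∂_i f)²`. -/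
def sobOne (i : Fin 3) (f : cyl T → ℝ) (t : ℝ) : ℝ :=
  cint (f * f) t + cint (pd (eX i) f * pd (eX i) f) t

/-- The mixed second-order Sobolev norm in the directions `i` and `j`. -/
def sobTwo (i j : Fin 3) (f : cyl T → ℝ) (t : ℝ) : ℝ := sobOne j f t + sobOne j (pd (eX i) f) t

/-- The mixed third-order Sobolev norm. -/
def sobThree (f : cyl T → ℝ) (t : ℝ) : ℝ := sobTwo 1 2 f t + sobTwo 1 2 (pd (eX 0) f) t

theorem cint_mul_self_nonneg (f : cyl T → ℝ) {t : ℝ} (ht : t ∈ Icc 0 T) : 0 ≤ cint (f * f) t :=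
  cint_nonneg ht fun _ => mul_self_nonneg _

theorem sobOne_nonneg (i : Fin 3) (f : cyl T → ℝ) {t : ℝ} (ht : t ∈ Icc 0 T) :
    0 ≤ sobOne i f t := add_nonneg (cint_mul_self_nonneg _ ht) (cint_mul_self_nonneg _ ht)

theorem sobTwo_nonneg (i j : Fin 3) (f : cyl T → ℝ) {t : ℝ} (ht : t ∈ Icc 0 T) :
    0 ≤ sobTwo i j f t := add_nonneg (sobOne_nonneg _ _ ht) (sobOne_nonneg _ _ ht)

theorem sobThree_nonneg (f : cyl T → ℝ) {t : ℝ} (ht : t ∈ Icc 0 T) : 0 ≤ sobThree f t :=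
  add_nonneg (sobTwo_nonneg _ _ _ ht) (sobTwo_nonneg _ _ _ ht)

/-- The density of `sobOne`. -/
def densOne (i : Fin 3) (f : cyl T → ℝ) (t : ℝ) : (Fin 3 → ℝ) → ℝ≥0∞ :=
  dens f t + dens (pd (eX i) f) t

/-- The density of `sobTwo`. -/
def densTwo (i j : Fin 3) (f : cyl T → ℝ) (t : ℝ) : (Fin 3 → ℝ) → ℝ≥0∞ :=
  densOne j f t + densOne j (pd (eX i) f) t

/-- The density of `sobThree`. -/
def densThree (f : cyl T → ℝ) (t : ℝ) : (Fin 3 → ℝ) → ℝ≥0∞ :=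
  densTwo 1 2 f t + densTwo 1 2 (pd (eX 0) f) t

theorem measurable_densOne (hT : 0 < T) {f : cyl T → ℝ} (hf : Sm 1 f) (i : Fin 3) (t : ℝ) :
    Measurable (densOne i f t) :=
  (measurable_dens hT hf t).add (measurable_dens hT (hf.pd hT (n := 0) _) t)

theorem measurable_densTwo (hT : 0 < T) {f : cyl T → ℝ} (hf : Sm 2 f) (i j : Fin 3) (t : ℝ) :
    Measurable (densTwo i j f t) :=
  (measurable_densOne hT (hf.mono (by norm_num)) _ t).add
    (measurable_densOne hT (hf.pd hT (n := 1) _) _ t)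

theorem measurable_densThree (hT : 0 < T) {f : cyl T → ℝ} (hf : Sm 3 f) (t : ℝ) :
    Measurable (densThree f t) :=
  (measurable_densTwo hT (hf.mono (by norm_num)) _ _ t).add
    (measurable_densTwo hT (hf.pd hT (n := 2) _) _ _ t)

theorem lintegral_densOne (hT : 0 < T) {f : cyl T → ℝ} (hf : Sm 1 f) (i : Fin 3) {t : ℝ}
    (ht : t ∈ Icc 0 T) :
    ∫⁻ y, densOne i f t y ∂Measure.pi edge = ENNReal.ofReal (sobOne i f t) := by
  have hd : Sm 0 (pd (eX i) f) := hf.pd hT _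
  refine (lintegral_add_left (measurable_dens hT hf t) _).trans ?_
  rw [lintegral_dens hT hf ht, lintegral_dens hT hd ht, sobOne, ENNReal.ofReal_add
    (cint_mul_self_nonneg _ ht) (cint_mul_self_nonneg _ ht)]

theorem lintegral_densTwo (hT : 0 < T) {f : cyl T → ℝ} (hf : Sm 2 f) (i j : Fin 3) {t : ℝ}
    (ht : t ∈ Icc 0 T) :
    ∫⁻ y, densTwo i j f t y ∂Measure.pi edge = ENNReal.ofReal (sobTwo i j f t) := by
  have hd : Sm 1 (pd (eX i) f) := hf.pd hT _
  have hf1 : Sm 1 f := hf.mono (by norm_num)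
  refine (lintegral_add_left (measurable_densOne hT hf1 _ t) _).trans ?_
  rw [lintegral_densOne hT hf1 _ ht, lintegral_densOne hT hd _ ht, sobTwo, ENNReal.ofReal_add
    (sobOne_nonneg _ _ ht) (sobOne_nonneg _ _ ht)]

theorem lintegral_densThree (hT : 0 < T) {f : cyl T → ℝ} (hf : Sm 3 f) {t : ℝ}
    (ht : t ∈ Icc 0 T) :
    ∫⁻ y, densThree f t y ∂Measure.pi edge = ENNReal.ofReal (sobThree f t) := by
  have hd : Sm 2 (pd (eX 0) f) := hf.pd hT _
  have hf1 : Sm 2 f := hf.mono (by norm_num)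
  refine (lintegral_add_left (measurable_densTwo hT hf1 _ _ t) _).trans ?_
  rw [lintegral_densTwo hT hf1 _ _ ht, lintegral_densTwo hT hd _ _ ht, sobThree,
    ENNReal.ofReal_add (sobTwo_nonneg _ _ _ ht) (sobTwo_nonneg _ _ _ ht)]

theorem densOne_le (hT : 0 < T) {f : cyl T → ℝ} (hf : Sm 2 f) {t : ℝ} (ht : t ∈ Icc 0 T)
    (i j : Fin 3) : densOne i f t ≤ 2 • lmarginal edge {j} (densTwo i j f t) := by
  have hd : Sm 1 (pd (eX i) f) := hf.pd hT _
  have hf1 : Sm 1 f := hf.mono (by norm_num)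
  rw [densTwo, lmarginal_add _ (measurable_densOne hT hf1 _ t), smul_add]
  exact add_le_add (dens_le_lmarginal hT hf1 ht j) (dens_le_lmarginal hT hd ht j)

theorem dens_le_two (hT : 0 < T) {f : cyl T → ℝ} (hf : Sm 2 f) {t : ℝ} (ht : t ∈ Icc 0 T)
    {i j : Fin 3} (hij : j ≠ i) :
    dens f t ≤ 4 • lmarginal edge {j, i} (densTwo i j f t) :=
  lmarginal_step (by simpa using hij) (measurable_densTwo hT hf i j t)
    (dens_le_lmarginal hT (hf.mono (by norm_num)) ht i) (densOne_le hT hf ht i j)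

theorem dens_le_three (hT : 0 < T) {f : cyl T → ℝ} (hf : Sm 3 f) {t : ℝ} (ht : t ∈ Icc 0 T) :
    dens f t ≤ 8 • lmarginal edge {2, 1, 0} (densThree f t) := by
  have hd : Sm 2 (pd (eX 0) f) := hf.pd hT _
  have hf2 : Sm 2 f := hf.mono (by norm_num)
  have h2 : densTwo 0 1 f t ≤ 2 • lmarginal edge {2} (densThree f t) := by
    rw [densThree, lmarginal_add _ (measurable_densTwo hT hf2 _ _ t), smul_add]
    exact add_le_add (densOne_le hT hf2 ht 1 2) (densOne_le hT hd ht 1 2)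
  exact lmarginal_step (a := 4) (by decide) (measurable_densThree hT hf t)
    (dens_le_two hT hf2 ht (by decide)) h2

theorem dens_mul (hT : 0 < T) (f g : cyl T → ℝ) (t : ℝ) (y : Fin 3 → ℝ) :
    dens (f * g) t y = dens f t y * dens g t y := by
  rw [dens, dens, dens, ← ENNReal.ofReal_mul (sq_nonneg _), ← mul_pow,
    ext_of_mem _ (clamp_mem hT _), ext_of_mem _ (clamp_mem hT _), ext_of_mem _ (clamp_mem hT _),
    Pi.mul_apply]

/-- The anisotropic product estimate. -/
theorem cint_mul_sq_le (hT : 0 < T) {f g : cyl T → ℝ} (hf : Sm 2 f) (hg : Sm 1 g) {t : ℝ}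
    (ht : t ∈ Icc 0 T) {i j k : Fin 3} (hij : j ≠ i) (hik : i ≠ k) (hjk : j ≠ k) :
    cint (f * g * (f * g)) t ≤ 8 * (sobTwo i j f t * sobOne k g t) := by
  have hfg : Sm 1 (f * g) := (hf.mono (by norm_num)).mul hg
  -- The factor `f` is made bounded in the directions `i` and `j`, the factor `g` in the direction
  -- `k`; hence the asymmetric smoothness assumptions.
  have h := lintegral_mul_le {j, i} {k} (by simp [hik.symm, hjk.symm])
    (by revert i j k; decide) (measurable_densTwo hT hf i j t) (measurable_densOne hT hg k t)
    (dens_le_two hT hf ht hij) (dens_le_lmarginal hT hg ht k)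
  rw [lintegral_densTwo hT hf _ _ ht, lintegral_densOne hT hg _ ht,
    ← ENNReal.ofReal_mul (sobTwo_nonneg _ _ _ ht)] at h
  simp only [← dens_mul hT] at h
  rw [lintegral_dens hT hfg ht, ← ENNReal.ofReal_natCast,
    ← ENNReal.ofReal_mul (by positivity)] at h
  have hnn : 0 ≤ sobTwo i j f t * sobOne k g t :=
    mul_nonneg (sobTwo_nonneg _ _ _ ht) (sobOne_nonneg _ _ ht)
  have := (ENNReal.ofReal_le_ofReal_iff (by positivity)).1 h
  simpa using this

/-- The anisotropic Sobolev embedding. -/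
theorem sq_le_sobThree (hT : 0 < T) {f : cyl T → ℝ} (hf : Sm 3 f) {z : cyl T}
    (hz : z.1.2 ∈ cell) : f z ^ 2 ≤ 8 * sobThree f z.1.1 := by
  have ht := z.2.1
  have h := dens_le_three hT hf ht z.1.2
  have hu : ({2, 1, 0} : Finset (Fin 3)) = Finset.univ := by decide
  rw [Pi.smul_apply, hu, lmarginal_univ, lintegral_densThree hT hf ht, dens,
    clamp_of_mem ht hz, ext_of_mem _ z.2, nsmul_eq_mul, ← ENNReal.ofReal_natCast,
    ← ENNReal.ofReal_mul (by positivity)] at h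
  have hnn := sobThree_nonneg f ht
  simpa using (ENNReal.ofReal_le_ofReal_iff (by positivity)).1 h

end Sobolev

/-! ### Families indexed by solutions, polynomial bounds, and the five derivations -/

section Family

/-- The solutions considered, for fixed bounds on the equation of state. -/
structure Sol (A₀ ρ₁ ρ₂ : ℝ) where
  T : ℝ
  c₀ : ℝ
  R : ℝ → ℝ
  b₀ : (Fin 3 → ℝ) → Fin 3 → ℝ
  η : SpaceTime → Fin 3 → ℝ
  v : SpaceTime → Fin 3 → ℝ
  q : SpaceTime → ℝ
  one_lt : 1 < A₀
  ρ₁_pos : 0 < ρ₁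
  ρ₁_lt : ρ₁ < ρ₂
  T_pos : 0 < T
  c₀_pos : 0 < c₀
  liquid : IsLiquid T A₀ ρ₁ ρ₂ R q
  isSol : IsSolution T c₀ R b₀ η v q

/-- Families of functions on the space-time domain, indexed by the solutions. -/
abbrev Fam (A₀ ρ₁ ρ₂ : ℝ) : Type := (s : Sol A₀ ρ₁ ρ₂) → cyl s.T → ℝ

variable {A₀ ρ₁ ρ₂ : ℝ}

/-- The energy of a solution. -/
def En (s : Sol A₀ ρ₁ ρ₂) (t : ℝ) : ℝ := energy s.T s.b₀ s.η s.v s.q t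

theorem l2Sq_nonneg (f : SpaceTime → ℝ) (t : ℝ) : 0 ≤ l2Sq f t :=
  integral_nonneg fun _ => sq_nonneg _

theorem starSq_nonneg (T : ℝ) (m : ℕ) (f : SpaceTime → ℝ) (t : ℝ) : 0 ≤ starSq T m f t :=
  Finset.sum_nonneg fun _ _ => l2Sq_nonneg _ _

theorem bdrySq_nonneg (f : SpaceTime → ℝ) (t : ℝ) : 0 ≤ bdrySq f t := by
  unfold bdrySq integralBdry
  exact Finset.sum_nonneg fun _ _ => integral_nonneg fun _ => sq_nonneg _

theorem En_nonneg (s : Sol A₀ ρ₁ ρ₂) (t : ℝ) : 0 ≤ En s t := by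
  have h1 : 0 ≤ ∑ i, starSq s.T 8 (fun z => s.η z i) t :=
    Finset.sum_nonneg fun _ _ => starSq_nonneg _ _ _ _
  have h2 : 0 ≤ ∑ i, starSq s.T 8 (fun z => s.v z i) t :=
    Finset.sum_nonneg fun _ _ => starSq_nonneg _ _ _ _
  have h3 : 0 ≤ ∑ i, starSq s.T 8 (fun z => mag s.T s.b₀ s.η z i) t :=
    Finset.sum_nonneg fun _ _ => starSq_nonneg _ _ _ _
  have h4 : 0 ≤ ∑ I ∈ indicesEq 8, bdrySq (bdryUnknown s.T s.η I) t :=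
    Finset.sum_nonneg fun _ _ => bdrySq_nonneg _ _
  have h5 := starSq_nonneg s.T 8 (totalP s.T s.b₀ s.η s.q) t
  unfold En energy
  linarith

/-- The size of a solution at time `t`, including its initial size. -/
def Mg (s : Sol A₀ ρ₁ ρ₂) (t : ℝ) : ℝ := 1 + En s 0 + En s t

theorem one_le_Mg (s : Sol A₀ ρ₁ ρ₂) (t : ℝ) : 1 ≤ Mg s t := by
  have h1 := En_nonneg s 0
  have h2 := En_nonneg s t
  unfold Mg
  linarith

/-- Allows a bound at time zero to be read as a bound at any time, at the price of a factor 2 per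
power. -/
theorem Mg_zero_le (s : Sol A₀ ρ₁ ρ₂) (t : ℝ) : Mg s 0 ≤ 2 * Mg s t := by
  have h1 := En_nonneg s 0
  have h2 := En_nonneg s t
  unfold Mg
  linarith

/-- Quantities bounded by a polynomial in the size of the solution, uniformly in the solution. -/
def PolyBd (φ : Sol A₀ ρ₁ ρ₂ → ℝ → ℝ) : Prop :=
  ∃ (C : ℝ) (k : ℕ), 0 ≤ C ∧ ∀ s, ∀ t ∈ Icc 0 s.T, φ s t ≤ C * Mg s t ^ k

theorem PolyBd.mono {φ ψ : Sol A₀ ρ₁ ρ₂ → ℝ → ℝ} (h : PolyBd ψ)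
    (hle : ∀ s, ∀ t ∈ Icc 0 s.T, φ s t ≤ ψ s t) : PolyBd φ := by
  obtain ⟨C, k, hC, h⟩ := h
  exact ⟨C, k, hC, fun s t ht => (hle s t ht).trans (h s t ht)⟩

theorem PolyBd.const (c : ℝ) : PolyBd fun (_ : Sol A₀ ρ₁ ρ₂) _ => c :=
  ⟨|c|, 0, abs_nonneg _, fun _ _ _ => by simpa using le_abs_self c⟩

theorem PolyBd.add {φ ψ : Sol A₀ ρ₁ ρ₂ → ℝ → ℝ} (h : PolyBd φ) (h' : PolyBd ψ) :
    PolyBd fun s t => φ s t + ψ s t := by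
  obtain ⟨C, k, hC, h⟩ := h
  obtain ⟨C', k', hC', h'⟩ := h'
  refine ⟨C + C', k + k', by positivity, fun s t ht => ?_⟩
  have hM := one_le_Mg s t
  have h1 : Mg s t ^ k ≤ Mg s t ^ (k + k') := pow_le_pow_right₀ hM (by omega)
  have h2 : Mg s t ^ k' ≤ Mg s t ^ (k + k') := pow_le_pow_right₀ hM (by omega)
  nlinarith [h s t ht, h' s t ht, mul_le_mul_of_nonneg_left h1 hC,
    mul_le_mul_of_nonneg_left h2 hC']

theorem PolyBd.mul {φ ψ : Sol A₀ ρ₁ ρ₂ → ℝ → ℝ} (h : PolyBd φ) (h' : PolyBd ψ)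
    (h0 : ∀ s, ∀ t ∈ Icc 0 s.T, 0 ≤ ψ s t) : PolyBd fun s t => φ s t * ψ s t := by
  obtain ⟨C, k, hC, h⟩ := h
  obtain ⟨C', k', hC', h'⟩ := h'
  refine ⟨C * C', k + k', by positivity, fun s t ht => ?_⟩
  have hM : 0 ≤ Mg s t := zero_le_one.trans (one_le_Mg s t)
  calc φ s t * ψ s t ≤ C * Mg s t ^ k * (C' * Mg s t ^ k') :=
        mul_le_mul (h s t ht) (h' s t ht) (h0 s t ht) (by positivity)
    _ = C * C' * Mg s t ^ (k + k') := by ring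

theorem PolyBd.const_mul {φ : Sol A₀ ρ₁ ρ₂ → ℝ → ℝ} (h : PolyBd φ) {c : ℝ} (hc : 0 ≤ c) :
    PolyBd fun s t => c * φ s t := by
  obtain ⟨C, k, hC, h⟩ := h
  refine ⟨c * C, k, by positivity, fun s t ht => ?_⟩
  rw [mul_assoc]
  exact mul_le_mul_of_nonneg_left (h s t ht) hc

/-- Regularity `C^n` of every member of a family. -/
def Reg (n : ℕ) (f : Fam A₀ ρ₁ ρ₂) : Prop := ∀ s, Sm n (f s)

/-- Tangential periodicity of every member of a family. -/
def Per (f : Fam A₀ ρ₁ ρ₂) : Prop := ∀ s, Pr (f s)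

/-- Directional derivative of a family. -/
def P (e : SpaceTime) (f : Fam A₀ ρ₁ ρ₂) : Fam A₀ ρ₁ ρ₂ := fun s => pd e (f s)

/-- The normal coordinate. -/
def Yc : Fam A₀ ρ₁ ρ₂ := fun _ => ycoord

/-- The directions of the five derivations `∂_t, ∂₁, ∂₂, ∂₃, σ∂₃`. -/
def vec : Fin 5 → SpaceTime := ![eT, eX 0, eX 1, eX 2, eX 2]

/-- The coefficients of the five derivations. -/
def cf : Fin 5 → Fam A₀ ρ₁ ρ₂ := ![1, 1, 1, 1, 1 - Yc * Yc]

/-- The five derivations `∂_t, ∂₁, ∂₂, ∂₃, σ∂₃`. -/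
def D (d : Fin 5) (f : Fam A₀ ρ₁ ρ₂) : Fam A₀ ρ₁ ρ₂ := cf d * P (vec d) f

/-- The anisotropic weights of the five derivations. -/
def wt : Fin 5 → ℕ := ![1, 1, 1, 2, 1]

theorem one_le_wt (d : Fin 5) : 1 ≤ wt d := by fin_cases d <;> simp [wt]

theorem D_zero_eq (f : Fam A₀ ρ₁ ρ₂) : D 0 f = P eT f := one_mul _

theorem D_one_eq (f : Fam A₀ ρ₁ ρ₂) : D 1 f = P (eX 0) f := one_mul _

theorem D_two_eq (f : Fam A₀ ρ₁ ρ₂) : D 2 f = P (eX 1) f := one_mul _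

theorem D_three_eq (f : Fam A₀ ρ₁ ρ₂) : D 3 f = P (eX 2) f := one_mul _

theorem D_four_eq (f : Fam A₀ ρ₁ ρ₂) : D 4 f = (1 - Yc * Yc) * D 3 f := by
  rw [D_three_eq]; rfl

section RegPer

variable {f g : Fam A₀ ρ₁ ρ₂} {m n : ℕ}

protected theorem Reg.mono (h : Reg n f) (hmn : m ≤ n) : Reg m f := fun s => (h s).mono hmn

protected theorem Reg.add (hf : Reg n f) (hg : Reg n g) : Reg n (f + g) :=
  fun s => (hf s).add (hg s)

protected theorem Reg.mul (hf : Reg n f) (hg : Reg n g) : Reg n (f * g) :=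
  fun s => (hf s).mul (hg s)

protected theorem Reg.neg (hf : Reg n f) : Reg n (-f) := fun s => (hf s).neg

protected theorem Reg.sub (hf : Reg n f) (hg : Reg n g) : Reg n (f - g) := by
  rw [sub_eq_add_neg]; exact hf.add hg.neg

protected theorem Reg.const (n : ℕ) (c : ℝ) : Reg n (fun _ _ => c : Fam A₀ ρ₁ ρ₂) :=
  fun _ => Sm.const n c

protected theorem Reg.zero (n : ℕ) : Reg n (0 : Fam A₀ ρ₁ ρ₂) := Reg.const n 0

protected theorem Reg.one (n : ℕ) : Reg n (1 : Fam A₀ ρ₁ ρ₂) := Reg.const n 1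

protected theorem Reg.ofNat (n k : ℕ) [k.AtLeastTwo] :
    Reg n (OfNat.ofNat k : Fam A₀ ρ₁ ρ₂) := Reg.const n (OfNat.ofNat k)

protected theorem Reg.Yc (n : ℕ) : Reg n (Yc : Fam A₀ ρ₁ ρ₂) := fun _ => Sm.ycoord n

protected theorem Reg.cf (n : ℕ) (d : Fin 5) : Reg n (cf d : Fam A₀ ρ₁ ρ₂) := by
  fin_cases d
  · exact Reg.one n
  · exact Reg.one n
  · exact Reg.one n
  · exact Reg.one n
  · exact (Reg.one n).sub ((Reg.Yc n).mul (Reg.Yc n))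

protected theorem Reg.P (hf : Reg (n + 1) f) (e : SpaceTime) : Reg n (P e f) :=
  fun s => (hf s).pd s.T_pos e

protected theorem Reg.D (hf : Reg (n + 1) f) (d : Fin 5) : Reg n (D d f) :=
  (Reg.cf n d).mul (hf.P _)

protected theorem Reg.inv (hf : Reg n f) (h0 : ∀ s z, f s z ≠ 0) : Reg n f⁻¹ :=
  fun s => (hf s).inv (h0 s)

protected theorem Reg.sum {ι : Type*} {t : Finset ι} {f : ι → Fam A₀ ρ₁ ρ₂}
    (h : ∀ i ∈ t, Reg n (f i)) : Reg n (∑ i ∈ t, f i) := by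
  classical
  induction t using Finset.induction_on with
  | empty => simpa using Reg.zero n
  | insert a t ha ih =>
    rw [Finset.sum_insert ha]
    exact (h a (Finset.mem_insert_self _ _)).add
      (ih fun i hi => h i (Finset.mem_insert_of_mem hi))

protected theorem Per.add (hf : Per f) (hg : Per g) : Per (f + g) := fun s => (hf s).add (hg s)

protected theorem Per.mul (hf : Per f) (hg : Per g) : Per (f * g) := fun s => (hf s).mul (hg s)

protected theorem Per.neg (hf : Per f) : Per (-f) := fun s => (hf s).neg

protected theorem Per.sub (hf : Per f) (hg : Per g) : Per (f - g) := by
  rw [sub_eq_add_neg]; exact hf.add hg.neg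

protected theorem Per.const (c : ℝ) : Per (fun _ _ => c : Fam A₀ ρ₁ ρ₂) := fun _ => Pr.const c

protected theorem Per.zero : Per (0 : Fam A₀ ρ₁ ρ₂) := Per.const 0

protected theorem Per.one : Per (1 : Fam A₀ ρ₁ ρ₂) := Per.const 1

protected theorem Per.ofNat (k : ℕ) [k.AtLeastTwo] :
    Per (OfNat.ofNat k : Fam A₀ ρ₁ ρ₂) := Per.const (OfNat.ofNat k)

protected theorem Per.Yc : Per (Yc : Fam A₀ ρ₁ ρ₂) := fun _ => Pr.ycoord

protected theorem Per.inv (hf : Per f) : Per f⁻¹ := fun s => (hf s).inv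

protected theorem Per.D (hf : Per f) (hr : Reg 1 f) (d : Fin 5) : Per (D d f) := by
  have h1 : Per (P (vec d) f) := fun s => (hf s).pd s.T_pos (hr s) _
  have h2 : Per (cf d : Fam A₀ ρ₁ ρ₂) := by
    fin_cases d
    · exact Per.one
    · exact Per.one
    · exact Per.one
    · exact Per.one
    · exact Per.one.sub (Per.Yc.mul Per.Yc)
  exact h2.mul h1

protected theorem Per.sum {ι : Type*} {t : Finset ι} {f : ι → Fam A₀ ρ₁ ρ₂}
    (h : ∀ i ∈ t, Per (f i)) : Per (∑ i ∈ t, f i) := by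
  classical
  induction t using Finset.induction_on with
  | empty => simpa using Per.zero
  | insert a t ha ih =>
    rw [Finset.sum_insert ha]
    exact (h a (Finset.mem_insert_self _ _)).add
      (ih fun i hi => h i (Finset.mem_insert_of_mem hi))

end RegPer

section Rules

variable {f g : Fam A₀ ρ₁ ρ₂}

theorem P_add (e : SpaceTime) (hf : Reg 1 f) (hg : Reg 1 g) : P e (f + g) = P e f + P e g :=
  funext fun s => pd_add s.T_pos (hf s) (hg s)

theorem P_mul (e : SpaceTime) (hf : Reg 1 f) (hg : Reg 1 g) :
    P e (f * g) = P e f * g + f * P e g :=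
  funext fun s => pd_mul s.T_pos (hf s) (hg s)

theorem P_comm (e e' : SpaceTime) (hf : Reg 2 f) : P e (P e' f) = P e' (P e f) :=
  funext fun s => pd_comm s.T_pos (hf s) e e'

theorem P_const (e : SpaceTime) (c : ℝ) : P e (fun _ _ => c : Fam A₀ ρ₁ ρ₂) = 0 :=
  funext fun _ => pd_const e c

theorem D_add (d : Fin 5) (hf : Reg 1 f) (hg : Reg 1 g) : D d (f + g) = D d f + D d g := by
  simp only [D, P_add _ hf hg, mul_add]

theorem D_mul (d : Fin 5) (hf : Reg 1 f) (hg : Reg 1 g) :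
    D d (f * g) = D d f * g + f * D d g := by
  simp only [D, P_mul _ hf hg]
  ring

theorem D_const (d : Fin 5) (c : ℝ) : D d (fun _ _ => c : Fam A₀ ρ₁ ρ₂) = 0 := by
  rw [D, P_const, mul_zero]

theorem D_fam_zero (d : Fin 5) : D d (0 : Fam A₀ ρ₁ ρ₂) = 0 := D_const d 0

theorem D_fam_one (d : Fin 5) : D d (1 : Fam A₀ ρ₁ ρ₂) = 0 := D_const d 1

theorem D_fam_ofNat (d : Fin 5) (k : ℕ) [k.AtLeastTwo] :
    D d (OfNat.ofNat k : Fam A₀ ρ₁ ρ₂) = 0 := D_const d (OfNat.ofNat k)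

theorem D_neg (d : Fin 5) (hf : Reg 1 f) : D d (-f) = -D d f := by
  have h := D_add d hf hf.neg
  rw [add_neg_cancel, D_fam_zero] at h
  exact (neg_eq_of_add_eq_zero_right h.symm).symm

theorem D_sub (d : Fin 5) (hf : Reg 1 f) (hg : Reg 1 g) : D d (f - g) = D d f - D d g := by
  rw [sub_eq_add_neg, D_add d hf hg.neg, D_neg d hg, sub_eq_add_neg]

theorem D_sum (d : Fin 5) {ι : Type*} {t : Finset ι} {f : ι → Fam A₀ ρ₁ ρ₂}
    (h : ∀ i ∈ t, Reg 1 (f i)) : D d (∑ i ∈ t, f i) = ∑ i ∈ t, D d (f i) := by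
  classical
  induction t using Finset.induction_on with
  | empty => simpa using D_fam_zero d
  | insert a t ha ih =>
    have h' : ∀ i ∈ t, Reg 1 (f i) := fun i hi => h i (Finset.mem_insert_of_mem hi)
    rw [Finset.sum_insert ha, Finset.sum_insert ha,
      D_add d (h a (Finset.mem_insert_self _ _)) (Reg.sum h'), ih h']

theorem D_inv (d : Fin 5) (hf : Reg 1 f) (h0 : ∀ s z, f s z ≠ 0) :
    D d f⁻¹ = -(D d f * f⁻¹ * f⁻¹) := by
  have : P (vec d) f⁻¹ = -(P (vec d) f * f⁻¹ * f⁻¹) :=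
    funext fun s => pd_inv s.T_pos (hf s) (h0 s)
  rw [D, D, this]
  ring

theorem P_Yc (e : SpaceTime) : P e (Yc : Fam A₀ ρ₁ ρ₂) = fun _ _ => e.2 2 :=
  funext fun s => pd_ycoord s.T_pos e

theorem D_three_Yc : D 3 (Yc : Fam A₀ ρ₁ ρ₂) = 1 := by
  rw [D_three_eq, P_Yc]
  funext s z
  simp

theorem D_tangential_Yc {d : Fin 5} (hd : d ≠ 3) (hd' : d ≠ 4) :
    D d (Yc : Fam A₀ ρ₁ ρ₂) = 0 := by
  rw [D, P_Yc]
  have : (vec d).2 2 = 0 := by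
    fin_cases d <;> simp_all [vec]
  rw [this]
  exact mul_zero _

theorem D_comm_of_ne_four {d e : Fin 5} (hd : d ≠ 4) (he : e ≠ 4) (hf : Reg 2 f) :
    D d (D e f) = D e (D d f) := by
  have h1 : ∀ {d : Fin 5}, d ≠ 4 → (cf d : Fam A₀ ρ₁ ρ₂) = 1 := by
    intro d hd
    fin_cases d
    · rfl
    · rfl
    · rfl
    · rfl
    · exact absurd rfl hd
  simp only [D, h1 hd, h1 he, one_mul]
  exact P_comm _ _ hf

theorem D_sigma {d : Fin 5} (hd : d ≠ 3) (hd' : d ≠ 4) :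
    D d (1 - Yc * Yc : Fam A₀ ρ₁ ρ₂) = 0 := by
  rw [D_sub d (Reg.one 1) ((Reg.Yc 1).mul (Reg.Yc 1)), D_mul d (Reg.Yc 1) (Reg.Yc 1),
    D_tangential_Yc hd hd', D_fam_one]
  ring

theorem D_three_sigma : D 3 (1 - Yc * Yc : Fam A₀ ρ₁ ρ₂) = -2 * Yc := by
  rw [D_sub 3 (Reg.one 1) ((Reg.Yc 1).mul (Reg.Yc 1)), D_mul 3 (Reg.Yc 1) (Reg.Yc 1),
    D_three_Yc, D_fam_one]
  ring

protected theorem Reg.sigma (n : ℕ) : Reg n (1 - Yc * Yc : Fam A₀ ρ₁ ρ₂) :=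
  (Reg.one n).sub ((Reg.Yc n).mul (Reg.Yc n))

theorem D_tangential_four {d : Fin 5} (hd : d ≠ 3) (hf : Reg 2 f) :
    D d (D 4 f) = D 4 (D d f) := by
  rcases eq_or_ne d 4 with rfl | hd'
  · rfl
  · rw [D_four_eq, D_four_eq, D_mul d (Reg.sigma 1) (hf.D 3), D_sigma hd hd',
      D_comm_of_ne_four hd' (by decide) hf, zero_mul, zero_add]

/-- The only noncommuting pair among the five derivations. The commutator has weight two, below the
weight three of either product, so reordering never costs weight. -/
theorem D_three_four (hf : Reg 2 f) : D 3 (D 4 f) = D 4 (D 3 f) + -2 * Yc * D 3 f := by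
  rw [D_four_eq, D_four_eq, D_mul 3 (Reg.sigma 1) (hf.D 3), D_three_sigma]
  ring

/-- Tangential derivatives commute with all others. -/
theorem D_comm {d : Fin 5} (hd : d < 3) (e : Fin 5) (hf : Reg 2 f) :
    D d (D e f) = D e (D d f) := by
  have h3 : d ≠ 3 := ne_of_lt hd
  have h4 : d ≠ 4 := ne_of_lt (hd.trans (by decide))
  rcases eq_or_ne e 4 with rfl | he
  · exact D_tangential_four h3 hf
  · exact D_comm_of_ne_four h4 he hf

end Rules

end Family

/-! ### Anisotropic Sobolev classes with uniform bounds -/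

section Calculus

variable {A₀ ρ₁ ρ₂ : ℝ} {f g : Fam A₀ ρ₁ ρ₂}

/-- Square-integrability in space with a polynomial bound. -/
def L2 (f : Fam A₀ ρ₁ ρ₂) : Prop := PolyBd fun s t => cint (f s * f s) t

/-- Boundedness on the cell with a polynomial bound. -/
def LI (f : Fam A₀ ρ₁ ρ₂) : Prop :=
  ∃ (C : ℝ) (k : ℕ), 0 ≤ C ∧ ∀ s (z : cyl s.T), z.1.2 ∈ cell → |f s z| ≤ C * Mg s z.1.1 ^ k

theorem LI.const (c : ℝ) : LI (fun _ _ => c : Fam A₀ ρ₁ ρ₂) :=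
  ⟨|c|, 0, abs_nonneg _, fun _ _ _ => by simp⟩

theorem cint_le_of_le {T : ℝ} {n : ℕ} {f g : cyl T → ℝ} {c t : ℝ} (hf : Sm n f)
    (hg : Sm n g) (ht : t ∈ Icc 0 T)
    (h : ∀ z : cyl T, z.1.1 = t → z.1.2 ∈ cell → f z ≤ c * g z) : cint f t ≤ c * cint g t := by
  rw [← cint_const_mul _ _ ht]
  exact cint_mono hf ((Sm.const n c).mul hg) ht h

theorem L2.add (hf0 : Reg 0 f) (hg0 : Reg 0 g) (hf : L2 f) (hg : L2 g) : L2 (f + g) := by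
  refine ((PolyBd.add hf hg).const_mul zero_le_two).mono fun s t ht => ?_
  have h1 := (hf0 s).mul (hf0 s)
  have h2 := (hg0 s).mul (hg0 s)
  rw [← cint_add h1 h2 ht]
  refine cint_le_of_le (((hf0.add hg0) s).mul ((hf0.add hg0) s)) (h1.add h2) ht fun z _ _ => ?_
  simp only [Pi.add_apply, Pi.mul_apply]
  nlinarith [sq_nonneg (f s z - g s z)]

theorem L2.neg (hf : L2 f) : L2 (-f) := by
  unfold L2 at hf ⊢
  simpa using hf

theorem L2.mul_of_LI (hf0 : Reg 0 f) (hg0 : Reg 0 g) (hf : LI f) (hg : L2 g) : L2 (f * g) := by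
  obtain ⟨C, k, hC, hf⟩ := hf
  have h1 : PolyBd fun (s : Sol A₀ ρ₁ ρ₂) t => (C * Mg s t ^ k) ^ 2 :=
    ⟨C ^ 2, k * 2, by positivity, fun s t _ => le_of_eq (by ring)⟩
  refine (h1.mul hg fun s t ht => cint_mul_self_nonneg _ ht).mono fun s t ht => ?_
  refine cint_le_of_le (((hf0.mul hg0) s).mul ((hf0.mul hg0) s)) ((hg0 s).mul (hg0 s)) ht
    fun z hz hc => ?_
  have h2 := hf s z hc
  rw [hz] at h2
  have h3 : f s z ^ 2 ≤ (C * Mg s t ^ k) ^ 2 := by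
    rw [← sq_abs]
    exact pow_le_pow_left₀ (abs_nonneg _) h2 2
  simp only [Pi.mul_apply]
  nlinarith [mul_le_mul_of_nonneg_right h3 (sq_nonneg (g s z))]

theorem L2.of_LI (hf0 : Reg 0 f) (hf : LI f) : L2 f := by
  have h1 : L2 (1 : Fam A₀ ρ₁ ρ₂) := by
    -- The constant is the volume of the cell, which is the same for every solution; it is recorded
    -- as an integral on the cylinder with final time one.
    refine (PolyBd.const (cint (T := 1) (fun _ => 1) 0)).mono fun s t ht => le_of_eq ?_
    unfold cint
    refine setIntegral_congr_fun measurableSet_cell fun y hy => ?_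
    simp only [ext_of_mem _ (mem_cyl_of_cell ht hy),
      ext_of_mem _ (mem_cyl_of_cell (show (0 : ℝ) ∈ Icc 0 1 by simp) hy)]
    simp
  simpa using h1.mul_of_LI hf0 (Reg.one 0) hf

/-- Iterated application of the derivations, the first letter first. -/
def Wd : List (Fin 5) → Fam A₀ ρ₁ ρ₂ → Fam A₀ ρ₁ ρ₂
  | [], f => f
  | d :: w, f => Wd w (D d f)

/-- The weight of a word. -/
def wtl (w : List (Fin 5)) : ℕ := (w.map wt).sum

/-- The anisotropic Sobolev class of order `m`. -/
def H (m : ℕ) (f : Fam A₀ ρ₁ ρ₂) : Prop := Reg m f ∧ ∀ w, wtl w ≤ m → L2 (Wd w f)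

theorem H.reg {m : ℕ} (h : H m f) : Reg m f := h.1

theorem H.l2 {m : ℕ} (h : H m f) : L2 f := h.2 [] (Nat.zero_le _)

protected theorem H.mono {m n : ℕ} (h : H n f) (hmn : m ≤ n) : H m f :=
  ⟨h.1.mono hmn, fun w hw => h.2 w (hw.trans hmn)⟩

theorem H.of_l2 (h0 : Reg 0 f) (h : L2 f) : H 0 f := by
  refine ⟨h0, fun w hw => ?_⟩
  cases w with
  | nil => exact h
  | cons d w =>
    have := one_le_wt d
    simp only [wtl, List.map_cons, List.sum_cons] at hw
    omega

/-- The recursive description of the class. The closure properties under sums, products and inverses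
follow from it by strong induction on the order, differentiating once. -/
theorem H.intro {m : ℕ} (hr : Reg m f) (h0 : L2 f)
    (hd : ∀ d, wt d ≤ m → H (m - wt d) (D d f)) : H m f := by
  refine ⟨hr, fun w hw => ?_⟩
  cases w with
  | nil => exact h0
  | cons d w =>
    simp only [wtl, List.map_cons, List.sum_cons] at hw
    exact (hd d (by omega)).2 w (by unfold wtl; omega)

protected theorem H.D' {m : ℕ} (h : H m f) (d : Fin 5) (hd : wt d ≤ m) : H (m - wt d) (D d f) := by
  have h1 := one_le_wt d
  refine ⟨(h.1.mono (show m - wt d + 1 ≤ m by omega)).D d, fun w hw => h.2 (d :: w) ?_⟩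
  simp only [wtl, List.map_cons, List.sum_cons]
  unfold wtl at hw
  omega

protected theorem H.D {m : ℕ} (h : H m f) (d : Fin 5) {k : ℕ} (hd : k + wt d ≤ m) :
    H k (D d f) := (h.D' d (by omega)).mono (by omega)

protected theorem H.add {m : ℕ} (hf : H m f) (hg : H m g) : H m (f + g) := by
  induction m using Nat.strong_induction_on generalizing f g with
  | _ m ih =>
    refine H.intro (hf.1.add hg.1)
      (hf.l2.add (hf.1.mono (Nat.zero_le _)) (hg.1.mono (Nat.zero_le _)) hg.l2) fun d hd => ?_
    have := one_le_wt d
    rw [D_add d (hf.1.mono (by omega)) (hg.1.mono (by omega))]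
    exact ih _ (by omega) (hf.D' d hd) (hg.D' d hd)

protected theorem H.neg {m : ℕ} (hf : H m f) : H m (-f) := by
  induction m using Nat.strong_induction_on generalizing f with
  | _ m ih =>
    refine H.intro hf.1.neg hf.l2.neg fun d hd => ?_
    have := one_le_wt d
    rw [D_neg d (hf.1.mono (by omega))]
    exact ih _ (by omega) (hf.D' d hd)

protected theorem H.sub {m : ℕ} (hf : H m f) (hg : H m g) : H m (f - g) := by
  rw [sub_eq_add_neg]; exact hf.add hg.neg

protected theorem H.zero (m : ℕ) : H m (0 : Fam A₀ ρ₁ ρ₂) := by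
  induction m using Nat.strong_induction_on with
  | _ m ih =>
    refine H.intro (Reg.zero m) (L2.of_LI (Reg.zero 0) (LI.const 0)) fun d hd => ?_
    have := one_le_wt d
    rw [D_fam_zero]
    exact ih _ (by omega)

protected theorem H.const (m : ℕ) (c : ℝ) : H m (fun _ _ => c : Fam A₀ ρ₁ ρ₂) :=
  H.intro (Reg.const m c) (L2.of_LI (Reg.const 0 c) (LI.const c)) fun d _ => by
    rw [D_const]; exact H.zero _

protected theorem H.one (m : ℕ) : H m (1 : Fam A₀ ρ₁ ρ₂) := H.const m 1

protected theorem H.ofNat (m k : ℕ) [k.AtLeastTwo] :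
    H m (OfNat.ofNat k : Fam A₀ ρ₁ ρ₂) := H.const m (OfNat.ofNat k)

protected theorem H.sum {ι : Type*} {t : Finset ι} {m : ℕ} {f : ι → Fam A₀ ρ₁ ρ₂}
    (h : ∀ i ∈ t, H m (f i)) : H m (∑ i ∈ t, f i) := by
  classical
  induction t using Finset.induction_on with
  | empty => simpa using H.zero m
  | insert a t ha ih =>
    rw [Finset.sum_insert ha]
    exact (h a (Finset.mem_insert_self _ _)).add
      (ih fun i hi => h i (Finset.mem_insert_of_mem hi))

theorem polyBd_sobOne_tangential (h : H 1 f) : PolyBd fun s t => sobOne 0 (f s) t := by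
  have := PolyBd.add h.l2 (h.D 1 (k := 0) le_rfl).l2
  simp only [D_one_eq] at this
  exact this

theorem polyBd_sobOne_normal {m : ℕ} (hm : 2 ≤ m) (h : H m f) :
    PolyBd fun s t => sobOne 2 (f s) t := by
  have := PolyBd.add h.l2 (h.D 3 (k := 0) hm).l2
  simp only [D_three_eq] at this
  exact this

theorem polyBd_sobTwo_tangential (h : H 2 f) : PolyBd fun s t => sobTwo 0 1 (f s) t := by
  have h1 := h.D 1 (k := 1) le_rfl
  have h2 := h.D 2 (k := 1) le_rfl
  have h12 := h1.D 2 (k := 0) le_rfl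
  have := (PolyBd.add h.l2 h2.l2).add (PolyBd.add h1.l2 h12.l2)
  simp only [D_one_eq, D_two_eq] at this
  exact this

theorem polyBd_sobTwo_normal (h : H 3 f) : PolyBd fun s t => sobTwo 1 2 (f s) t := by
  have h1 := h.D 2 (k := 2) le_rfl
  have := (polyBd_sobOne_normal (by norm_num) h).add (polyBd_sobOne_normal le_rfl h1)
  simp only [D_two_eq] at this
  exact this

theorem polyBd_sobThree (h : H 4 f) : PolyBd fun s t => sobThree (f s) t := by
  have h1 := h.D 1 (k := 3) le_rfl
  have := (polyBd_sobTwo_normal (h.mono (by norm_num))).add (polyBd_sobTwo_normal h1)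
  simp only [D_one_eq] at this
  exact this

/-- Boundedness needs one derivative in each of the three directions, of total weight 1 + 1 + 2 = 4.
-/
theorem H.li (h : H 4 f) : LI f := by
  obtain ⟨C, k, hC, hb⟩ := polyBd_sobThree h
  -- The added 1 keeps the bound at least one, hence below its own square; this replaces taking a
  -- square root.
  refine ⟨8 * C + 1, k, by positivity, fun s z hz => ?_⟩
  have h1 := sq_le_sobThree s.T_pos ((h.reg s).mono (by norm_num)) hz
  have h2 := hb s z.1.1 z.2.1
  have hM : 1 ≤ Mg s z.1.1 ^ k := one_le_pow₀ (one_le_Mg s _)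
  have h3 : f s z ^ 2 ≤ ((8 * C + 1) * Mg s z.1.1 ^ k) ^ 2 := by
    have h4 : 8 * C * Mg s z.1.1 ^ k ≤ (8 * C + 1) * Mg s z.1.1 ^ k := by nlinarith
    have h5 : 1 ≤ (8 * C + 1) * Mg s z.1.1 ^ k := by nlinarith
    nlinarith
  exact abs_le_of_sq_le_sq h3 (by positivity)

/-- The total weight four of the three directions is divided between the factors in whatever way
their orders permit: 4 + 0, 3 + 1 or 2 + 2. -/
theorem L2.mul_of_H {a b : ℕ} (hab : 4 ≤ a + b) (hf : H a f) (hg : H b g) : L2 (f * g) := by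
  have hf0 : Reg 0 f := hf.1.mono (Nat.zero_le _)
  have hg0 : Reg 0 g := hg.1.mono (Nat.zero_le _)
  -- The first factor takes one tangential and the normal direction, of weight 1 + 2, the second the
  -- other tangential direction.
  have h31 : ∀ {f g : Fam A₀ ρ₁ ρ₂}, H 3 f → H 1 g → L2 (f * g) := by
    intro f g hf hg
    refine (((polyBd_sobTwo_normal hf).mul (polyBd_sobOne_tangential hg)
      fun s t ht => sobOne_nonneg _ _ ht).const_mul (by norm_num : (0 : ℝ) ≤ 8)).mono
      fun s t ht => ?_
    exact cint_mul_sq_le s.T_pos ((hf.1 s).mono (by norm_num)) (hg.1 s) ht (by decide) (by decide)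
      (by decide)
  -- Both tangential directions go to the first factor, the normal one, of weight 2, to the second.
  have h22 : ∀ {f g : Fam A₀ ρ₁ ρ₂}, H 2 f → H 2 g → L2 (f * g) := by
    intro f g hf hg
    refine (((polyBd_sobTwo_tangential hf).mul (polyBd_sobOne_normal le_rfl hg)
      fun s t ht => sobOne_nonneg _ _ ht).const_mul (by norm_num : (0 : ℝ) ≤ 8)).mono
      fun s t ht => ?_
    exact cint_mul_sq_le s.T_pos (hf.1 s) ((hg.1 s).mono (by norm_num)) ht (by decide) (by decide)
      (by decide)
  by_cases ha : 4 ≤ a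
  · exact hg.l2.mul_of_LI hf0 hg0 (hf.mono ha).li
  by_cases hb : 4 ≤ b
  · rw [mul_comm]
    exact hf.l2.mul_of_LI hg0 hf0 (hg.mono hb).li
  by_cases ha3 : a = 3
  · subst ha3
    exact h31 hf (hg.mono (by omega))
  by_cases hb3 : b = 3
  · subst hb3
    rw [mul_comm]
    exact h31 hg (hf.mono (by omega))
  exact h22 (hf.mono (by omega)) (hg.mono (by omega))

/-- The product estimate in the anisotropic Sobolev classes. -/
protected theorem H.mul {a b : ℕ} (hf : H a f) (hg : H b g) {c : ℕ} (hca : c ≤ a) (hcb : c ≤ b)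
    (hab : c + 4 ≤ a + b) : H c (f * g) := by
  induction c using Nat.strong_induction_on generalizing f g a b with
  | _ c ih =>
    refine H.intro ((hf.1.mono hca).mul (hg.1.mono hcb)) (L2.mul_of_H (by omega) hf hg)
      fun d hd => ?_
    have := one_le_wt d
    rw [D_mul d (hf.1.mono (by omega)) (hg.1.mono (by omega))]
    exact (ih _ (by omega) (hf.D' d (by omega)) hg (by omega) (by omega) (by omega)).add
      (ih _ (by omega) hf (hg.D' d (by omega)) (by omega) (by omega) (by omega))

/-- Multiplication by a function of order at least four. -/
theorem H.smul {a c : ℕ} (hf : H a f) (hg : H c g) (h4 : 4 ≤ a) (hca : c ≤ a) : H c (f * g) :=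
  hf.mul hg hca le_rfl (by omega)

theorem H.const_smul {c : ℕ} (r : ℝ) (hg : H c g) : H c ((fun _ _ => r) * g) :=
  (H.const (c + 4) r).smul hg (by omega) (by omega)

theorem H.ofNat_mul {c : ℕ} (k : ℕ) [k.AtLeastTwo] (hg : H c g) : H c (OfNat.ofNat k * g) :=
  (H.ofNat (c + 4) k).smul hg (by omega) (by omega)

/-- Multiplication by powers of the reciprocal of a function bounded below. -/
theorem H.inv_pow_mul {a : ℕ} (ha : 4 ≤ a) (hf : H a f) {δ : ℝ} (hδ : 0 < δ)
    (hfδ : ∀ s z, δ ≤ f s z) {c b : ℕ} (hca : c ≤ a) (hcb : c ≤ b) (k : ℕ) (hg : H b g) :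
    H c (f⁻¹ ^ k * g) := by
  have h0 : ∀ s z, f s z ≠ 0 := fun s z => (hδ.trans_le (hfδ s z)).ne'
  have hli : ∀ k, LI (f⁻¹ ^ k) := fun k => ⟨(δ⁻¹) ^ k, 0, by positivity, fun s z _ => by
    simp only [Pi.pow_apply, Pi.inv_apply, pow_zero, mul_one, abs_pow, abs_inv]
    refine pow_le_pow_left₀ (by positivity) ?_ k
    rw [abs_of_pos (hδ.trans_le (hfδ s z))]
    exact inv_anti₀ hδ (hfδ s z)⟩
  have hreg : ∀ n k, n ≤ a → Reg n (f⁻¹ ^ k) := by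
    intro n k hn
    induction k with
    | zero => simpa using Reg.one n
    | succ k ih => rw [pow_succ]; exact ih.mul ((hf.1.mono hn).inv h0)
  have hD : ∀ (d : Fin 5) (k : ℕ), D d (f⁻¹ ^ k) = -(k : Fam A₀ ρ₁ ρ₂) * D d f * f⁻¹ ^ (k + 1) := by
    intro d k
    induction k with
    | zero => simp [D_fam_one]
    | succ k ih =>
      rw [pow_succ, D_mul d (hreg 1 k (by omega)) ((hf.1.mono (by omega)).inv h0), ih,
        D_inv d (hf.1.mono (by omega)) h0]
      push_cast
      ring
  -- The power and the extra factor must vary: differentiating `f⁻ᵏ g` raises the power and replaces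
  -- `g` by the product of a derivative of `f` with `g`.
  induction c using Nat.strong_induction_on generalizing g b k with
  | _ c ih =>
    refine H.intro ((hreg c k hca).mul (hg.1.mono hcb))
      (hg.l2.mul_of_LI (hreg 0 k (by omega)) (hg.1.mono (by omega)) (hli k)) fun d hd => ?_
    have h1 := one_le_wt d
    have hw : wt d ≤ 2 := by fin_cases d <;> simp [wt]
    rw [D_mul d (hreg 1 k (by omega)) (hg.1.mono (by omega)), hD]
    have e : -(k : Fam A₀ ρ₁ ρ₂) * D d f * f⁻¹ ^ (k + 1) * g + f⁻¹ ^ k * D d g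
        = (fun _ _ => -(k : ℝ)) * (f⁻¹ ^ (k + 1) * (D d f * g)) + f⁻¹ ^ k * D d g := by
      have : (fun _ _ => -(k : ℝ) : Fam A₀ ρ₁ ρ₂) = -(k : Fam A₀ ρ₁ ρ₂) := rfl
      rw [this]
      ring
    rw [e]
    refine H.add (H.const_smul _ ?_) ?_
    · exact ih _ (by omega) (b := c - wt d) (by omega) (by omega) (k + 1)
        ((hf.D' d (by omega)).mul hg (by omega) (by omega) (by omega))
    · exact ih _ (by omega) (b := b - wt d) (by omega) (by omega) k (hg.D' d (by omega))

protected theorem H.inv {a : ℕ} (ha : 4 ≤ a) (hf : H a f) {δ : ℝ} (hδ : 0 < δ)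
    (hfδ : ∀ s z, δ ≤ f s z) : H a f⁻¹ := by
  simpa using H.inv_pow_mul ha hf hδ hfδ le_rfl le_rfl 1 (H.one a)

end Calculus

/-! ### Arbitrary words in the derivations are controlled by the energy -/

section Atoms

variable {A₀ ρ₁ ρ₂ : ℝ} {f g : Fam A₀ ρ₁ ρ₂}

/-- The family of restrictions of functions defined on all of space-time. -/
def resF (g : Sol A₀ ρ₁ ρ₂ → SpaceTime → ℝ) : Fam A₀ ρ₁ ρ₂ := fun s => res s.T (g s)

theorem iterate_D_resF {d : Fin 5} {op : Sol A₀ ρ₁ ρ₂ → (SpaceTime → ℝ) → SpaceTime → ℝ}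
    (h : ∀ s g, ∀ z : cyl s.T, op s g z = cf d s z * dirDeriv s.T (vec d) g z) (k : ℕ)
    (g : Sol A₀ ρ₁ ρ₂ → SpaceTime → ℝ) :
    (D d)^[k] (resF g) = resF fun s => (op s)^[k] (g s) := by
  induction k generalizing g with
  | zero => rfl
  | succ k ih =>
    have h1 : D d (resF g) = resF fun s => op s (g s) := by
      funext s z
      change cf d s z * pd (vec d) (res s.T (g s)) z = op s (g s) z
      rw [pd_res, h]
      rfl
    rw [Function.iterate_succ_apply, h1, ih]
    rfl

theorem iterate_D_zero_resF (k : ℕ) (g : Sol A₀ ρ₁ ρ₂ → SpaceTime → ℝ) :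
    (D 0)^[k] (resF g) = resF fun s => (dt s.T)^[k] (g s) :=
  iterate_D_resF (op := fun s => dt s.T) (fun _ _ _ => (one_mul _).symm) k g

theorem iterate_D_one_resF (k : ℕ) (g : Sol A₀ ρ₁ ρ₂ → SpaceTime → ℝ) :
    (D 1)^[k] (resF g) = resF fun s => (dx s.T 0)^[k] (g s) :=
  iterate_D_resF (op := fun s => dx s.T 0) (fun _ _ _ => (one_mul _).symm) k g

theorem iterate_D_two_resF (k : ℕ) (g : Sol A₀ ρ₁ ρ₂ → SpaceTime → ℝ) :
    (D 2)^[k] (resF g) = resF fun s => (dx s.T 1)^[k] (g s) :=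
  iterate_D_resF (op := fun s => dx s.T 1) (fun _ _ _ => (one_mul _).symm) k g

theorem iterate_D_three_resF (k : ℕ) (g : Sol A₀ ρ₁ ρ₂ → SpaceTime → ℝ) :
    (D 3)^[k] (resF g) = resF fun s => (dx s.T 2)^[k] (g s) :=
  iterate_D_resF (op := fun s => dx s.T 2) (fun _ _ _ => (one_mul _).symm) k g

theorem iterate_D_four_resF (k : ℕ) (g : Sol A₀ ρ₁ ρ₂ → SpaceTime → ℝ) :
    (D 4)^[k] (resF g) = resF fun s => (sigmaD3 s.T)^[k] (g s) := by
  refine iterate_D_resF (op := fun s => sigmaD3 s.T) (fun s g z => ?_) k g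
  change (1 - z.1.2 2) * (1 + z.1.2 2) * dx s.T 2 g z
    = (1 - z.1.2 2 * z.1.2 2) * dirDeriv s.T (eX 2) g z
  rw [show dx s.T 2 g z = dirDeriv s.T (eX 2) g z from rfl]
  ring

/-- The derivatives entering the energy, for families. -/
def dstarF (I : Fin 5 → ℕ) (f : Fam A₀ ρ₁ ρ₂) : Fam A₀ ρ₁ ρ₂ :=
  (D 0)^[I 0] ((D 4)^[I 4] ((D 1)^[I 1] ((D 2)^[I 2] ((D 3)^[I 3] f))))

theorem dstarF_resF (I : Fin 5 → ℕ) (g : Sol A₀ ρ₁ ρ₂ → SpaceTime → ℝ) :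
    dstarF I (resF g) = resF fun s => dstar s.T I (g s) := by
  rw [dstarF, iterate_D_three_resF, iterate_D_two_resF, iterate_D_one_resF, iterate_D_four_resF,
    iterate_D_zero_resF]
  rfl

theorem cint_resF (g : Sol A₀ ρ₁ ρ₂ → SpaceTime → ℝ) (s : Sol A₀ ρ₁ ρ₂) {t : ℝ}
    (ht : t ∈ Icc 0 s.T) : cint (resF g s * resF g s) t = l2Sq (g s) t := by
  refine setIntegral_congr_fun measurableSet_cell fun y hy => ?_
  simp only [ext_of_mem _ (mem_cyl_of_cell ht hy)]
  exact (sq _).symm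

protected theorem Reg.iterate {n : ℕ} (d : Fin 5) (k : ℕ) (h : Reg (n + k) f) :
    Reg n ((D d)^[k] f) := by
  induction k generalizing f with
  | zero => exact h
  | succ k ih =>
    rw [Function.iterate_succ_apply]
    exact ih (Reg.D (n := n + k) h d)

theorem D_iterate_comm {d e : Fin 5} (hc : ∀ h : Fam A₀ ρ₁ ρ₂, Reg 2 h → D d (D e h) = D e (D d h))
    (k : ℕ) (hr : Reg (k + 1) f) : D d ((D e)^[k] f) = (D e)^[k] (D d f) := by
  induction k generalizing f with
  | zero => rfl
  | succ k ih =>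
    rw [Function.iterate_succ_apply, ih (Reg.D (n := k + 1) hr e), hc f (hr.mono (by omega)),
      Function.iterate_succ_apply]

theorem card_le_weight (I : Fin 5 → ℕ) : I 0 + I 4 + I 1 + I 2 + I 3 ≤ weight I := by
  unfold weight; omega

theorem reg_dstarF (hf : Reg 8 f) (I : Fin 5 → ℕ) {n : ℕ}
    (hn : n + (I 0 + I 4 + I 1 + I 2 + I 3) ≤ 8) : Reg n (dstarF I f) := by
  refine Reg.iterate 0 _ (Reg.iterate 4 _ (Reg.iterate 1 _ (Reg.iterate 2 _
    (Reg.iterate 3 _ (hf.mono ?_)))))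
  omega

/-- Linear combinations, with coefficients polynomial in the normal coordinate, of the
derivatives entering the energy. -/
inductive Span (f : Fam A₀ ρ₁ ρ₂) (m : ℕ) : Fam A₀ ρ₁ ρ₂ → Prop
  | base (I : Fin 5 → ℕ) (h : weight I ≤ m) : Span f m (dstarF I f)
  | add {g h : Fam A₀ ρ₁ ρ₂} : Span f m g → Span f m h → Span f m (g + h)
  | ymul {g : Fam A₀ ρ₁ ρ₂} : Span f m g → Span f m (Yc * g)
  | cmul (c : ℝ) {g : Fam A₀ ρ₁ ρ₂} : Span f m g → Span f m ((fun _ _ => c) * g)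

theorem Span.mono {m n : ℕ} (h : Span f m g) (hmn : m ≤ n) : Span f n g := by
  induction h with
  | base I h => exact .base I (h.trans hmn)
  | add _ _ h1 h2 => exact .add h1 h2
  | ymul _ h => exact .ymul h
  | cmul c _ h => exact .cmul c h

theorem Span.reg {m : ℕ} (h : Span f m g) (hf : Reg 8 f) {n : ℕ} (hn : n + m ≤ 8) :
    Reg n g := by
  induction h with
  | base I h =>
    have := card_le_weight I
    exact reg_dstarF hf I (by omega)
  | add _ _ h1 h2 => exact h1.add h2
  | ymul _ h => exact (Reg.Yc n).mul h
  | cmul c _ h => exact (Reg.const n c).mul h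

theorem LI.Yc : LI (Yc : Fam A₀ ρ₁ ρ₂) := by
  refine ⟨1, 0, zero_le_one, fun s z hz => ?_⟩
  have h1 := hz.1 2
  have h2 := hz.2 2
  have h3 : |z.1.2 2| ≤ 1 := abs_le.2 ⟨by simpa using h1, by simpa using h2⟩
  simpa [FreeMHD.Yc, ycoord] using h3

theorem Span.l2 {m : ℕ} (h : Span f m g) (hf : Reg 8 f) (hm : m ≤ 8)
    (hb : ∀ I, weight I ≤ 8 → L2 (dstarF I f)) : L2 g := by
  have hr : ∀ {g}, Span f m g → Reg 0 g := fun h => h.reg hf (by omega)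
  induction h with
  | base I h => exact hb I (h.trans hm)
  | add h1 h2 i1 i2 => exact i1.add (hr h1) (hr h2) i2
  | ymul h i => exact i.mul_of_LI (Reg.Yc 0) (hr h) LI.Yc
  | cmul c h i => exact i.mul_of_LI (Reg.const 0 c) (hr h) (LI.const c)

theorem D_zero_dstarF (I : Fin 5 → ℕ) :
    D 0 (dstarF I f) = dstarF (Function.update I 0 (I 0 + 1)) f := by
  simp [dstarF, Function.iterate_succ_apply', Function.update]

theorem D_four_dstarF (hf : Reg 8 f) (I : Fin 5 → ℕ)
    (hI : I 0 + I 4 + I 1 + I 2 + I 3 + 1 ≤ 8) :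
    D 4 (dstarF I f) = dstarF (Function.update I 4 (I 4 + 1)) f := by
  have h : Reg (I 0 + 1) ((D 4)^[I 4] ((D 1)^[I 1] ((D 2)^[I 2] ((D 3)^[I 3] f)))) :=
    Reg.iterate 4 _ (Reg.iterate 1 _ (Reg.iterate 2 _ (Reg.iterate 3 _ (hf.mono (by omega)))))
  rw [dstarF, D_iterate_comm (fun h hh => (D_comm (by decide) 4 hh).symm) _ h]
  simp [dstarF, Function.iterate_succ_apply', Function.update]

theorem D_one_dstarF (hf : Reg 8 f) (I : Fin 5 → ℕ)
    (hI : I 0 + I 4 + I 1 + I 2 + I 3 + 1 ≤ 8) :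
    D 1 (dstarF I f) = dstarF (Function.update I 1 (I 1 + 1)) f := by
  have h1 : Reg (I 0 + 1 + I 4) ((D 1)^[I 1] ((D 2)^[I 2] ((D 3)^[I 3] f))) :=
    Reg.iterate 1 _ (Reg.iterate 2 _ (Reg.iterate 3 _ (hf.mono (by omega))))
  rw [dstarF, D_iterate_comm (fun h hh => D_comm (by decide) 0 hh) _ (Reg.iterate 4 _ h1),
    D_iterate_comm (fun h hh => D_comm (by decide) 4 hh) _ (h1.mono (by omega))]
  simp [dstarF, Function.iterate_succ_apply', Function.update]

theorem D_two_dstarF (hf : Reg 8 f) (I : Fin 5 → ℕ)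
    (hI : I 0 + I 4 + I 1 + I 2 + I 3 + 1 ≤ 8) :
    D 2 (dstarF I f) = dstarF (Function.update I 2 (I 2 + 1)) f := by
  have h2 : Reg (I 0 + 1 + I 4 + I 1) ((D 2)^[I 2] ((D 3)^[I 3] f)) :=
    Reg.iterate 2 _ (Reg.iterate 3 _ (hf.mono (by omega)))
  have h1 := Reg.iterate 1 _ h2
  rw [dstarF, D_iterate_comm (fun h hh => D_comm (by decide) 0 hh) _ (Reg.iterate 4 _ h1),
    D_iterate_comm (fun h hh => D_comm (by decide) 4 hh) _ (h1.mono (by omega)),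
    D_iterate_comm (fun h hh => D_comm (by decide) 1 hh) _ (h2.mono (by omega))]
  simp [dstarF, Function.iterate_succ_apply', Function.update]

theorem D_three_dstarF (hf : Reg 8 f) (I : Fin 5 → ℕ) (h4 : I 4 = 0)
    (hI : I 0 + I 4 + I 1 + I 2 + I 3 + 1 ≤ 8) :
    D 3 (dstarF I f) = dstarF (Function.update I 3 (I 3 + 1)) f := by
  have h3 : Reg (I 0 + 1 + I 1 + I 2) ((D 3)^[I 3] f) := Reg.iterate 3 _ (hf.mono (by omega))
  have h2 := Reg.iterate 2 _ h3
  have h1 := Reg.iterate 1 _ h2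
  rw [dstarF, h4, Function.iterate_zero, id,
    D_iterate_comm (fun h hh => (D_comm (by decide) 3 hh).symm) _ h1,
    D_iterate_comm (fun h hh => (D_comm (by decide) 3 hh).symm) _ (h2.mono (by omega)),
    D_iterate_comm (fun h hh => (D_comm (by decide) 3 hh).symm) _ (h3.mono (by omega))]
  simp [dstarF, Function.iterate_succ_apply', Function.update, h4]

theorem D_four_Yc : D 4 (Yc : Fam A₀ ρ₁ ρ₂) = 1 - Yc * Yc := by
  rw [D_four_eq, D_three_Yc, mul_one]

theorem Span.D_tangential {m : ℕ} (h : Span f m g) (hf : Reg 8 f) (hm : m + 1 ≤ 8) {d : Fin 5}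
    (hd : d ≠ 3) : Span f (m + 1) (D d g) := by
  have hr : ∀ {g}, Span f m g → Reg 1 g := fun h => h.reg hf (by omega)
  induction h with
  | base I h =>
    have hI := card_le_weight I
    have hb : ∀ d : Fin 5, d ≠ 3 → weight (Function.update I d (I d + 1)) ≤ m + 1 := by
      intro d hd
      fin_cases d <;> simp_all [weight, Function.update] <;> omega
    fin_cases d
    · exact (D_zero_dstarF (f := f) I) ▸ .base _ (hb 0 hd)
    · exact (D_one_dstarF hf I (by omega)) ▸ .base _ (hb 1 hd)
    · exact (D_two_dstarF hf I (by omega)) ▸ .base _ (hb 2 hd)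
    · exact absurd rfl hd
    · exact (D_four_dstarF hf I (by omega)) ▸ .base _ (hb 4 hd)
  | add h1 h2 i1 i2 => rw [D_add d (hr h1) (hr h2)]; exact .add i1 i2
  | @ymul g h i =>
    rw [D_mul d (Reg.Yc 1) (hr h)]
    rcases eq_or_ne d 4 with rfl | hd'
    -- Since σ∂₃ applied to `y₃` gives `1 - y₃²`, the coefficients remain polynomial in `y₃`.
    · have e : D 4 Yc * g + Yc * D 4 g
          = g + ((fun _ _ => (-1 : ℝ)) * (Yc * (Yc * g)) + Yc * D 4 g) := by
        have : (fun _ _ => (-1 : ℝ) : Fam A₀ ρ₁ ρ₂) = -1 := rfl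
        rw [D_four_Yc, this]
        ring
      rw [e]
      have h' := h.mono (Nat.le_succ m)
      exact .add h' (.add (.cmul _ (.ymul (.ymul h'))) (.ymul i))
    · rw [D_tangential_Yc hd hd', zero_mul, zero_add]
      exact .ymul i
  | @cmul c g h i =>
    rw [D_mul d (Reg.const 1 c) (hr h), D_const, zero_mul, zero_add]
    exact .cmul c i

/-- In `dstarF` the powers of σ∂₃ stand outside those of ∂₃. A new ∂₃ is moved inwards by induction
on their number; each exchange leaves a term with coefficient `-2 y₃` and one σ∂₃ fewer. -/
theorem Span.D_three_base (hf : Reg 8 f) (k : ℕ) (I : Fin 5 → ℕ) (h4 : I 4 = k)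
    (hw : weight I + 2 ≤ 8) : Span f (weight I + 2) (D 3 (dstarF I f)) := by
  induction k generalizing I with
  | zero =>
    have := card_le_weight I
    rw [D_three_dstarF hf I h4 (by omega)]
    refine .base _ ?_
    simp [weight, Function.update]
    omega
  | succ k ih =>
    set I' := Function.update I 4 k with hI'
    have h0 : I' 0 = I 0 := rfl
    have h1 : I' 1 = I 1 := rfl
    have h2 : I' 2 = I 2 := rfl
    have h3 : I' 3 = I 3 := rfl
    have h4' : I' 4 = k := by simp [hI']
    have hw' : weight I' + 1 = weight I := by
      unfold weight
      omega
    have hI : I = Function.update I' 4 (I' 4 + 1) := by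
      funext j
      rcases eq_or_ne j 4 with rfl | hj
      · simp [h4', h4]
      · simp [hI', hj]
    have hc := card_le_weight I'
    have e : dstarF I f = D 4 (dstarF I' f) := by
      rw [D_four_dstarF hf I' (by omega), ← hI]
    have hs := ih I' h4' (by omega)
    rw [e, D_three_four (reg_dstarF hf I' (by omega))]
    have hs' := hs.D_tangential hf (by omega) (d := 4) (by decide)
    have e2 : weight I' + 2 + 1 = weight I + 2 := by omega
    rw [e2] at hs'
    refine .add hs' ?_
    have : (-2 * Yc * D 3 (dstarF I' f) : Fam A₀ ρ₁ ρ₂)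
        = (fun _ _ => (-2 : ℝ)) * (Yc * D 3 (dstarF I' f)) := by
      have : (fun _ _ => (-2 : ℝ) : Fam A₀ ρ₁ ρ₂) = -2 := rfl
      rw [this]
      ring
    rw [this]
    exact .cmul _ (.ymul (hs.mono (by omega)))

theorem Span.D_three {m : ℕ} (h : Span f m g) (hf : Reg 8 f) (hm : m + 2 ≤ 8) :
    Span f (m + 2) (D 3 g) := by
  have hr : ∀ {g}, Span f m g → Reg 1 g := fun h => h.reg hf (by omega)
  induction h with
  | base I h => exact (Span.D_three_base hf _ I rfl (by omega)).mono (by omega)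
  | add h1 h2 i1 i2 => rw [D_add 3 (hr h1) (hr h2)]; exact .add i1 i2
  | ymul h i =>
    rw [D_mul 3 (Reg.Yc 1) (hr h), D_three_Yc, one_mul]
    exact .add (h.mono (by omega)) (.ymul i)
  | cmul c h i =>
    rw [D_mul 3 (Reg.const 1 c) (hr h), D_const, zero_mul, zero_add]
    exact .cmul c i

theorem Span.D {m : ℕ} (h : Span f m g) (hf : Reg 8 f) (d : Fin 5) (hm : m + wt d ≤ 8) :
    Span f (m + wt d) (D d g) := by
  rcases eq_or_ne d 3 with rfl | hd
  · exact h.D_three hf hm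
  · have : wt d = 1 := by fin_cases d <;> simp_all [wt]
    rw [this] at hm ⊢
    exact h.D_tangential hf hm hd

theorem Span.word (hf : Reg 8 f) (w : List (Fin 5)) {m : ℕ} (hg : Span f m g)
    (hw : m + wtl w ≤ 8) : Span f (m + wtl w) (Wd w g) := by
  induction w generalizing m g with
  | nil => exact hg
  | cons d w ih =>
    simp only [wtl, List.map_cons, List.sum_cons] at hw ⊢
    have := ih (hg.D hf d (by omega)) (by unfold wtl; omega)
    simp only [wtl, add_assoc] at this
    exact this

/-- The energy contains each derivative in one fixed order only, whereas the class asks for all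
words. The span of the ordered derivatives over polynomials in `y₃` is stable under every
derivation, within the available weight. -/
theorem H.of_dstarF (hf : Reg 8 f) (hb : ∀ I, weight I ≤ 8 → L2 (dstarF I f)) : H 8 f := by
  refine ⟨hf, fun w hw => ?_⟩
  have h0 : Span f 0 f := by
    have := Span.base (f := f) (m := 0) 0 (by simp [weight])
    simpa [dstarF] using this
  have h1 := h0.word hf w (by omega)
  exact h1.l2 hf (by omega) hb

/-- Functions whose anisotropic norm is part of the energy are of order eight. -/
theorem H.of_starSq {g : Sol A₀ ρ₁ ρ₂ → SpaceTime → ℝ}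
    (hg : ∀ s, ContDiffOn ℝ 8 (g s) (cyl s.T))
    (hE : ∀ s, ∀ t ∈ Icc 0 s.T, starSq s.T 8 (g s) t ≤ En s t) : H 8 (resF g) := by
  refine H.of_dstarF (fun s => Sm.congr (by exact_mod_cast hg s) fun _ => rfl) fun I hI => ?_
  refine ⟨1, 1, zero_le_one, fun s t ht => ?_⟩
  simp only [dstarF_resF]
  rw [cint_resF _ s ht]
  have h1 : l2Sq (dstar s.T I (g s)) t ≤ starSq s.T 8 (g s) t :=
    Finset.single_le_sum (f := fun I => l2Sq (dstar s.T I (g s)) t)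
      (fun _ _ => l2Sq_nonneg _ _) (mem_indicesLE.2 hI)
  have h2 := hE s t ht
  have h3 := En_nonneg s 0
  unfold Mg
  linarith

end Atoms

/-! ### Initial values as functions constant in time -/

section TimeZero

variable {A₀ ρ₁ ρ₂ : ℝ} {f g : Fam A₀ ρ₁ ρ₂}

/-- The initial values of a family, constant in time. -/
def atZ (f : Fam A₀ ρ₁ ρ₂) : Fam A₀ ρ₁ ρ₂ := fun s => atZero (f s)

protected theorem Reg.atZ {n : ℕ} (h : Reg n f) : Reg n (atZ f) := fun s => (h s).atZero

theorem atZ_mul (f g : Fam A₀ ρ₁ ρ₂) : atZ (f * g) = atZ f * atZ g := rfl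

theorem cf_atZ (d : Fin 5) : atZ (cf d : Fam A₀ ρ₁ ρ₂) = cf d := by
  fin_cases d <;> rfl

theorem D_zero_atZ (hf : Reg 1 f) : D 0 (atZ f) = 0 := by
  rw [D_zero_eq]
  funext s
  change pd eT (atZero (f s)) = 0
  rw [pd_atZero s.T_pos (hf s)]
  change atZero (pd 0 (f s)) = 0
  rw [pd_zero_dir]
  rfl

theorem D_atZ {d : Fin 5} (hd : d ≠ 0) (hf : Reg 1 f) : D d (atZ f) = atZ (D d f) := by
  have h : P (vec d) (atZ f) = atZ (P (vec d) f) := by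
    funext s
    change pd (vec d) (atZero (f s)) = atZero (pd (vec d) (f s))
    rw [pd_atZero s.T_pos (hf s)]
    have : ((0 : ℝ), (vec d).2) = vec d := by fin_cases d <;> simp_all [vec]
    rw [this]
  rw [D, h, D, atZ_mul, cf_atZ]

/-- This is why `Mg` contains the initial energy: coefficients frozen at time zero, such as ρ₀ and
b₀, obey the same kind of bounds as the solution at time `t`. -/
theorem L2.atZ (h : L2 f) : L2 (atZ f) := by
  obtain ⟨C, k, hC, h⟩ := h
  refine ⟨C * 2 ^ k, k, by positivity, fun s t ht => ?_⟩
  have h0 : (0 : ℝ) ∈ Icc 0 s.T := ⟨le_rfl, s.T_pos.le⟩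
  have e : cint (FreeMHD.atZ f s * FreeMHD.atZ f s) t = cint (f s * f s) 0 := by
    refine setIntegral_congr_fun measurableSet_cell fun y hy => ?_
    simp only [ext_of_mem _ (mem_cyl_of_cell ht hy), ext_of_mem _ (mem_cyl_of_cell h0 hy)]
    rfl
  simp only [e]
  refine (h s 0 h0).trans ?_
  rw [mul_assoc, ← mul_pow]
  exact mul_le_mul_of_nonneg_left (pow_le_pow_left₀ (zero_le_one.trans (one_le_Mg s 0))
    (Mg_zero_le s t) k) hC

protected theorem H.atZ {m : ℕ} (h : H m f) : H m (atZ f) := by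
  induction m using Nat.strong_induction_on generalizing f with
  | _ m ih =>
    refine H.intro h.1.atZ h.l2.atZ fun d hd => ?_
    have := one_le_wt d
    rcases eq_or_ne d 0 with rfl | hd0
    · rw [D_zero_atZ (h.1.mono (by omega))]
      exact H.zero _
    · rw [D_atZ hd0 (h.1.mono (by omega))]
      exact ih _ (by omega) (h.D' d hd)

theorem eq_atZ_of_D_zero (hf : Reg 1 f) (h : D 0 f = 0) : f = atZ f := by
  funext s z
  have hm : MapsTo (fun t : ℝ => ((t, z.1.2) : SpaceTime)) (Icc 0 s.T) (cyl s.T) :=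
    fun t ht => ⟨ht, z.2.2⟩
  have hd : ∀ t ∈ Icc 0 s.T, HasDerivWithinAt (fun t => ext (f s) (t, z.1.2)) 0 (Icc 0 s.T) t := by
    intro t ht
    have h1 := (hf s).hasDerivWithinAt_comp
      ((hasDerivAt_id t).prodMk (hasDerivAt_const t z.1.2)).hasDerivWithinAt hm ht
    have h2 : pd eT (f s) = 0 := by
      rw [D_zero_eq] at h
      exact congrFun h s
    change HasDerivWithinAt _ (ext (pd eT (f s)) (t, z.1.2)) _ _ at h1
    rw [h2, ext_of_mem _ (hm ht)] at h1
    exact h1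
  have := constant_of_derivWithin_zero (f := fun t => ext (f s) (t, z.1.2))
    (fun t ht => (hd t ht).differentiableWithinAt)
    (fun t ht => (hd t (Ico_subset_Icc_self ht)).derivWithin
      (uniqueDiffOn_Icc s.T_pos t (Ico_subset_Icc_self ht))) z.1.1 z.2.1
  rw [ext_of_mem _ z.2, ext_of_mem _ (zero_mem_cyl z.2)] at this
  exact this

end TimeZero

/-! ### The unknowns, the equation of state and the cofactors as families -/

section SolutionFields

variable (A₀ ρ₁ ρ₂ : ℝ)

/-- The components of the flow map. -/
def etaF (i : Fin 3) : Fam A₀ ρ₁ ρ₂ := resF fun s z => s.η z i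

/-- The components of the velocity. -/
def velF (i : Fin 3) : Fam A₀ ρ₁ ρ₂ := resF fun s z => s.v z i

/-- The components of the magnetic field. -/
def magF (i : Fin 3) : Fam A₀ ρ₁ ρ₂ := resF fun s z => mag s.T s.b₀ s.η z i

/-- The total pressure. -/
def QF : Fam A₀ ρ₁ ρ₂ := resF fun s => totalP s.T s.b₀ s.η s.q

/-- The pressure. -/
def qF : Fam A₀ ρ₁ ρ₂ := resF fun s => s.q

/-- The components of the initial magnetic field. -/
def b0F (l : Fin 3) : Fam A₀ ρ₁ ρ₂ := resF fun s z => s.b₀ z.2 l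

/-- The Jacobian determinant of the flow map. -/
def JF : Fam A₀ ρ₁ ρ₂ := resF fun s => jac s.T s.η

/-- The derivatives of the equation of state, evaluated at the pressure. -/
def Rj (j : ℕ) : Fam A₀ ρ₁ ρ₂ := fun s z => iteratedDeriv j s.R (s.q z)

/-- The initial density. -/
def rho0 : Fam A₀ ρ₁ ρ₂ := atZ (Rj A₀ ρ₁ ρ₂ 0)

/-- The space derivatives among the five derivations. -/
def dl : Fin 3 → Fin 5 := ![1, 2, 3]

/-- The entries `∂_l η_i` of the deformation gradient. -/
def X (l i : Fin 3) : Fam A₀ ρ₁ ρ₂ := D (dl l) (etaF A₀ ρ₁ ρ₂ i)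

variable {A₀ ρ₁ ρ₂}

theorem D_dl_eq (l : Fin 3) (f : Fam A₀ ρ₁ ρ₂) : D (dl l) f = P (eX l) f := by
  fin_cases l
  · exact D_one_eq f
  · exact D_two_eq f
  · exact D_three_eq f

theorem D_dl_resF (l : Fin 3) (g : Sol A₀ ρ₁ ρ₂ → SpaceTime → ℝ) :
    D (dl l) (resF g) = resF fun s => dx s.T l (g s) := by
  rw [D_dl_eq]
  exact funext fun s => pd_res _ _

theorem D_zero_resF (g : Sol A₀ ρ₁ ρ₂ → SpaceTime → ℝ) :
    D 0 (resF g) = resF fun s => dt s.T (g s) := by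
  rw [D_zero_eq]
  exact funext fun s => pd_res _ _

theorem En_eta_le (s : Sol A₀ ρ₁ ρ₂) (i : Fin 3) (t : ℝ) :
    starSq s.T 8 (fun z => s.η z i) t ≤ En s t ∧ starSq s.T 8 (fun z => s.v z i) t ≤ En s t
      ∧ starSq s.T 8 (fun z => mag s.T s.b₀ s.η z i) t ≤ En s t
      ∧ starSq s.T 8 (totalP s.T s.b₀ s.η s.q) t ≤ En s t
      ∧ ∑ I ∈ indicesEq 8, bdrySq (bdryUnknown s.T s.η I) t ≤ En s t := by
  have h1 := Finset.single_le_sum (f := fun i => starSq s.T 8 (fun z => s.η z i) t)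
    (fun _ _ => starSq_nonneg _ _ _ _) (Finset.mem_univ i)
  have h2 := Finset.single_le_sum (f := fun i => starSq s.T 8 (fun z => s.v z i) t)
    (fun _ _ => starSq_nonneg _ _ _ _) (Finset.mem_univ i)
  have h3 := Finset.single_le_sum (f := fun i => starSq s.T 8 (fun z => mag s.T s.b₀ s.η z i) t)
    (fun _ _ => starSq_nonneg _ _ _ _) (Finset.mem_univ i)
  have h4 : 0 ≤ ∑ I ∈ indicesEq 8, bdrySq (bdryUnknown s.T s.η I) t :=
    Finset.sum_nonneg fun _ _ => bdrySq_nonneg _ _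
  have h5 := starSq_nonneg s.T 8 (totalP s.T s.b₀ s.η s.q) t
  have h6 := starSq_nonneg s.T 8 (fun z => s.η z i) t
  have h7 := starSq_nonneg s.T 8 (fun z => s.v z i) t
  have h8 := starSq_nonneg s.T 8 (fun z => mag s.T s.b₀ s.η z i) t
  unfold En energy
  refine ⟨?_, ?_, ?_, ?_, ?_⟩ <;> linarith

theorem H_etaF (i : Fin 3) : H 8 (etaF A₀ ρ₁ ρ₂ i) :=
  H.of_starSq (fun s => contDiffOn_pi.1 s.isSol.smooth_η i) fun s t _ => (En_eta_le s i t).1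

theorem H_velF (i : Fin 3) : H 8 (velF A₀ ρ₁ ρ₂ i) :=
  H.of_starSq (fun s => contDiffOn_pi.1 s.isSol.smooth_v i) fun s t _ => (En_eta_le s i t).2.1

theorem H_magF (i : Fin 3) : H 8 (magF A₀ ρ₁ ρ₂ i) :=
  H.of_starSq (fun s => contDiffOn_pi.1 s.isSol.smooth_b i) fun s t _ => (En_eta_le s i t).2.2.1

theorem H_QF : H 8 (QF A₀ ρ₁ ρ₂) := by
  refine H.of_starSq (fun s => ?_) fun s t _ => (En_eta_le s 0 t).2.2.2.1
  have h := s.isSol.smooth_b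
  refine s.isSol.smooth_q.add (contDiffOn_const.mul (ContDiffOn.sum fun i _ => ?_))
  exact (contDiffOn_pi.1 h i).pow 2

/-- The constant family one half. -/
def half : Fam A₀ ρ₁ ρ₂ := fun _ _ => 1 / 2

theorem two_mul_half : (2 : Fam A₀ ρ₁ ρ₂) * half = 1 := by
  funext s z
  change (2 : ℝ) * (1 / 2) = 1
  norm_num

theorem QF_eq : QF A₀ ρ₁ ρ₂ = qF A₀ ρ₁ ρ₂ + half * ∑ i, magF A₀ ρ₁ ρ₂ i * magF A₀ ρ₁ ρ₂ i := by
  funext s z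
  change totalP s.T s.b₀ s.η s.q z = _
  simp only [totalP, Pi.add_apply, Pi.mul_apply, Finset.sum_apply]
  congr 2
  exact Finset.sum_congr rfl fun i _ => sq _

theorem H_qF : H 8 (qF A₀ ρ₁ ρ₂) := by
  have e : qF A₀ ρ₁ ρ₂ = QF A₀ ρ₁ ρ₂ - half * ∑ i, magF A₀ ρ₁ ρ₂ i * magF A₀ ρ₁ ρ₂ i := by
    rw [QF_eq]; ring
  rw [e]
  refine H_QF.sub (H.const_smul _ (H.sum fun i _ => ?_))
  exact (H_magF i).smul (H_magF i) (by norm_num) le_rfl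

theorem Reg_Rj (j n : ℕ) (hn : n ≤ 8) : Reg n (Rj A₀ ρ₁ ρ₂ j) := by
  intro s
  have h1 : ContDiff ℝ n (iteratedDeriv j s.R) := by
    have h := (s.liquid.smooth).iterate_deriv j
    rw [← iteratedDeriv_eq_iterate] at h
    exact h.of_le (by exact_mod_cast le_top)
  exact Sm.comp h1 ((H_qF (A₀ := A₀) (ρ₁ := ρ₁) (ρ₂ := ρ₂)).1 s |>.mono hn)

theorem D_Rj (d : Fin 5) (j : ℕ) : D d (Rj A₀ ρ₁ ρ₂ j) = Rj A₀ ρ₁ ρ₂ (j + 1) * D d (qF A₀ ρ₁ ρ₂) := by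
  have h : P (vec d) (Rj A₀ ρ₁ ρ₂ j) = Rj A₀ ρ₁ ρ₂ (j + 1) * P (vec d) (qF A₀ ρ₁ ρ₂) := by
    funext s
    refine pd_comp s.T_pos ((H_qF (A₀ := A₀) (ρ₁ := ρ₁) (ρ₂ := ρ₂)).1 s |>.mono (by norm_num))
      (φ := iteratedDeriv j s.R) fun z => ?_
    have h1 : Differentiable ℝ (iteratedDeriv j s.R) :=
      (s.liquid.smooth).differentiable_iteratedDeriv j (by exact_mod_cast WithTop.coe_lt_top _)
    have h2 := (h1 (s.q z)).hasDerivAt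
    rw [← iteratedDeriv_succ] at h2
    exact h2
  rw [D, D, h]
  ring

theorem LI_Rj (j : ℕ) (hj : j ≤ 8) : LI (Rj A₀ ρ₁ ρ₂ j) := by
  refine ⟨|A₀| + |ρ₂|, 0, by positivity, fun s z _ => ?_⟩
  rw [pow_zero, mul_one]
  have h1 := abs_nonneg ρ₂
  have h2 := abs_nonneg A₀
  rcases Nat.eq_zero_or_pos j with rfl | hj0
  · have h := s.liquid.density_bounds z z.2
    have h3 := s.ρ₁_pos
    simp only [Rj, iteratedDeriv_zero]
    rw [abs_of_pos (by linarith)]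
    linarith [le_abs_self ρ₂]
  · have h := s.liquid.deriv_upper z z.2 j hj0 hj
    exact h.trans (by linarith [le_abs_self A₀])

/-- Each differentiation of `R^{(j)}(q)` uses the next derivative of `R`, so order and index trade
off within the eight bounds that are available. -/
theorem H_Rj (c j : ℕ) (hcj : c + j ≤ 8) : H c (Rj A₀ ρ₁ ρ₂ j) := by
  induction c using Nat.strong_induction_on generalizing j with
  | _ c ih =>
    refine H.intro (Reg_Rj j c (by omega)) (L2.of_LI (Reg_Rj j 0 (by omega)) (LI_Rj j (by omega)))
      fun d hd => ?_
    have h1 := one_le_wt d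
    have h2 : wt d ≤ 2 := by fin_cases d <;> simp [wt]
    rw [D_Rj]
    exact (ih (c - wt d) (by omega) (j + 1) (by omega)).mul (H_qF.D' d (by omega)) le_rfl
      (by omega) (by omega)

theorem Rj_zero_ge (s : Sol A₀ ρ₁ ρ₂) (z : cyl s.T) : ρ₁ ≤ Rj A₀ ρ₁ ρ₂ 0 s z := by
  simpa [Rj] using (s.liquid.density_bounds z z.2).1

theorem Rj_zero_le (s : Sol A₀ ρ₁ ρ₂) (z : cyl s.T) : Rj A₀ ρ₁ ρ₂ 0 s z ≤ ρ₂ := by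
  simpa [Rj] using (s.liquid.density_bounds z z.2).2

theorem H_rho0 : H 8 (rho0 A₀ ρ₁ ρ₂) := (H_Rj 8 0 le_rfl).atZ

theorem rho0_ge (s : Sol A₀ ρ₁ ρ₂) (z : cyl s.T) : ρ₁ ≤ rho0 A₀ ρ₁ ρ₂ s z := Rj_zero_ge s _

theorem D_zero_etaF (i : Fin 3) : D 0 (etaF A₀ ρ₁ ρ₂ i) = velF A₀ ρ₁ ρ₂ i := by
  rw [etaF, D_zero_resF]
  funext s z
  exact s.isSol.flow z z.2 i

theorem D_zero_X (l i : Fin 3) : D 0 (X A₀ ρ₁ ρ₂ l i) = D (dl l) (velF A₀ ρ₁ ρ₂ i) := by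
  rw [X, D_comm (by decide) _ ((H_etaF i).1.mono (by norm_num)), D_zero_etaF]

theorem X_apply (l i : Fin 3) (s : Sol A₀ ρ₁ ρ₂) (z : cyl s.T) :
    X A₀ ρ₁ ρ₂ l i s z = gradη s.T s.η z i l := by
  rw [X, etaF, D_dl_resF]
  rfl

/-- The cross product of families of vector fields. -/
def cross (u w : Fin 3 → Fam A₀ ρ₁ ρ₂) (i : Fin 3) : Fam A₀ ρ₁ ρ₂ :=
  u (i + 1) * w (i + 2) - u (i + 2) * w (i + 1)

/-- The cofactor vectors `J A^{l·}`. -/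
def cof (l : Fin 3) : Fin 3 → Fam A₀ ρ₁ ρ₂ := cross (X A₀ ρ₁ ρ₂ (l + 1)) (X A₀ ρ₁ ρ₂ (l + 2))

/-- The rows of the cofactor matrix are cross products of the columns ∂_lη, hence the dual frame up
to the factor J. -/
theorem sum_cof_mul_X (l m : Fin 3) : ∑ i, cof l i * X A₀ ρ₁ ρ₂ m i
    = if l = m then JF A₀ ρ₁ ρ₂ else 0 := by
  have hJ : JF A₀ ρ₁ ρ₂ = X A₀ ρ₁ ρ₂ 0 0 * X A₀ ρ₁ ρ₂ 1 1 * X A₀ ρ₁ ρ₂ 2 2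
      - X A₀ ρ₁ ρ₂ 0 0 * X A₀ ρ₁ ρ₂ 2 1 * X A₀ ρ₁ ρ₂ 1 2
      - X A₀ ρ₁ ρ₂ 1 0 * X A₀ ρ₁ ρ₂ 0 1 * X A₀ ρ₁ ρ₂ 2 2
      + X A₀ ρ₁ ρ₂ 1 0 * X A₀ ρ₁ ρ₂ 2 1 * X A₀ ρ₁ ρ₂ 0 2
      + X A₀ ρ₁ ρ₂ 2 0 * X A₀ ρ₁ ρ₂ 0 1 * X A₀ ρ₁ ρ₂ 1 2
      - X A₀ ρ₁ ρ₂ 2 0 * X A₀ ρ₁ ρ₂ 1 1 * X A₀ ρ₁ ρ₂ 0 2 := by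
    funext s z
    simp only [Pi.add_apply, Pi.sub_apply, Pi.mul_apply, X_apply]
    exact Matrix.det_fin_three _
  rw [Fin.sum_univ_three]
  fin_cases l <;> fin_cases m <;> simp [cof, cross, hJ] <;> ring

theorem JF_eq : JF A₀ ρ₁ ρ₂ = ∑ i, cof 2 i * X A₀ ρ₁ ρ₂ 2 i := by
  rw [sum_cof_mul_X, if_pos rfl]

theorem JF_pos (s : Sol A₀ ρ₁ ρ₂) (z : cyl s.T) : 0 < JF A₀ ρ₁ ρ₂ s z := s.isSol.jac_pos z z.2

theorem JF_ne (s : Sol A₀ ρ₁ ρ₂) (z : cyl s.T) : JF A₀ ρ₁ ρ₂ s z ≠ 0 := (JF_pos s z).ne.symm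

/-- Entries of the inverse deformation gradient. -/
def AF (l i : Fin 3) : Fam A₀ ρ₁ ρ₂ := fun s z => invGrad s.T s.η z l i

theorem AF_eq (l i : Fin 3) : AF (A₀ := A₀) (ρ₁ := ρ₁) (ρ₂ := ρ₂) l i
    = (JF A₀ ρ₁ ρ₂)⁻¹ * cof l i := by
  funext s z
  have h : invGrad s.T s.η z
      = Matrix.of fun l i => ((JF A₀ ρ₁ ρ₂)⁻¹ * cof (A₀ := A₀) (ρ₁ := ρ₁) (ρ₂ := ρ₂) l i) s z := by
    refine Matrix.inv_eq_left_inv ?_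
    ext l m
    have h1 := congrFun (congrFun (sum_cof_mul_X (A₀ := A₀) (ρ₁ := ρ₁) (ρ₂ := ρ₂) l m) s) z
    simp only [Finset.sum_apply, Pi.mul_apply, X_apply] at h1
    simp only [Matrix.mul_apply, Matrix.of_apply, Pi.mul_apply, Pi.inv_apply, mul_assoc]
    rw [← Finset.mul_sum, h1, Matrix.one_apply]
    split_ifs
    · exact inv_mul_cancel₀ (JF_ne s z)
    · simp
  change invGrad s.T s.η z l i = _
  rw [h]
  rfl

theorem Reg_X (l i : Fin 3) : Reg 7 (X A₀ ρ₁ ρ₂ l i) := (H_etaF i).1.D _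

theorem Reg_cof (l i : Fin 3) : Reg 7 (cof (A₀ := A₀) (ρ₁ := ρ₁) (ρ₂ := ρ₂) l i) :=
  ((Reg_X _ _).mul (Reg_X _ _)).sub ((Reg_X _ _).mul (Reg_X _ _))

theorem JF_mul_inv : JF A₀ ρ₁ ρ₂ * (JF A₀ ρ₁ ρ₂)⁻¹ = 1 := by
  funext s z
  exact mul_inv_cancel₀ (JF_ne s z)

/-- Jacobi's formula. It identifies the divergence in the continuity equation with the logarithmic
time derivative of J. -/
theorem D_zero_JF : D 0 (JF A₀ ρ₁ ρ₂) = ∑ l, ∑ i, cof l i * D (dl l) (velF A₀ ρ₁ ρ₂ i) := by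
  have hX : ∀ l i, Reg 1 (X A₀ ρ₁ ρ₂ l i) := fun l i => (Reg_X l i).mono (by norm_num)
  have hXX : ∀ l i l' i', Reg 1 (X A₀ ρ₁ ρ₂ l i * X A₀ ρ₁ ρ₂ l' i') :=
    fun l i l' i' => (hX l i).mul (hX l' i')
  have hc : ∀ l i, Reg 1 (cof (A₀ := A₀) (ρ₁ := ρ₁) (ρ₂ := ρ₂) l i) :=
    fun l i => (Reg_cof l i).mono (by norm_num)
  have hDc : ∀ i, D 0 (cof (A₀ := A₀) (ρ₁ := ρ₁) (ρ₂ := ρ₂) 2 i)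
      = D (dl 0) (velF A₀ ρ₁ ρ₂ (i + 1)) * X A₀ ρ₁ ρ₂ 1 (i + 2)
        + X A₀ ρ₁ ρ₂ 0 (i + 1) * D (dl 1) (velF A₀ ρ₁ ρ₂ (i + 2))
        - (D (dl 0) (velF A₀ ρ₁ ρ₂ (i + 2)) * X A₀ ρ₁ ρ₂ 1 (i + 1)
        + X A₀ ρ₁ ρ₂ 0 (i + 2) * D (dl 1) (velF A₀ ρ₁ ρ₂ (i + 1))) := by
    intro i
    have e1 : (2 : Fin 3) + 1 = 0 := by decide
    have e2 : (2 : Fin 3) + 2 = 1 := by decide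
    rw [cof, cross, D_sub 0 (hXX _ _ _ _) (hXX _ _ _ _), D_mul 0 (hX _ _) (hX _ _),
      D_mul 0 (hX _ _) (hX _ _), D_zero_X, D_zero_X, D_zero_X, D_zero_X, e1, e2]
  rw [JF_eq, D_sum 0 fun i _ => (hc 2 i).mul (hX 2 i)]
  simp only [D_mul 0 (hc 2 _) (hX 2 _), hDc, D_zero_X, Fin.sum_univ_three]
  simp [cof, cross]
  ring

end SolutionFields

/-! ### Conservation of mass, the frozen field, and the momentum equation -/

section SolutionFacts

variable {A₀ ρ₁ ρ₂ : ℝ}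

theorem Rj_zero_ne (s : Sol A₀ ρ₁ ρ₂) (z : cyl s.T) : Rj A₀ ρ₁ ρ₂ 0 s z ≠ 0 :=
  (s.ρ₁_pos.trans_le (Rj_zero_ge s z)).ne'

theorem rho0_ne (s : Sol A₀ ρ₁ ρ₂) (z : cyl s.T) : rho0 A₀ ρ₁ ρ₂ s z ≠ 0 := Rj_zero_ne s _

theorem Reg_JF_seven : Reg 7 (JF A₀ ρ₁ ρ₂) := by
  rw [JF_eq]
  exact Reg.sum fun i _ => (Reg_cof 2 i).mul (Reg_X 2 i)

/-- The deformation gradient is the identity at time zero. -/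
theorem atZ_X (l i : Fin 3) : atZ (X A₀ ρ₁ ρ₂ l i) = if l = i then 1 else 0 := by
  have hr : Reg 1 (etaF A₀ ρ₁ ρ₂ i) := (H_etaF i).1.mono (by norm_num)
  have h0 : (dl l) ≠ 0 := by fin_cases l <;> decide
  rw [X, ← D_atZ h0 hr, D_dl_eq]
  have h1 : atZ (etaF A₀ ρ₁ ρ₂ i) = resF fun _ z => z.2 i := by
    funext s z
    change s.η (0, z.1.2) i = z.1.2 i
    rw [s.isSol.initial_η z.1.2 z.2.2]
  rw [h1]
  funext s z
  have h2 : HasFDerivWithinAt (fun w : SpaceTime => w.2 i)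
      ((ContinuousLinearMap.proj (R := ℝ) (φ := fun _ : Fin 3 => ℝ) i).comp
        (ContinuousLinearMap.snd ℝ ℝ (Fin 3 → ℝ))) (cyl s.T) z :=
    ((ContinuousLinearMap.proj (R := ℝ) (φ := fun _ : Fin 3 => ℝ) i).comp
        (ContinuousLinearMap.snd ℝ ℝ (Fin 3 → ℝ))).hasFDerivWithinAt
  change pd (eX l) (res s.T fun z => z.2 i) z = _
  rw [pd_eq_of_hasFDerivWithinAt s.T_pos
    (hasFDerivWithinAt_ext (f := res s.T fun z => z.2 i) h2 fun w => rfl)]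
  rcases eq_or_ne l i with rfl | hli
  · simp
  · simp [hli, hli.symm]

theorem atZ_JF : atZ (JF A₀ ρ₁ ρ₂) = 1 := by
  have h : atZ (JF A₀ ρ₁ ρ₂) = ∑ i, (atZ (X A₀ ρ₁ ρ₂ 0 (i + 1)) * atZ (X A₀ ρ₁ ρ₂ 1 (i + 2))
      - atZ (X A₀ ρ₁ ρ₂ 0 (i + 2)) * atZ (X A₀ ρ₁ ρ₂ 1 (i + 1))) * atZ (X A₀ ρ₁ ρ₂ 2 i) := by
    rw [JF_eq]
    funext s z
    simp only [atZ, atZero, Finset.sum_apply, Pi.mul_apply, Pi.sub_apply]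
    rfl
  rw [h]
  simp only [atZ_X, Fin.sum_univ_three]
  simp

/-- The continuity equation divided by J, arranged as the expanded time derivative of `R/ρ₀ - 1/J`.
-/
theorem continuity_fam : Rj A₀ ρ₁ ρ₂ 1 * D 0 (qF A₀ ρ₁ ρ₂) * (rho0 A₀ ρ₁ ρ₂)⁻¹
    + D 0 (JF A₀ ρ₁ ρ₂) * (JF A₀ ρ₁ ρ₂)⁻¹ * (JF A₀ ρ₁ ρ₂)⁻¹ = 0 := by
  have hdiv : D 0 (JF A₀ ρ₁ ρ₂) * (JF A₀ ρ₁ ρ₂)⁻¹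
      = (fun s z => divA s.T s.η s.v z : Fam A₀ ρ₁ ρ₂) := by
    rw [D_zero_JF]
    funext s z
    simp only [divA, gradA, Pi.mul_apply, Finset.sum_apply, Finset.sum_mul]
    rw [Finset.sum_comm]
    refine Finset.sum_congr rfl fun i _ => Finset.sum_congr rfl fun l _ => ?_
    have h1 := congrFun (congrFun (AF_eq (A₀ := A₀) (ρ₁ := ρ₁) (ρ₂ := ρ₂) l i) s) z
    have h2 : invGrad s.T s.η z l i = (JF A₀ ρ₁ ρ₂ s z)⁻¹ * cof l i s z := h1
    rw [h2, velF, D_dl_resF]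
    simp only [Pi.inv_apply, resF, res]
    ring
  rw [hdiv]
  funext s z
  have h1 := s.isSol.continuity z z.2
  have h2 : D 0 (qF A₀ ρ₁ ρ₂) s z = dt s.T s.q z := by rw [qF, D_zero_resF]; rfl
  have h3 : Rj A₀ ρ₁ ρ₂ 1 s z = deriv s.R (s.q z) := by simp [Rj, iteratedDeriv_one]
  have h4 : rho0 A₀ ρ₁ ρ₂ s z = s.R (s.q (0, z.1.2)) := by simp [rho0, atZ, atZero, Rj]
  have h5 : JF A₀ ρ₁ ρ₂ s z = jac s.T s.η z := rfl
  have h6 := JF_ne s z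
  have h7 := rho0_ne s z
  simp only [Pi.add_apply, Pi.mul_apply, Pi.inv_apply, Pi.zero_apply]
  rw [h2, h3, eq_neg_of_add_eq_zero_right h1, ← h4, ← h5]
  field_simp
  ring

/-- Conservation of mass. -/
theorem Rj_mul_JF : Rj A₀ ρ₁ ρ₂ 0 * JF A₀ ρ₁ ρ₂ = rho0 A₀ ρ₁ ρ₂ := by
  have hR : Reg 1 (Rj A₀ ρ₁ ρ₂ 0) := Reg_Rj 0 1 (by norm_num)
  have hρ : Reg 1 (rho0 A₀ ρ₁ ρ₂) := H_rho0.1.mono (by norm_num)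
  have hJ : Reg 1 (JF A₀ ρ₁ ρ₂) := Reg_JF_seven.mono (by norm_num)
  have hρi := hρ.inv rho0_ne
  have hJi := hJ.inv JF_ne
  -- A quantity constant in time; it vanishes initially because J = 1 there and ρ₀ is the initial
  -- density.
  have hD : D 0 (Rj A₀ ρ₁ ρ₂ 0 * (rho0 A₀ ρ₁ ρ₂)⁻¹ - (JF A₀ ρ₁ ρ₂)⁻¹) = 0 := by
    have h0 : D 0 (rho0 A₀ ρ₁ ρ₂) = 0 := D_zero_atZ hR
    rw [D_sub 0 (hR.mul hρi) hJi, D_mul 0 hR hρi, D_inv 0 hρ rho0_ne, D_inv 0 hJ JF_ne, h0, D_Rj]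
    have := continuity_fam (A₀ := A₀) (ρ₁ := ρ₁) (ρ₂ := ρ₂)
    linear_combination this
  have h := eq_atZ_of_D_zero ((hR.mul hρi).sub hJi) hD
  funext s z
  have h1 := congrFun (congrFun h s) z
  have h2 : atZ (Rj A₀ ρ₁ ρ₂ 0 * (rho0 A₀ ρ₁ ρ₂)⁻¹ - (JF A₀ ρ₁ ρ₂)⁻¹) s z
      = rho0 A₀ ρ₁ ρ₂ s z * (rho0 A₀ ρ₁ ρ₂ s z)⁻¹ - (atZ (JF A₀ ρ₁ ρ₂) s z)⁻¹ := rfl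
  rw [h2, atZ_JF, mul_inv_cancel₀ (rho0_ne s z)] at h1
  have h3 := JF_ne s z
  have h4 := rho0_ne s z
  simp only [Pi.sub_apply, Pi.mul_apply, Pi.inv_apply, Pi.one_apply, inv_one, sub_self] at h1 ⊢
  field_simp at h1
  linarith

theorem JF_eq_div : JF A₀ ρ₁ ρ₂ = (Rj A₀ ρ₁ ρ₂ 0)⁻¹ * rho0 A₀ ρ₁ ρ₂ := by
  rw [← Rj_mul_JF]
  funext s z
  have := Rj_zero_ne s z
  simp only [Pi.mul_apply, Pi.inv_apply]
  field_simp

theorem H_Rj_inv : H 8 (Rj A₀ ρ₁ ρ₂ 0)⁻¹ := by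
  by_cases h : 0 < ρ₁
  · exact (H_Rj 8 0 le_rfl).inv (by norm_num) h Rj_zero_ge
  -- When `ρ₁` is not positive the index type of solutions is empty, so all families coincide.
  · have : (Rj A₀ ρ₁ ρ₂ 0)⁻¹ = 0 := funext fun s => absurd s.ρ₁_pos h
    rw [this]
    exact H.zero 8

/-- As a polynomial in ∂η, J would only have order six, since ∂₃ costs two. Mass conservation makes
it as regular as the pressure; this gain drives the whole argument. -/
theorem H_JF : H 8 (JF A₀ ρ₁ ρ₂) := by
  rw [JF_eq_div]
  exact H_Rj_inv.smul H_rho0 (by norm_num) le_rfl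

theorem JF_ge (s : Sol A₀ ρ₁ ρ₂) (z : cyl s.T) : ρ₁ / ρ₂ ≤ JF A₀ ρ₁ ρ₂ s z := by
  have h1 := congrFun (congrFun (Rj_mul_JF (A₀ := A₀) (ρ₁ := ρ₁) (ρ₂ := ρ₂)) s) z
  simp only [Pi.mul_apply] at h1
  have h2 := Rj_zero_le s z
  have h3 := rho0_ge s z
  have h4 := JF_pos s z
  have h5 := s.ρ₁_pos
  rw [div_le_iff₀ (h5.trans s.ρ₁_lt)]
  nlinarith

theorem H_JF_inv : H 8 (JF A₀ ρ₁ ρ₂)⁻¹ := by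
  by_cases h : 0 < ρ₁ / ρ₂
  · exact H_JF.inv (by norm_num) h JF_ge
  · have : (JF A₀ ρ₁ ρ₂)⁻¹ = 0 := funext fun s =>
      absurd (div_pos s.ρ₁_pos (s.ρ₁_pos.trans s.ρ₁_lt)) h
    rw [this]
    exact H.zero 8

theorem JF_mul_magF (i : Fin 3) : JF A₀ ρ₁ ρ₂ * magF A₀ ρ₁ ρ₂ i
    = ∑ l, b0F A₀ ρ₁ ρ₂ l * X A₀ ρ₁ ρ₂ l i := by
  funext s z
  have h : magF A₀ ρ₁ ρ₂ i s z = (JF A₀ ρ₁ ρ₂ s z)⁻¹ * ∑ l, s.b₀ z.1.2 l * X A₀ ρ₁ ρ₂ l i s z := by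
    simp only [X_apply]
    rfl
  simp only [Pi.mul_apply, Finset.sum_apply]
  rw [h, mul_inv_cancel_left₀ (JF_ne s z)]
  rfl

/-- At time zero the deformation gradient is the identity, so b equals b₀. Thus no separate norm of
b₀ is needed: its size is part of the initial energy. -/
theorem b0F_eq (l : Fin 3) : b0F A₀ ρ₁ ρ₂ l = atZ (magF A₀ ρ₁ ρ₂ l) := by
  have h := congrArg atZ (JF_mul_magF (A₀ := A₀) (ρ₁ := ρ₁) (ρ₂ := ρ₂) l)
  have h2 : atZ (∑ m, b0F A₀ ρ₁ ρ₂ m * X A₀ ρ₁ ρ₂ m l)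
      = ∑ m, b0F A₀ ρ₁ ρ₂ m * atZ (X A₀ ρ₁ ρ₂ m l) := by
    funext s z
    simp only [atZ, atZero, Finset.sum_apply, Pi.mul_apply]
    rfl
  rw [atZ_mul, atZ_JF, one_mul, h2] at h
  rw [h]
  simp only [atZ_X, mul_ite, mul_one, mul_zero, Finset.sum_ite_eq', Finset.mem_univ, if_true]

theorem H_b0F (l : Fin 3) : H 8 (b0F A₀ ρ₁ ρ₂ l) := by
  rw [b0F_eq]; exact (H_magF l).atZ

theorem D_zero_b0F (l : Fin 3) : D 0 (b0F A₀ ρ₁ ρ₂ l) = 0 := by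
  rw [b0F_eq]; exact D_zero_atZ ((H_magF l).1.mono (by norm_num))

theorem b0F_boundary (s : Sol A₀ ρ₁ ρ₂) (z : cyl s.T) (hz : z.1.2 2 = -1 ∨ z.1.2 2 = 1) :
    b0F A₀ ρ₁ ρ₂ 2 s z = 0 := s.isSol.normal_b₀ _ hz

theorem div_b0F : ∑ l, D (dl l) (b0F A₀ ρ₁ ρ₂ l) = 0 := by
  funext s z
  simp only [Finset.sum_apply, Pi.zero_apply]
  rw [← s.isSol.div_b₀ z.1.2 z.2.2]
  refine Finset.sum_congr rfl fun l _ => ?_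
  rw [D_dl_eq]
  have h1 : DifferentiableWithinAt ℝ (fun x => s.b₀ x l) slab z.1.2 :=
    (contDiffOn_pi.1 s.isSol.smooth_b₀ l).differentiableOn (by norm_num) _ z.2.2
  have h2 := HasFDerivWithinAt.comp (g := fun x => s.b₀ x l) (z : SpaceTime)
    h1.hasFDerivWithinAt (hasFDerivWithinAt_snd (s := cyl s.T)) (fun w hw => hw.2)
  change pd (eX l) (res s.T fun z => s.b₀ z.2 l) z = _
  rw [pd_eq_of_hasFDerivWithinAt s.T_pos
    (hasFDerivWithinAt_ext (f := res s.T fun z => s.b₀ z.2 l) h2 fun w => rfl)]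
  simp

/-- The derivative along the initial magnetic field. -/
def Db (f : Fam A₀ ρ₁ ρ₂) : Fam A₀ ρ₁ ρ₂ := ∑ l, b0F A₀ ρ₁ ρ₂ l * D (dl l) f

variable (A₀ ρ₁ ρ₂) in
/-- The Eulerian gradient of the total pressure. -/
def WF (k : Fin 3) : Fam A₀ ρ₁ ρ₂ :=
  (JF A₀ ρ₁ ρ₂)⁻¹ * (Db (magF A₀ ρ₁ ρ₂ k) - rho0 A₀ ρ₁ ρ₂ * D 0 (velF A₀ ρ₁ ρ₂ k))

theorem JF_mul_WF (k : Fin 3) : JF A₀ ρ₁ ρ₂ * WF A₀ ρ₁ ρ₂ k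
    = Db (magF A₀ ρ₁ ρ₂ k) - rho0 A₀ ρ₁ ρ₂ * D 0 (velF A₀ ρ₁ ρ₂ k) := by
  rw [WF, ← mul_assoc, JF_mul_inv, one_mul]

/-- The momentum equation, with `R J = ρ₀`. Defining `WF` by its magnetic and inertial terms shows
that the pressure gradient costs only ∂_t v and (b₀·∂)b, both tangential on Γ. -/
theorem WF_eq (k : Fin 3) : WF A₀ ρ₁ ρ₂ k = ∑ l, AF l k * D (dl l) (QF A₀ ρ₁ ρ₂) := by
  funext s z
  have h1 := s.isSol.momentum z z.2 k
  have h2 : gradA s.T s.η k (totalP s.T s.b₀ s.η s.q) z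
      = (∑ l, AF (A₀ := A₀) (ρ₁ := ρ₁) (ρ₂ := ρ₂) l k * D (dl l) (QF A₀ ρ₁ ρ₂)) s z := by
    simp only [QF, D_dl_resF, Finset.sum_apply, Pi.mul_apply]
    rfl
  have h3 : magD s.T s.b₀ s.η (fun w => mag s.T s.b₀ s.η w k) z
      = (JF A₀ ρ₁ ρ₂ s z)⁻¹ * Db (magF A₀ ρ₁ ρ₂ k) s z := by
    simp only [Db, magF, D_dl_resF, Finset.sum_apply, Pi.mul_apply]
    rfl
  have h4 : D 0 (velF A₀ ρ₁ ρ₂ k) s z = dt s.T (fun w => s.v w k) z := by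
    rw [velF, D_zero_resF]; rfl
  have h5 : Rj A₀ ρ₁ ρ₂ 0 s z = s.R (s.q z) := by simp [Rj]
  have h6 := congrFun (congrFun (Rj_mul_JF (A₀ := A₀) (ρ₁ := ρ₁) (ρ₂ := ρ₂)) s) z
  simp only [Pi.mul_apply] at h6
  rw [h2, h3, ← h4, ← h5] at h1
  have h7 := JF_ne s z
  simp only [WF, Pi.mul_apply, Pi.sub_apply, Pi.inv_apply]
  rw [← h6]
  field_simp at h1 ⊢
  linarith

/-- The chain rule back to Lagrangian derivatives: A is inverse to ∂η. -/
theorem sum_X_mul_WF (l : Fin 3) : ∑ k, X A₀ ρ₁ ρ₂ l k * WF A₀ ρ₁ ρ₂ k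
    = D (dl l) (QF A₀ ρ₁ ρ₂) := by
  simp only [WF_eq, AF_eq, Finset.mul_sum]
  rw [Finset.sum_comm]
  have h : ∀ m, ∑ k, X A₀ ρ₁ ρ₂ l k * ((JF A₀ ρ₁ ρ₂)⁻¹ * cof m k * D (dl m) (QF A₀ ρ₁ ρ₂))
      = (JF A₀ ρ₁ ρ₂)⁻¹ * (∑ k, cof m k * X A₀ ρ₁ ρ₂ l k) * D (dl m) (QF A₀ ρ₁ ρ₂) := by
    intro m
    rw [Finset.mul_sum, Finset.sum_mul]
    exact Finset.sum_congr rfl fun k _ => by ring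
  simp only [h, sum_cof_mul_X, mul_ite, mul_zero, ite_mul, zero_mul, Finset.sum_ite_eq',
    Finset.mem_univ, if_true]
  rw [mul_comm (JF A₀ ρ₁ ρ₂)⁻¹, JF_mul_inv, one_mul]

section Periodicity

/-- The flow map itself is periodic only up to a constant translation, which differentiation
removes. -/
theorem Per_X (l i : Fin 3) : Per (X A₀ ρ₁ ρ₂ l i) := by
  intro s
  rw [X, D_dl_eq]
  refine Pr.pd_of_shift s.T_pos ((H_etaF i).1 s |>.mono (by norm_num))
    (fun k => (Pi.single k 1 : Fin 3 → ℝ) i) (fun k hk z => ?_) _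
  exact congrFun (s.isSol.periodic_η k hk z z.2) i

theorem Per_velF (i : Fin 3) : Per (velF A₀ ρ₁ ρ₂ i) := fun s =>
  Pr.of_res (f := fun z => s.v z i) fun k hk z hz => congrFun (s.isSol.periodic_v k hk z hz) i

theorem Per_b0F (l : Fin 3) : Per (b0F A₀ ρ₁ ρ₂ l) := fun s =>
  Pr.of_res (f := fun z => s.b₀ z.2 l) fun k hk z hz =>
    congrFun (s.isSol.periodic_b₀ k hk z.2 hz.2) l

theorem Per_cof (l i : Fin 3) : Per (cof (A₀ := A₀) (ρ₁ := ρ₁) (ρ₂ := ρ₂) l i) :=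
  ((Per_X _ _).mul (Per_X _ _)).sub ((Per_X _ _).mul (Per_X _ _))

theorem Per_JF : Per (JF A₀ ρ₁ ρ₂) := by
  rw [JF_eq]
  exact Per.sum fun i _ => (Per_cof 2 i).mul (Per_X 2 i)

theorem Per_magF (i : Fin 3) : Per (magF A₀ ρ₁ ρ₂ i) := by
  have h : magF A₀ ρ₁ ρ₂ i = (JF A₀ ρ₁ ρ₂)⁻¹ * ∑ l, b0F A₀ ρ₁ ρ₂ l * X A₀ ρ₁ ρ₂ l i := by
    rw [← JF_mul_magF, ← mul_assoc, mul_comm (JF A₀ ρ₁ ρ₂)⁻¹, JF_mul_inv, one_mul]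
  rw [h]
  exact Per_JF.inv.mul (Per.sum fun l _ => (Per_b0F l).mul (Per_X l i))

end Periodicity

end SolutionFacts

/-! ### Leibniz formulas for normal derivatives -/

section NormalDerivatives

variable {A₀ ρ₁ ρ₂ : ℝ} {f g : Fam A₀ ρ₁ ρ₂} {a b c m n : ℕ}

/-- Iterated normal derivatives. -/
def dn (j : ℕ) (f : Fam A₀ ρ₁ ρ₂) : Fam A₀ ρ₁ ρ₂ := (D 3)^[j] f

theorem D_three_dn (j : ℕ) (f : Fam A₀ ρ₁ ρ₂) : D 3 (dn j f) = dn (j + 1) f :=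
  (Function.iterate_succ_apply' _ _ _).symm

theorem dn_D_three (j : ℕ) (f : Fam A₀ ρ₁ ρ₂) : dn j (D 3 f) = dn (j + 1) f := rfl

theorem D_three_eq_dn (f : Fam A₀ ρ₁ ρ₂) : D 3 f = dn 1 f := rfl

protected theorem Reg.dn (j : ℕ) (h : Reg m f) (hm : n + j ≤ m) : Reg n (dn j f) :=
  Reg.iterate 3 j (h.mono hm)

protected theorem H.dn (j : ℕ) (h : H m f) (hm : c + 2 * j ≤ m) : H c (dn j f) := by
  induction j generalizing c with
  | zero => exact h.mono hm
  | succ j ih =>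
    rw [← D_three_dn]
    exact (ih (c := c + 2) (by omega)).D 3 le_rfl

protected theorem Per.dn (j : ℕ) (hp : Per f) (hr : Reg j f) : Per (dn j f) := by
  induction j with
  | zero => exact hp
  | succ j ih =>
    rw [← D_three_dn]
    exact (ih (hr.mono (Nat.le_succ j))).D (hr.dn j (by omega)) 3

theorem D_dn {d : Fin 5} (hd : d < 3) (j : ℕ) (h : Reg (j + 1) f) :
    D d (dn j f) = dn j (D d f) := by
  induction j with
  | zero => rfl
  | succ j ih =>
    rw [← D_three_dn, D_comm hd 3 (h.dn j (by omega)), ih (h.mono (by omega)), D_three_dn]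

theorem dn_add (j : ℕ) (hf : Reg j f) (hg : Reg j g) : dn j (f + g) = dn j f + dn j g := by
  induction j with
  | zero => rfl
  | succ j ih =>
    rw [← D_three_dn, ih (hf.mono (by omega)) (hg.mono (by omega)),
      D_add 3 (hf.dn j (by omega)) (hg.dn j (by omega)), D_three_dn, D_three_dn]

theorem dn_sub (j : ℕ) (hf : Reg j f) (hg : Reg j g) : dn j (f - g) = dn j f - dn j g := by
  induction j with
  | zero => rfl
  | succ j ih =>
    rw [← D_three_dn, ih (hf.mono (by omega)) (hg.mono (by omega)),
      D_sub 3 (hf.dn j (by omega)) (hg.dn j (by omega)), D_three_dn, D_three_dn]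

theorem dn_fam_zero (j : ℕ) : dn j (0 : Fam A₀ ρ₁ ρ₂) = 0 := by
  induction j with
  | zero => rfl
  | succ j ih => rw [← D_three_dn, ih, D_fam_zero]

theorem dn_sum (j : ℕ) {ι : Type*} {t : Finset ι} {f : ι → Fam A₀ ρ₁ ρ₂}
    (h : ∀ i ∈ t, Reg j (f i)) : dn j (∑ i ∈ t, f i) = ∑ i ∈ t, dn j (f i) := by
  classical
  induction t using Finset.induction_on with
  | empty => simpa using dn_fam_zero j
  | insert a t ha ih =>
    have h' : ∀ i ∈ t, Reg j (f i) := fun i hi => h i (Finset.mem_insert_of_mem hi)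
    rw [Finset.sum_insert ha, Finset.sum_insert ha,
      dn_add j (h a (Finset.mem_insert_self _ _)) (Reg.sum h'), ih h']

theorem dn_two_mul (hf : Reg 2 f) (hg : Reg 2 g) :
    dn 2 (f * g) = dn 2 f * g + 2 * (dn 1 f * dn 1 g) + f * dn 2 g := by
  have h : dn 2 (f * g) = D 3 (D 3 (f * g)) := rfl
  rw [h, D_mul 3 (hf.mono (by norm_num)) (hg.mono (by norm_num)),
    D_add 3 ((hf.D 3).mul (hg.mono (by norm_num))) ((hf.mono (by norm_num)).mul (hg.D 3)),
    D_mul 3 (hf.D 3) (hg.mono (by norm_num)), D_mul 3 (hf.mono (by norm_num)) (hg.D 3)]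
  simp only [D_three_eq_dn]
  change dn 2 f * g + _ + (_ + f * dn 2 g) = _
  ring

theorem D_ofNat_mul (d : Fin 5) (k : ℕ) [k.AtLeastTwo] (hf : Reg 1 f) :
    D d (OfNat.ofNat k * f) = OfNat.ofNat k * D d f := by
  rw [D_mul d (Reg.ofNat 1 k) hf, D_fam_ofNat, zero_mul, zero_add]

theorem dn_three_mul (hf : Reg 3 f) (hg : Reg 3 g) : dn 3 (f * g)
    = dn 3 f * g + 3 * (dn 2 f * dn 1 g) + 3 * (dn 1 f * dn 2 g) + f * dn 3 g := by
  have rf : ∀ j, j ≤ 2 → Reg 1 (dn j f) := fun j hj => hf.dn j (by omega)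
  have rg : ∀ j, j ≤ 2 → Reg 1 (dn j g) := fun j hj => hg.dn j (by omega)
  have f0 : Reg 1 f := rf 0 (by norm_num)
  have g0 : Reg 1 g := rg 0 (by norm_num)
  have f1 := rf 1 (by norm_num)
  have g1 := rg 1 (by norm_num)
  have f2 := rf 2 (by norm_num)
  have g2 := rg 2 (by norm_num)
  rw [← D_three_dn, dn_two_mul (hf.mono (by norm_num)) (hg.mono (by norm_num)),
    D_add 3 ((f2.mul g0).add ((Reg.ofNat 1 2).mul (f1.mul g1))) (f0.mul g2),
    D_add 3 (f2.mul g0) ((Reg.ofNat 1 2).mul (f1.mul g1)), D_ofNat_mul 3 2 (f1.mul g1),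
    D_mul 3 f2 g0, D_mul 3 f1 g1, D_mul 3 f0 g2, D_three_eq_dn f, D_three_eq_dn g]
  simp only [D_three_dn]
  ring

/-- The terms of intermediate order in the Leibniz formula for four normal derivatives. -/
def comm4 (f g : Fam A₀ ρ₁ ρ₂) : Fam A₀ ρ₁ ρ₂ :=
  4 * (dn 1 f * dn 3 g) + 6 * (dn 2 f * dn 2 g) + 4 * (dn 3 f * dn 1 g)

theorem dn_four_mul (hf : Reg 4 f) (hg : Reg 4 g) :
    dn 4 (f * g) = dn 4 f * g + f * dn 4 g + comm4 f g := by
  have rf : ∀ j, j ≤ 3 → Reg 1 (dn j f) := fun j hj => hf.dn j (by omega)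
  have rg : ∀ j, j ≤ 3 → Reg 1 (dn j g) := fun j hj => hg.dn j (by omega)
  have f0 : Reg 1 f := rf 0 (by norm_num)
  have g0 : Reg 1 g := rg 0 (by norm_num)
  have f1 := rf 1 (by norm_num)
  have g1 := rg 1 (by norm_num)
  have f2 := rf 2 (by norm_num)
  have g2 := rg 2 (by norm_num)
  have f3 := rf 3 (by norm_num)
  have g3 := rg 3 (by norm_num)
  have t3 : Reg 1 (3 : Fam A₀ ρ₁ ρ₂) := Reg.ofNat 1 3
  rw [← D_three_dn, dn_three_mul (hf.mono (by norm_num)) (hg.mono (by norm_num)),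
    D_add 3 (((f3.mul g0).add (t3.mul (f2.mul g1))).add (t3.mul (f1.mul g2))) (f0.mul g3),
    D_add 3 ((f3.mul g0).add (t3.mul (f2.mul g1))) (t3.mul (f1.mul g2)),
    D_add 3 (f3.mul g0) (t3.mul (f2.mul g1)), D_ofNat_mul 3 3 (f2.mul g1),
    D_ofNat_mul 3 3 (f1.mul g2), D_mul 3 f3 g0, D_mul 3 f2 g1, D_mul 3 f1 g2, D_mul 3 f0 g3,
    D_three_eq_dn f, D_three_eq_dn g, comm4]
  simp only [D_three_dn]
  ring

/-- Each factor carries at most three normal derivatives, of weight six, and together they carry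
four, of weight eight; the product estimate needs a further four. -/
theorem H_comm4 (hf : H a f) (hg : H b g) (ha : c + 6 ≤ a) (hb : c + 6 ≤ b)
    (hab : c + 12 ≤ a + b) : H c (comm4 f g) := by
  refine ((H.ofNat_mul 4 ?_).add (H.ofNat_mul 6 ?_)).add (H.ofNat_mul 4 ?_)
  · exact (hf.dn (c := a - 2) 1 (by omega)).mul (hg.dn (c := b - 6) 3 (by omega)) (by omega)
      (by omega) (by omega)
  · exact (hf.dn (c := a - 4) 2 (by omega)).mul (hg.dn (c := b - 4) 2 (by omega)) (by omega)
      (by omega) (by omega)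
  · exact (hf.dn (c := a - 6) 3 (by omega)).mul (hg.dn (c := b - 2) 1 (by omega)) (by omega)
      (by omega) (by omega)

end NormalDerivatives

/-! ### Functions whose time derivative costs no order -/

section TimeRegular

variable {A₀ ρ₁ ρ₂ : ℝ} {f g : Fam A₀ ρ₁ ρ₂} {a b c m n : ℕ}

/-- Functions whose time derivative has the same order. -/
def HT (m : ℕ) (f : Fam A₀ ρ₁ ρ₂) : Prop := Reg 1 f ∧ H m f ∧ H m (D 0 f)

theorem H.ht (h : H (m + 1) f) : HT m f :=
  ⟨h.1.mono (by omega), h.mono (Nat.le_succ m), h.D 0 le_rfl⟩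

theorem HT.h (h : HT m f) : H m f := h.2.1

theorem HT.reg (h : HT m f) : Reg m f := h.2.1.1

protected theorem HT.mono (h : HT n f) (hmn : m ≤ n) : HT m f :=
  ⟨h.1, h.2.1.mono hmn, h.2.2.mono hmn⟩

protected theorem HT.add (hf : HT m f) (hg : HT m g) : HT m (f + g) :=
  ⟨hf.1.add hg.1, hf.2.1.add hg.2.1, by rw [D_add 0 hf.1 hg.1]; exact hf.2.2.add hg.2.2⟩

protected theorem HT.neg (hf : HT m f) : HT m (-f) :=
  ⟨hf.1.neg, hf.2.1.neg, by rw [D_neg 0 hf.1]; exact hf.2.2.neg⟩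

protected theorem HT.sub (hf : HT m f) (hg : HT m g) : HT m (f - g) := by
  rw [sub_eq_add_neg]; exact hf.add hg.neg

protected theorem HT.zero (m : ℕ) : HT m (0 : Fam A₀ ρ₁ ρ₂) := (H.zero (m + 1)).ht

protected theorem HT.sum {ι : Type*} {t : Finset ι} {f : ι → Fam A₀ ρ₁ ρ₂}
    (h : ∀ i ∈ t, HT m (f i)) : HT m (∑ i ∈ t, f i) := by
  classical
  induction t using Finset.induction_on with
  | empty => simpa using HT.zero m
  | insert a t ha ih =>
    rw [Finset.sum_insert ha]
    exact (h a (Finset.mem_insert_self _ _)).add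
      (ih fun i hi => h i (Finset.mem_insert_of_mem hi))

protected theorem HT.mul (hf : HT a f) (hg : HT b g) (hca : c ≤ a) (hcb : c ≤ b)
    (hab : c + 4 ≤ a + b) : HT c (f * g) := by
  refine ⟨hf.1.mul hg.1, hf.2.1.mul hg.2.1 hca hcb hab, ?_⟩
  rw [D_mul 0 hf.1 hg.1]
  exact (hf.2.2.mul hg.2.1 hca hcb hab).add (hf.2.1.mul hg.2.2 hca hcb hab)

protected theorem HT.ofNat_mul (k : ℕ) [k.AtLeastTwo] (hg : HT c g) : HT c (OfNat.ofNat k * g) :=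
  ((H.ofNat (c + 5) k).ht (m := c + 4)).mul hg (by omega) le_rfl (by omega)

protected theorem HT.dn (j : ℕ) (h : HT m f) (hr : Reg (j + 1) f) (hm : c + 2 * j ≤ m) :
    HT c (dn j f) :=
  ⟨hr.dn j (by omega), h.2.1.dn j hm, by
    rw [D_dn (by decide) j hr]; exact h.2.2.dn j hm⟩

protected theorem HT.D {d : Fin 5} (hd : d < 3) (h : HT m f) (hr : Reg 2 f) (hm : c + 1 ≤ m) :
    HT c (D d f) := by
  have hw : wt d = 1 := by fin_cases d <;> first | rfl | exact absurd hd (by decide)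
  refine ⟨hr.D d, h.2.1.D d (by omega), ?_⟩
  rw [D_comm (by decide) d hr]
  exact h.2.2.D d (by omega)

end TimeRegular

/-! ### Products of order-zero functions under the integral -/

section Integrable

variable {A₀ ρ₁ ρ₂ : ℝ} {f g : Fam A₀ ρ₁ ρ₂}

/-- Polynomial control of the spatial integral. -/
def L1 (f : Fam A₀ ρ₁ ρ₂) : Prop := Reg 0 f ∧ PolyBd fun s t => |cint (f s) t|

theorem H.mul_l1 (hf : H 0 f) (hg : H 0 g) : L1 (f * g) := by
  refine ⟨hf.1.mul hg.1, (PolyBd.add hf.l2 hg.l2).mono fun s t ht => ?_⟩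
  have h1 := (hf.1 s).mul (hf.1 s)
  have h2 := (hg.1 s).mul (hg.1 s)
  have h3 := (hf.1 s).mul (hg.1 s)
  rw [← cint_add h1 h2 ht, abs_le]
  constructor
  · have := cint_le_of_le h3.neg (h1.add h2) ht (c := 1) fun z _ _ => by
      simp only [Pi.add_apply, Pi.mul_apply, Pi.neg_apply]
      nlinarith [sq_nonneg (f s z + g s z), sq_nonneg (f s z), sq_nonneg (g s z)]
    have e : cint (-(f s * g s)) t = - cint (f s * g s) t := by
      have := cint_const_mul (-1) (f s * g s) ht
      rw [neg_one_mul] at this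
      rw [← this]
      exact cint_congr ht fun z _ _ => by simp
    rw [e] at this
    simp only [Pi.mul_apply] at this ⊢
    linarith
  · have := cint_le_of_le h3 (h1.add h2) ht (c := 1) fun z _ _ => by
      simp only [Pi.add_apply, Pi.mul_apply]
      nlinarith [sq_nonneg (f s z - g s z), sq_nonneg (f s z), sq_nonneg (g s z)]
    simp only [Pi.mul_apply] at this ⊢
    linarith

protected theorem L1.add (hf : L1 f) (hg : L1 g) : L1 (f + g) := by
  refine ⟨hf.1.add hg.1, (hf.2.add hg.2).mono fun s t ht => ?_⟩
  have := cint_add (hf.1 s) (hg.1 s) ht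
  simp only [Pi.add_apply]
  rw [this]
  exact abs_add_le _ _

protected theorem L1.neg (hf : L1 f) : L1 (-f) := by
  refine ⟨hf.1.neg, hf.2.mono fun s t ht => le_of_eq ?_⟩
  have := cint_const_mul (-1) (f s) ht
  have e : cint ((-f) s) t = -cint (f s) t := by
    rw [neg_one_mul] at this
    rw [← this]
    exact cint_congr ht fun z _ _ => by simp
  rw [e, abs_neg]

protected theorem L1.sub (hf : L1 f) (hg : L1 g) : L1 (f - g) := by
  rw [sub_eq_add_neg]; exact hf.add hg.neg

protected theorem L1.sum {ι : Type*} {t : Finset ι} {f : ι → Fam A₀ ρ₁ ρ₂}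
    (h : ∀ i ∈ t, L1 (f i)) : L1 (∑ i ∈ t, f i) := by
  classical
  induction t using Finset.induction_on with
  | empty => simpa using (H.zero 0).mul_l1 (H.zero 0)
  | insert a t ha ih =>
    rw [Finset.sum_insert ha]
    exact (h a (Finset.mem_insert_self _ _)).add
      (ih fun i hi => h i (Finset.mem_insert_of_mem hi))

theorem H.li_mul (hf : LI f) (hr : Reg 0 f) (hg : H 0 g) : H 0 (f * g) :=
  H.of_l2 (hr.mul hg.1) (hg.l2.mul_of_LI hr hg.1 hf)

end Integrable

/-! ### The derivative along the frozen magnetic field -/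

section MagneticDerivative

variable {A₀ ρ₁ ρ₂ : ℝ} {f g : Fam A₀ ρ₁ ρ₂}

theorem ext_lineY_hasDeriv (hf : Reg 1 f) (s : Sol A₀ ρ₁ ρ₂) (z : cyl s.T) {x : ℝ}
    (hx : x ∈ Icc (-1 : ℝ) 1) :
    HasDerivWithinAt (fun x => ext (f s) (z.1.1, Function.update z.1.2 2 x))
      (ext (D 3 f s) (z.1.1, Function.update z.1.2 2 x)) (Icc (-1) 1) x := by
  have hm : MapsTo (fun x : ℝ => ((z.1.1, Function.update z.1.2 2 x) : SpaceTime)) (Icc (-1) 1)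
      (cyl s.T) := fun x hx => ⟨z.2.1, by simpa [slab] using hx⟩
  have h1 := (hf s).hasDerivWithinAt_comp
    ((hasDerivAt_const x z.1.1).prodMk (hasDerivAt_update z.1.2 2 x)).hasDerivWithinAt hm hx
  rw [D_three_eq]
  exact h1

/-- A function vanishing on the boundary is dominated by the distance to it. -/
theorem abs_le_sigma_of_boundary (hf : Reg 1 f) (hli : LI (D 3 f))
    (h0 : ∀ s (z : cyl s.T), (z.1.2 2 = -1 ∨ z.1.2 2 = 1) → f s z = 0) :
    ∃ (C : ℝ) (k : ℕ), 0 ≤ C ∧ ∀ s (z : cyl s.T), z.1.2 ∈ cell →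
      |f s z| ≤ C * Mg s z.1.1 ^ k * (1 - z.1.2 2 * z.1.2 2) := by
  obtain ⟨C, k, hC, hb⟩ := hli
  refine ⟨C, k, hC, fun s z hz => ?_⟩
  have hzs : z.1.2 2 ∈ Icc (-1 : ℝ) 1 := z.2.2
  have hM : 0 ≤ C * Mg s z.1.1 ^ k :=
    mul_nonneg hC (pow_nonneg (zero_le_one.trans (one_le_Mg s _)) _)
  have hcell : ∀ x ∈ Icc (-1 : ℝ) 1, Function.update z.1.2 2 x ∈ cell := by
    intro x hx
    constructor
    · intro i
      rcases eq_or_ne i 2 with rfl | hi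
      · simpa using hx.1
      · simpa [hi] using hz.1 i
    · intro i
      rcases eq_or_ne i 2 with rfl | hi
      · simpa using hx.2
      · simpa [hi] using hz.2 i
  have hmv : ∀ x ∈ Icc (-1 : ℝ) 1, (x = -1 ∨ x = 1) →
      |f s z| ≤ C * Mg s z.1.1 ^ k * |z.1.2 2 - x| := by
    intro x hx hx1
    have h1 := (convex_Icc (-1 : ℝ) 1).norm_image_sub_le_of_norm_hasDerivWithin_le
      (fun x hx => ext_lineY_hasDeriv hf s z hx) (C := C * Mg s z.1.1 ^ k)
      (fun x hx => by
        have hmem : (z.1.1, Function.update z.1.2 2 x) ∈ cyl s.T :=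
          mem_cyl_of_cell z.2.1 (hcell x hx)
        rw [ext_of_mem _ hmem]
        exact hb s ⟨_, hmem⟩ (hcell x hx)) hx hzs
    have hmem : (z.1.1, Function.update z.1.2 2 x) ∈ cyl s.T :=
      mem_cyl_of_cell z.2.1 (hcell x hx)
    rw [ext_of_mem _ hmem, h0 s ⟨_, hmem⟩ (by simpa using hx1), sub_zero,
      Function.update_eq_self] at h1
    have h2 : ext (f s) (z.1.1, z.1.2) = f s z := ext_of_mem _ z.2
    rw [h2] at h1
    exact h1
  have hl := hmv (-1) (by norm_num) (Or.inl rfl)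
  have hr := hmv 1 (by norm_num) (Or.inr rfl)
  rw [abs_of_nonneg (a := z.1.2 2 - -1) (by linarith [hzs.1])] at hl
  rw [abs_of_nonpos (a := z.1.2 2 - 1) (by linarith [hzs.2])] at hr
  -- In either half of the slab the distance to the nearer face is at most `(1 - y₃)(1 + y₃)`, the
  -- other factor being at least one.
  rcases le_total 0 (z.1.2 2) with h | h
  · refine hr.trans (mul_le_mul_of_nonneg_left ?_ hM)
    nlinarith [hzs.2]
  · refine hl.trans (mul_le_mul_of_nonneg_left ?_ hM)
    nlinarith [hzs.1]

/-- The normal component of the initial magnetic field makes the normal derivative tangential. -/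
theorem H_b0F_mul_D_three (hf : H 1 f) : H 0 (b0F A₀ ρ₁ ρ₂ 2 * D 3 f) := by
  have hr : Reg 0 (b0F A₀ ρ₁ ρ₂ 2) := (H_b0F 2).1.mono (by norm_num)
  have hr3 : Reg 0 (D 3 f) := hf.1.D 3
  refine H.of_l2 (hr.mul hr3) ?_
  -- The vanishing coefficient is dominated by σ, so the product is dominated by σ∂₃ and has weight
  -- one instead of two.
  obtain ⟨C, k, hC, hb⟩ := abs_le_sigma_of_boundary (A₀ := A₀) (ρ₁ := ρ₁) (ρ₂ := ρ₂)
    ((H_b0F 2).1.mono (by norm_num)) ((H_b0F 2).D 3 (k := 4) (by decide)).li b0F_boundary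
  have h1 : PolyBd fun (s : Sol A₀ ρ₁ ρ₂) t => (C * Mg s t ^ k) ^ 2 :=
    ⟨C ^ 2, k * 2, by positivity, fun s t _ => le_of_eq (by ring)⟩
  have h4 : H 0 (D 4 f) := hf.D 4 le_rfl
  refine (h1.mul h4.l2 fun s t ht => cint_mul_self_nonneg _ ht).mono fun s t ht => ?_
  refine cint_le_of_le (((hr.mul hr3) s).mul ((hr.mul hr3) s)) ((h4.1 s).mul (h4.1 s)) ht
    fun z hz hc => ?_
  have h2 := hb s z hc
  rw [hz] at h2
  have h3 : b0F A₀ ρ₁ ρ₂ 2 s z ^ 2 ≤ (C * Mg s t ^ k * (1 - z.1.2 2 * z.1.2 2)) ^ 2 := by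
    rw [← sq_abs]
    exact pow_le_pow_left₀ (abs_nonneg _) h2 2
  have h5 : D 4 f s z = (1 - z.1.2 2 * z.1.2 2) * D 3 f s z := by rw [D_four_eq]; rfl
  simp only [Pi.mul_apply]
  rw [h5]
  nlinarith [mul_le_mul_of_nonneg_right h3 (sq_nonneg (D 3 f s z))]

theorem Db_eq (f : Fam A₀ ρ₁ ρ₂) : Db f = b0F A₀ ρ₁ ρ₂ 0 * D 1 f + b0F A₀ ρ₁ ρ₂ 1 * D 2 f
    + b0F A₀ ρ₁ ρ₂ 2 * D 3 f := by
  rw [Db, Fin.sum_univ_three]; rfl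

/-- With b₀³ absorbing the normal derivative, the operator costs a single order down to order zero.
-/
theorem H.Db (hf : H 1 f) : H 0 (Db f) := by
  rw [Db_eq]
  exact (((H_b0F 0).smul (hf.D 1 (k := 0) le_rfl) (by norm_num) (by norm_num)).add
    ((H_b0F 1).smul (hf.D 2 (k := 0) le_rfl) (by norm_num) (by norm_num))).add
    (H_b0F_mul_D_three hf)

/-- The cruder count, with ∂₃ at full weight, used where two orders can be spared. -/
theorem H.Db_of_le {m c : ℕ} (hf : H m f) (hc : c + 2 ≤ m) (hm : m ≤ 8) : H c (FreeMHD.Db f) := by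
  rw [Db_eq]
  have h1 : H c (D 1 f) := hf.D 1 (show c + 1 ≤ m by omega)
  have h2 : H c (D 2 f) := hf.D 2 (show c + 1 ≤ m by omega)
  have h3 : H c (D 3 f) := hf.D 3 (show c + 2 ≤ m by omega)
  exact (((H_b0F 0).smul h1 (by norm_num) (by omega)).add
    ((H_b0F 1).smul h2 (by norm_num) (by omega))).add ((H_b0F 2).smul h3 (by norm_num) (by omega))

theorem Db_sub (hf : Reg 1 f) (hg : Reg 1 g) : Db (f - g) = Db f - Db g := by
  simp only [Db_eq, D_sub _ hf hg]; ring

theorem Db_mul (hf : Reg 1 f) (hg : Reg 1 g) : Db (f * g) = Db f * g + f * Db g := by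
  simp only [Db_eq, D_mul _ hf hg]; ring

theorem Db_sum {ι : Type*} {t : Finset ι} {f : ι → Fam A₀ ρ₁ ρ₂}
    (h : ∀ i ∈ t, Reg 1 (f i)) : Db (∑ i ∈ t, f i) = ∑ i ∈ t, Db (f i) := by
  simp only [Db_eq, D_sum _ h, Finset.mul_sum, ← Finset.sum_add_distrib]

protected theorem Reg.Db {n : ℕ} (hf : Reg (n + 1) f) (hn : n ≤ 8) : Reg n (Db f) :=
  Reg.sum fun l _ => ((H_b0F l).1.mono hn).mul (hf.D _)

theorem D_zero_Db (hf : Reg 2 f) : D 0 (Db f) = Db (D 0 f) := by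
  have r : ∀ l, Reg 1 (b0F A₀ ρ₁ ρ₂ l) := fun l => (H_b0F l).1.mono (by norm_num)
  rw [Db_eq, Db_eq, D_add 0 (((r 0).mul (hf.D 1)).add ((r 1).mul (hf.D 2))) ((r 2).mul (hf.D 3)),
    D_add 0 ((r 0).mul (hf.D 1)) ((r 1).mul (hf.D 2)), D_mul 0 (r 0) (hf.D 1),
    D_mul 0 (r 1) (hf.D 2), D_mul 0 (r 2) (hf.D 3)]
  simp only [D_zero_b0F, D_comm (show (0 : Fin 5) < 3 by decide) _ hf]
  ring

/-- The field is divergence free and tangential, so derivatives along it integrate to zero. -/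
theorem cint_Db (hf : Reg 1 f) (hp : Per f) (s : Sol A₀ ρ₁ ρ₂) {t : ℝ} (ht : t ∈ Icc 0 s.T) :
    cint (Db f s) t = 0 := by
  have r : ∀ l, Reg 1 (b0F A₀ ρ₁ ρ₂ l) := fun l => (H_b0F l).1.mono (by norm_num)
  have e : Db f = P (eX 0) (b0F A₀ ρ₁ ρ₂ 0 * f) + P (eX 1) (b0F A₀ ρ₁ ρ₂ 1 * f)
      + P (eX 2) (b0F A₀ ρ₁ ρ₂ 2 * f) := by
    have hd := div_b0F (A₀ := A₀) (ρ₁ := ρ₁) (ρ₂ := ρ₂)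
    rw [Fin.sum_univ_three] at hd
    simp only [D_dl_eq] at hd
    simp only [Db, Fin.sum_univ_three, D_dl_eq, P_mul _ (r _) hf]
    linear_combination (-f) * hd
  have h := fun l => ((r l).mul hf) s
  have hP : ∀ l, Sm 0 (P (eX l) (b0F A₀ ρ₁ ρ₂ l * f) s) := fun l => (h l).pd s.T_pos _
  rw [e]
  change cint (P (eX 0) (b0F A₀ ρ₁ ρ₂ 0 * f) s + P (eX 1) (b0F A₀ ρ₁ ρ₂ 1 * f) s
    + P (eX 2) (b0F A₀ ρ₁ ρ₂ 2 * f) s) t = 0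
  rw [cint_add ((hP 0).add (hP 1)) (hP 2) ht, cint_add (hP 0) (hP 1) ht]
  have hp' := fun l => ((Per_b0F (A₀ := A₀) (ρ₁ := ρ₁) (ρ₂ := ρ₂) l).mul hp) s
  have h0 := cint_pd_tangential s.T_pos (h 0) (hp' 0) ht (i := 0) (by decide)
  have h1 := cint_pd_tangential s.T_pos (h 1) (hp' 1) ht (i := 1) (by decide)
  have h2 := cint_pd_normal_eq_zero s.T_pos (h 2) ht fun z hz => by
    simp [b0F_boundary s z hz]
  change cint (P (eX 0) _ s) t = 0 at h0
  change cint (P (eX 1) _ s) t = 0 at h1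
  change cint (P (eX 2) _ s) t = 0 at h2
  rw [h0, h1, h2]
  norm_num

theorem L1_Db (hf : Reg 1 f) (hp : Per f) : L1 (Db f) :=
  ⟨hf.Db (by norm_num), (PolyBd.const 0).mono fun s t ht => by rw [cint_Db hf hp s ht, abs_zero]⟩

/-- Four normal derivatives commute with the magnetic derivative up to terms of order zero. -/
theorem H_dn_four_Db (hf : H 8 f) : H 0 (dn 4 (Db f) - Db (dn 4 f)) := by
  have hb := fun l => H_b0F (A₀ := A₀) (ρ₁ := ρ₁) (ρ₂ := ρ₂) l
  have hd : ∀ d, H 6 (D d f) := fun d => (hf.D' d (by fin_cases d <;> decide)).mono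
    (by fin_cases d <;> decide)
  have rb : ∀ l, Reg 4 (b0F A₀ ρ₁ ρ₂ l) := fun l => (hb l).1.mono (by norm_num)
  have rd : ∀ d, Reg 4 (D d f) := fun d => (hd d).1.mono (by norm_num)
  -- The terms with all four normal derivatives on the first derivatives of `f` cancel, including
  -- the one with five normal derivatives.
  have e : dn 4 (Db f) - Db (dn 4 f)
      = (dn 4 (b0F A₀ ρ₁ ρ₂ 0) * D 1 f + comm4 (b0F A₀ ρ₁ ρ₂ 0) (D 1 f))
      + (dn 4 (b0F A₀ ρ₁ ρ₂ 1) * D 2 f + comm4 (b0F A₀ ρ₁ ρ₂ 1) (D 2 f))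
      + (dn 4 (b0F A₀ ρ₁ ρ₂ 2) * D 3 f + comm4 (b0F A₀ ρ₁ ρ₂ 2) (D 3 f)) := by
    rw [Db_eq, Db_eq, dn_add 4 (((rb 0).mul (rd 1)).add ((rb 1).mul (rd 2))) ((rb 2).mul (rd 3)),
      dn_add 4 ((rb 0).mul (rd 1)) ((rb 1).mul (rd 2)), dn_four_mul (rb 0) (rd 1),
      dn_four_mul (rb 1) (rd 2), dn_four_mul (rb 2) (rd 3),
      D_dn (show (1 : Fin 5) < 3 by decide) 4 (hf.1.mono (by norm_num)),
      D_dn (show (2 : Fin 5) < 3 by decide) 4 (hf.1.mono (by norm_num)), D_three_dn, dn_D_three]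
    ring
  rw [e]
  have h : ∀ l d, H 0 (dn 4 (b0F A₀ ρ₁ ρ₂ l) * D d f + comm4 (b0F A₀ ρ₁ ρ₂ l) (D d f)) :=
    fun l d => (((hb l).dn (c := 0) 4 le_rfl).mul (hd d) le_rfl (by norm_num) (by norm_num)).add
      (H_comm4 (hb l) (hd d) (by norm_num) (by norm_num) (by norm_num))
  exact ((h 0 1).add (h 1 2)).add (h 2 3)

end MagneticDerivative

/-! ### Transversal and tangential parts of four normal derivatives -/

section NormalUnknowns

variable {A₀ ρ₁ ρ₂ : ℝ}

local notation "𝐉" => JF A₀ ρ₁ ρ₂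
local notation "𝐗" => X A₀ ρ₁ ρ₂
local notation "𝐖" => WF A₀ ρ₁ ρ₂
local notation "𝐞" => etaF A₀ ρ₁ ρ₂
local notation "𝐯" => velF A₀ ρ₁ ρ₂
local notation "𝐛" => magF A₀ ρ₁ ρ₂
local notation "𝐚" => cof (A₀ := A₀) (ρ₁ := ρ₁) (ρ₂ := ρ₂) 2

/-- The velocity is in the energy at the same order as the flow map, so time derivatives of η are
free. -/
theorem HT_etaF (i : Fin 3) : HT 8 (𝐞 i) :=
  ⟨(H_etaF i).1.mono (by norm_num), H_etaF i, by rw [D_zero_etaF]; exact H_velF i⟩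

theorem HT_X_tangential {l : Fin 3} (hl : l ≠ 2) (i : Fin 3) : HT 7 (𝐗 l i) :=
  (HT_etaF i).D (by fin_cases l <;> first | decide | exact absurd rfl hl)
    ((H_etaF i).1.mono (by norm_num)) le_rfl

theorem HT_X (l i : Fin 3) : HT 6 (𝐗 l i) := by
  by_cases hl : l = 2
  · subst hl
    exact (HT_etaF i).dn 1 ((H_etaF i).1.mono (by norm_num)) le_rfl
  · exact (HT_X_tangential hl i).mono (by norm_num)

theorem cof_two (i : Fin 3) : 𝐚 i = 𝐗 0 (i + 1) * 𝐗 1 (i + 2) - 𝐗 0 (i + 2) * 𝐗 1 (i + 1) := rfl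

/-- This cofactor row is ∂₁η × ∂₂η, without normal derivatives; it loses one order instead of two.
-/
theorem HT_cof_two (i : Fin 3) : HT 7 (𝐚 i) := by
  have h0 := fun i => HT_X_tangential (A₀ := A₀) (ρ₁ := ρ₁) (ρ₂ := ρ₂) (l := 0) (by decide) i
  have h1 := fun i => HT_X_tangential (A₀ := A₀) (ρ₁ := ρ₁) (ρ₂ := ρ₂) (l := 1) (by decide) i
  rw [cof_two]
  exact ((h0 _).mul (h1 _) le_rfl le_rfl (by norm_num)).sub
    ((h0 _).mul (h1 _) le_rfl le_rfl (by norm_num))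

theorem H_WF (k : Fin 3) : H 6 (𝐖 k) := by
  have h1 : H 6 (Db (𝐛 k)) := (H_magF k).Db_of_le le_rfl le_rfl
  have h2 : H 6 (D 0 (𝐯 k)) := (H_velF k).D 0 (by decide)
  exact H_JF_inv.smul (h1.sub (H_rho0.smul h2 (by norm_num) (by norm_num))) (by norm_num)
    (by norm_num)

theorem HT_dn_four_etaF (i : Fin 3) : HT 0 (dn 4 (𝐞 i)) :=
  (HT_etaF i).dn 4 ((H_etaF i).1.mono (by norm_num)) le_rfl

theorem D_zero_dn_four_etaF (i : Fin 3) : D 0 (dn 4 (𝐞 i)) = dn 4 (𝐯 i) := by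
  rw [D_dn (by decide) 4 ((H_etaF i).1.mono (by norm_num)), D_zero_etaF]

theorem Reg_dn_four_etaF (i : Fin 3) : Reg 4 (dn 4 (𝐞 i)) := (H_etaF i).1.dn 4 le_rfl

theorem Reg_dn_four_velF (i : Fin 3) : Reg 4 (dn 4 (𝐯 i)) := (H_velF i).1.dn 4 le_rfl

theorem H_dn_four_velF (i : Fin 3) : H 0 (dn 4 (𝐯 i)) := (H_velF i).dn 4 le_rfl

theorem Reg_dn_four_magF (i : Fin 3) : Reg 4 (dn 4 (𝐛 i)) := (H_magF i).1.dn 4 le_rfl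

theorem H_dn_four_magF (i : Fin 3) : H 0 (dn 4 (𝐛 i)) := (H_magF i).dn 4 le_rfl

variable (A₀ ρ₁ ρ₂) in
/-- The normal component of four normal derivatives of the flow map. -/
def UF : Fam A₀ ρ₁ ρ₂ := ∑ i, 𝐚 i * dn 4 (𝐞 i)

/-- Leibniz for three normal derivatives of `J = a·∂₃η`; the term in which all of them fall on ∂₃η
is isolated. -/
theorem UF_eq : UF A₀ ρ₁ ρ₂ = dn 3 𝐉 - ∑ i, (3 * (dn 1 (𝐚 i) * dn 3 (𝐞 i))
    + 3 * (dn 2 (𝐚 i) * dn 2 (𝐞 i)) + dn 3 (𝐚 i) * dn 1 (𝐞 i)) := by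
  have ra : ∀ i, Reg 3 (𝐚 i) := fun i => (Reg_cof 2 i).mono (by norm_num)
  have rx : ∀ i, Reg 3 (D 3 (𝐞 i)) := fun i => ((H_etaF i).1.mono (by norm_num)).D 3
  have h : dn 3 𝐉 = ∑ i, dn 3 (𝐚 i * D 3 (𝐞 i)) := by
    rw [JF_eq]
    exact dn_sum 3 fun i _ => (ra i).mul (rx i)
  rw [h, UF, ← Finset.sum_sub_distrib]
  refine Finset.sum_congr rfl fun i _ => ?_
  rw [dn_three_mul (ra i) (rx i)]
  simp only [dn_D_three]
  rw [D_three_eq_dn]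
  ring

theorem Reg_UF : Reg 4 (UF A₀ ρ₁ ρ₂) :=
  Reg.sum fun i _ => ((Reg_cof 2 i).mono (by norm_num)).mul (Reg_dn_four_etaF i)

/-- ∂₃³ costs six orders, and it acts on J and on the cofactor row, which retain order seven with
their time derivatives. So this component of ∂₃⁴η gains an order over the full vector. -/
theorem HT_UF : HT 1 (UF A₀ ρ₁ ρ₂) := by
  rw [UF_eq]
  have ra : ∀ i, Reg 7 (𝐚 i) := Reg_cof 2
  have re : ∀ i, Reg 8 (𝐞 i) := fun i => (H_etaF i).1
  have ha := HT_cof_two (A₀ := A₀) (ρ₁ := ρ₁) (ρ₂ := ρ₂)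
  have he := HT_etaF (A₀ := A₀) (ρ₁ := ρ₁) (ρ₂ := ρ₂)
  refine HT.sub ((H_JF.ht).dn 3 (H_JF.1.mono (by norm_num)) le_rfl)
    (HT.sum fun i _ => ((HT.ofNat_mul 3 ?_).add (HT.ofNat_mul 3 ?_)).add ?_)
  · exact ((ha i).dn (c := 5) 1 ((ra i).mono (by norm_num)) le_rfl).mul
      ((he i).dn (c := 2) 3 ((re i).mono (by norm_num)) le_rfl) (by norm_num) (by norm_num)
      (by norm_num)
  · exact ((ha i).dn (c := 3) 2 ((ra i).mono (by norm_num)) le_rfl).mul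
      ((he i).dn (c := 4) 2 ((re i).mono (by norm_num)) le_rfl) (by norm_num) (by norm_num)
      (by norm_num)
  · exact ((ha i).dn (c := 1) 3 ((ra i).mono (by norm_num)) le_rfl).mul
      ((he i).dn (c := 6) 1 ((re i).mono (by norm_num)) le_rfl) (by norm_num) (by norm_num)
      (by norm_num)

theorem Db_etaF (i : Fin 3) : Db (𝐞 i) = 𝐉 * 𝐛 i := by
  rw [JF_mul_magF]; rfl

/-- The derivative of η along b₀ is `J b`, of full order eight, and the commutator with ∂₃⁴ has
order zero. -/
theorem H_Db_dn_four_etaF (i : Fin 3) : H 0 (Db (dn 4 (𝐞 i))) := by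
  have h1 := H_dn_four_Db (H_etaF (A₀ := A₀) (ρ₁ := ρ₁) (ρ₂ := ρ₂) i)
  have h2 : H 0 (dn 4 (𝐉 * 𝐛 i)) :=
    (H_JF.smul (H_magF i) (by norm_num) le_rfl).dn 4 le_rfl
  rw [Db_etaF] at h1
  simpa using h2.sub h1

variable (A₀ ρ₁ ρ₂) in
/-- The normal component of four normal derivatives of the velocity. -/
def aV : Fam A₀ ρ₁ ρ₂ := ∑ i, 𝐚 i * dn 4 (𝐯 i)

theorem aV_eq : aV A₀ ρ₁ ρ₂ = D 0 (UF A₀ ρ₁ ρ₂) - ∑ i, D 0 (𝐚 i) * dn 4 (𝐞 i) := by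
  have ra : ∀ i, Reg 1 (𝐚 i) := fun i => (Reg_cof 2 i).mono (by norm_num)
  have re : ∀ i, Reg 1 (dn 4 (𝐞 i)) := fun i => (Reg_dn_four_etaF i).mono (by norm_num)
  rw [UF, D_sum 0 fun i _ => (ra i).mul (re i), ← Finset.sum_sub_distrib, aV]
  refine Finset.sum_congr rfl fun i _ => ?_
  rw [D_mul 0 (ra i) (re i), D_zero_dn_four_etaF]
  ring

theorem Reg_aV : Reg 4 (aV A₀ ρ₁ ρ₂) :=
  Reg.sum fun i _ => ((Reg_cof 2 i).mono (by norm_num)).mul (Reg_dn_four_velF i)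

theorem H_aV : H 0 (aV A₀ ρ₁ ρ₂) :=
  H.sum fun i _ => (HT_cof_two i).h.smul (H_dn_four_velF i) (by norm_num) (by norm_num)

theorem Reg_D_zero_cof_mul (i : Fin 3) : Reg 1 (D 0 (𝐚 i) * dn 4 (𝐞 i)) :=
  (((Reg_cof 2 i).mono (by norm_num)).D 0).mul ((Reg_dn_four_etaF i).mono (by norm_num))

theorem H_D_zero_aV : H 0 (D 0 (aV A₀ ρ₁ ρ₂)) := by
  have hr := Reg_D_zero_cof_mul (A₀ := A₀) (ρ₁ := ρ₁) (ρ₂ := ρ₂)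
  rw [aV_eq, D_sub 0 ((Reg_UF.mono (by norm_num)).D 0) (Reg.sum fun i _ => hr i),
    D_sum 0 fun i _ => hr i]
  refine (HT_UF.2.2.D 0 le_rfl).sub (H.sum fun i _ => ?_)
  rw [D_mul 0 (((Reg_cof 2 i).mono (by norm_num)).D 0) ((Reg_dn_four_etaF i).mono (by norm_num)),
    D_zero_dn_four_etaF]
  exact (((HT_cof_two i).2.2.D 0 (k := 6) (by decide)).smul (HT_dn_four_etaF i).h (by norm_num)
    (by norm_num)).add ((HT_cof_two i).2.2.smul (H_dn_four_velF i) (by norm_num) (by norm_num))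

theorem H_Db_aV : H 0 (Db (aV A₀ ρ₁ ρ₂)) := by
  have hr := Reg_D_zero_cof_mul (A₀ := A₀) (ρ₁ := ρ₁) (ρ₂ := ρ₂)
  rw [aV_eq, Db_sub ((Reg_UF.mono (by norm_num)).D 0) (Reg.sum fun i _ => hr i),
    Db_sum fun i _ => hr i]
  refine HT_UF.2.2.Db.sub (H.sum fun i _ => ?_)
  rw [Db_mul (((Reg_cof 2 i).mono (by norm_num)).D 0) ((Reg_dn_four_etaF i).mono (by norm_num))]
  exact (((HT_cof_two i).2.2.Db_of_le (c := 5) (by norm_num) (by norm_num)).smul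
    (HT_dn_four_etaF i).h (by norm_num) (by norm_num)).add
    ((HT_cof_two i).2.2.smul (H_Db_dn_four_etaF i) (by norm_num) (by norm_num))

variable (A₀ ρ₁ ρ₂) in
/-- The transversal part of four normal derivatives of the velocity. -/
def YF (k : Fin 3) : Fam A₀ ρ₁ ρ₂ := 𝐉⁻¹ * 𝐗 2 k * aV A₀ ρ₁ ρ₂

theorem H_JF_inv_mul_X (k : Fin 3) : H 6 (𝐉⁻¹ * 𝐗 2 k) :=
  H_JF_inv.smul (HT_X 2 k).h (by norm_num) (by norm_num)

theorem Reg_JF_inv_mul_X (k : Fin 3) : Reg 7 (𝐉⁻¹ * 𝐗 2 k) :=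
  (H_JF_inv.1.mono (by norm_num)).mul (Reg_X 2 k)

theorem Reg_YF (k : Fin 3) : Reg 4 (YF A₀ ρ₁ ρ₂ k) :=
  ((Reg_JF_inv_mul_X k).mono (by norm_num)).mul Reg_aV

theorem H_YF (k : Fin 3) : H 0 (YF A₀ ρ₁ ρ₂ k) :=
  (H_JF_inv_mul_X k).smul H_aV (by norm_num) (by norm_num)

theorem H_D_zero_YF (k : Fin 3) : H 0 (D 0 (YF A₀ ρ₁ ρ₂ k)) := by
  rw [YF, D_mul 0 ((Reg_JF_inv_mul_X k).mono (by norm_num)) (Reg_aV.mono (by norm_num))]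
  exact (((H_JF_inv_mul_X k).D 0 (k := 5) le_rfl).smul H_aV (by norm_num) (by norm_num)).add
    ((H_JF_inv_mul_X k).smul H_D_zero_aV (by norm_num) (by norm_num))

theorem HT_YF (k : Fin 3) : HT 0 (YF A₀ ρ₁ ρ₂ k) :=
  ⟨(Reg_YF k).mono (by norm_num), H_YF k, H_D_zero_YF k⟩

theorem H_Db_YF (k : Fin 3) : H 0 (Db (YF A₀ ρ₁ ρ₂ k)) := by
  rw [YF, Db_mul ((Reg_JF_inv_mul_X k).mono (by norm_num)) (Reg_aV.mono (by norm_num))]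
  exact (((H_JF_inv_mul_X k).Db_of_le (c := 4) (by norm_num) (by norm_num)).smul H_aV
    (by norm_num) (by norm_num)).add
    ((H_JF_inv_mul_X k).smul H_Db_aV (by norm_num) (by norm_num))

variable (A₀ ρ₁ ρ₂) in
/-- The tangential part of four normal derivatives of the velocity. -/
def ZF (k : Fin 3) : Fam A₀ ρ₁ ρ₂ := dn 4 (𝐯 k) - YF A₀ ρ₁ ρ₂ k

theorem Reg_ZF (k : Fin 3) : Reg 4 (ZF A₀ ρ₁ ρ₂ k) := (Reg_dn_four_velF k).sub (Reg_YF k)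

theorem H_ZF (k : Fin 3) : H 0 (ZF A₀ ρ₁ ρ₂ k) := (H_dn_four_velF k).sub (H_YF k)

theorem Per_ZF (k : Fin 3) : Per (ZF A₀ ρ₁ ρ₂ k) := by
  have hV : ∀ k, Per (dn 4 (𝐯 k)) := fun k =>
    (Per_velF k).dn 4 ((H_velF k).1.mono (by norm_num))
  exact (hV k).sub ((Per_JF.inv.mul (Per_X 2 k)).mul
    (Per.sum fun i _ => (Per_cof 2 i).mul (hV i)))

theorem sum_AF_mul_X (i k : Fin 3) : ∑ l, AF l i * 𝐗 l k = if i = k then 1 else 0 := by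
  funext s z
  have hdet : (gradη s.T s.η z).det ≠ 0 := (s.isSol.jac_pos z z.2).ne'
  have h := Matrix.mul_nonsing_inv (gradη s.T s.η z) (isUnit_iff_ne_zero.2 hdet)
  have h2 := congrFun (congrFun h k) i
  rw [Matrix.mul_apply, Matrix.one_apply] at h2
  simp only [Finset.sum_apply, Pi.mul_apply, X_apply]
  have e : (if i = k then (1 : Fam A₀ ρ₁ ρ₂) else 0) s z = if k = i then (1 : ℝ) else 0 := by
    rcases eq_or_ne i k with h | h
    · simp [h]
    · simp [h, h.symm]
  rw [e, ← h2]
  exact Finset.sum_congr rfl fun l _ => mul_comm _ _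

variable (A₀ ρ₁ ρ₂) in
/-- The tangential components of four normal derivatives of the velocity. -/
def zF (l : Fin 3) : Fam A₀ ρ₁ ρ₂ := ∑ i, AF l i * ZF A₀ ρ₁ ρ₂ i

theorem H_AF (l i : Fin 3) : H 6 (AF (A₀ := A₀) (ρ₁ := ρ₁) (ρ₂ := ρ₂) l i) := by
  rw [AF_eq]
  refine H_JF_inv.smul ?_ (by norm_num) (by norm_num)
  exact ((HT_X _ _).h.mul (HT_X _ _).h le_rfl le_rfl (by norm_num)).sub
    ((HT_X _ _).h.mul (HT_X _ _).h le_rfl le_rfl (by norm_num))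

theorem H_zF (l : Fin 3) : H 0 (zF A₀ ρ₁ ρ₂ l) :=
  H.sum fun i _ => (H_AF l i).smul (H_ZF i) (by norm_num) (by norm_num)

/-- Because `a·∂₃η = J`, the transversal part carries the whole of `a·∂₃⁴v`. -/
theorem sum_cof_mul_ZF : ∑ i, 𝐚 i * ZF A₀ ρ₁ ρ₂ i = 0 := by
  have h := JF_eq (A₀ := A₀) (ρ₁ := ρ₁) (ρ₂ := ρ₂)
  have h1 := JF_mul_inv (A₀ := A₀) (ρ₁ := ρ₁) (ρ₂ := ρ₂)
  have h2 : ∑ i, 𝐚 i * ZF A₀ ρ₁ ρ₂ i = aV A₀ ρ₁ ρ₂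
      - 𝐉⁻¹ * aV A₀ ρ₁ ρ₂ * ∑ i, 𝐚 i * 𝐗 2 i := by
    conv_rhs => rw [aV]
    rw [← aV, Finset.mul_sum, aV, ← Finset.sum_sub_distrib]
    refine Finset.sum_congr rfl fun i _ => ?_
    rw [ZF, YF, aV]
    ring
  rw [h2, ← h]
  linear_combination (-aV A₀ ρ₁ ρ₂) * h1

/-- Expanding in the frame ∂₁η, ∂₂η, ∂₃η, the third coordinate is proportional to the product with
the cofactor row, which vanishes. -/
theorem ZF_eq (k : Fin 3) : ZF A₀ ρ₁ ρ₂ k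
    = zF A₀ ρ₁ ρ₂ 0 * 𝐗 0 k + zF A₀ ρ₁ ρ₂ 1 * 𝐗 1 k := by
  have h : ∑ l, zF A₀ ρ₁ ρ₂ l * 𝐗 l k = ZF A₀ ρ₁ ρ₂ k := by
    simp only [zF, Finset.sum_mul]
    rw [Finset.sum_comm]
    have : ∀ i, ∑ l, AF l i * ZF A₀ ρ₁ ρ₂ i * 𝐗 l k
        = ZF A₀ ρ₁ ρ₂ i * ∑ l, AF l i * 𝐗 l k := fun i => by
      rw [Finset.mul_sum]
      exact Finset.sum_congr rfl fun l _ => by ring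
    simp only [this, sum_AF_mul_X, mul_ite, mul_one, mul_zero, Finset.sum_ite_eq',
      Finset.mem_univ, if_true]
  have h2 : zF A₀ ρ₁ ρ₂ 2 = 0 := by
    have : zF A₀ ρ₁ ρ₂ 2 = 𝐉⁻¹ * ∑ i, 𝐚 i * ZF A₀ ρ₁ ρ₂ i := by
      rw [zF, Finset.mul_sum]
      exact Finset.sum_congr rfl fun i _ => by rw [AF_eq]; ring
    rw [this, sum_cof_mul_ZF, mul_zero]
  rw [← h, Fin.sum_univ_three, h2]
  ring

end NormalUnknowns

/-! ### Square-integrable tangential derivatives -/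

section TangentialClass

variable {A₀ ρ₁ ρ₂ : ℝ} {f g : Fam A₀ ρ₁ ρ₂}

/-- Square-integrable functions with square-integrable tangential derivatives. -/
def T1 (f : Fam A₀ ρ₁ ρ₂) : Prop := Reg 1 f ∧ H 0 f ∧ ∀ d < 3, H 0 (D d f)

theorem H.t1 (h : H 1 f) : T1 f :=
  ⟨h.1, h.mono (by norm_num), fun d hd => h.D d (by
    fin_cases d <;> first | decide | exact absurd hd (by decide))⟩

protected theorem T1.add (hf : T1 f) (hg : T1 g) : T1 (f + g) :=
  ⟨hf.1.add hg.1, hf.2.1.add hg.2.1, fun d hd => by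
    rw [D_add d hf.1 hg.1]; exact (hf.2.2 d hd).add (hg.2.2 d hd)⟩

protected theorem T1.sub (hf : T1 f) (hg : T1 g) : T1 (f - g) :=
  ⟨hf.1.sub hg.1, hf.2.1.sub hg.2.1, fun d hd => by
    rw [D_sub d hf.1 hg.1]; exact (hf.2.2 d hd).sub (hg.2.2 d hd)⟩

protected theorem T1.mul {a : ℕ} (hf : H a f) (ha : 6 ≤ a) (hg : T1 g) : T1 (f * g) :=
  ⟨(hf.1.mono (by omega)).mul hg.1, hf.smul hg.2.1 (by omega) (by omega), fun d hd => by
    have hw : wt d = 1 := by fin_cases d <;> first | rfl | exact absurd hd (by decide)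
    rw [D_mul d (hf.1.mono (by omega)) hg.1]
    exact ((hf.D d (k := 4) (by omega)).smul hg.2.1 le_rfl (by norm_num)).add
      (hf.smul (hg.2.2 d hd) (by omega) (by omega))⟩

protected theorem T1.sum {ι : Type*} {t : Finset ι} {f : ι → Fam A₀ ρ₁ ρ₂}
    (h : ∀ i ∈ t, T1 (f i)) : T1 (∑ i ∈ t, f i) := by
  classical
  induction t using Finset.induction_on with
  | empty => simpa using (H.zero 1).t1
  | insert a t ha ih =>
    rw [Finset.sum_insert ha]
    exact (h a (Finset.mem_insert_self _ _)).add
      (ih fun i hi => h i (Finset.mem_insert_of_mem hi))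

/-- A tangential derivative commutes with ∂₃, so the degenerate coefficient can absorb ∂₃ afterwards
as well. -/
theorem T1_b0F_mul_D_three (hf : H 2 f) : T1 (b0F A₀ ρ₁ ρ₂ 2 * D 3 f) := by
  have rb : Reg 1 (b0F A₀ ρ₁ ρ₂ 2) := (H_b0F 2).1.mono (by norm_num)
  refine ⟨rb.mul (hf.1.D 3), H_b0F_mul_D_three (hf.mono (by norm_num)), fun d hd => ?_⟩
  have hw : wt d = 1 := by fin_cases d <;> first | rfl | exact absurd hd (by decide)
  rw [D_mul d rb (hf.1.D 3), D_comm hd 3 hf.1]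
  exact (((H_b0F 2).D d (k := 4) (by omega)).smul (hf.D 3 (k := 0) le_rfl) le_rfl
    (by norm_num)).add (H_b0F_mul_D_three (hf.D d (by omega)))

end TangentialClass

/-! ### The good unknown for the pressure and the differentiated equations -/

section Pressure

variable {A₀ ρ₁ ρ₂ : ℝ}

local notation "𝐉" => JF A₀ ρ₁ ρ₂
local notation "𝐗" => X A₀ ρ₁ ρ₂
local notation "𝐖" => WF A₀ ρ₁ ρ₂
local notation "𝐞" => etaF A₀ ρ₁ ρ₂
local notation "𝐯" => velF A₀ ρ₁ ρ₂
local notation "𝐛" => magF A₀ ρ₁ ρ₂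

/-- Three normal derivatives and one derivative of weight one leave order one. The single exception
is b₀³∂₃⁴b, where degeneracy at Γ gives tangential regularity only. -/
theorem T1_dn_three_WF (k : Fin 3) : T1 (dn 3 (𝐖 k)) := by
  have hc : ∀ l, H 8 (𝐉⁻¹ * b0F A₀ ρ₁ ρ₂ l) := fun l =>
    H_JF_inv.smul (H_b0F l) (by norm_num) le_rfl
  have hr : H 7 (𝐉⁻¹ * (rho0 A₀ ρ₁ ρ₂ * D 0 (𝐯 k))) :=
    H_JF_inv.smul (H_rho0.smul ((H_velF k).D 0 (k := 7) le_rfl) (by norm_num) (by norm_num))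
      (by norm_num) (by norm_num)
  have hd : ∀ d, H 6 (D d (𝐛 k)) := fun d =>
    ((H_magF k).D' d (by fin_cases d <;> decide)).mono (by fin_cases d <;> decide)
  have e : 𝐖 k = 𝐉⁻¹ * b0F A₀ ρ₁ ρ₂ 0 * D 1 (𝐛 k) + 𝐉⁻¹ * b0F A₀ ρ₁ ρ₂ 1 * D 2 (𝐛 k)
      + 𝐉⁻¹ * b0F A₀ ρ₁ ρ₂ 2 * D 3 (𝐛 k) - 𝐉⁻¹ * (rho0 A₀ ρ₁ ρ₂ * D 0 (𝐯 k)) := by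
    rw [WF, Db_eq]
    ring
  have rc : ∀ l, Reg 3 (𝐉⁻¹ * b0F A₀ ρ₁ ρ₂ l) := fun l => (hc l).1.mono (by norm_num)
  have rd : ∀ d, Reg 3 (D d (𝐛 k)) := fun d => (hd d).1.mono (by norm_num)
  have h1 : H 7 (D 1 (𝐛 k)) := (H_magF k).D 1 le_rfl
  have h2 : H 7 (D 2 (𝐛 k)) := (H_magF k).D 2 le_rfl
  rw [e, dn_sub 3 ((((rc 0).mul (rd 1)).add ((rc 1).mul (rd 2))).add ((rc 2).mul (rd 3)))
      (hr.1.mono (by norm_num)),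
    dn_add 3 (((rc 0).mul (rd 1)).add ((rc 1).mul (rd 2))) ((rc 2).mul (rd 3)),
    dn_add 3 ((rc 0).mul (rd 1)) ((rc 1).mul (rd 2)), dn_three_mul (rc 2) (rd 3)]
  refine T1.sub ((T1.add ?_ ?_).add ?_) (hr.dn (c := 1) 3 (by norm_num)).t1
  · exact (((hc 0).smul h1 (by norm_num) (by norm_num)).dn (c := 1) 3 (by norm_num)).t1
  · exact (((hc 1).smul h2 (by norm_num) (by norm_num)).dn (c := 1) 3 (by norm_num)).t1
  · have hb := H_magF (A₀ := A₀) (ρ₁ := ρ₁) (ρ₂ := ρ₂) k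
    refine T1.add (H.t1 (((?_ : H 1 _).add (H.ofNat_mul 3 ?_)).add (H.ofNat_mul 3 ?_))) ?_
    · exact ((hc 2).dn (c := 2) 3 (by norm_num)).mul (hd 3) (by norm_num) (by norm_num)
        (by norm_num)
    · exact ((hc 2).dn (c := 4) 2 (by norm_num)).mul (hb.dn (c := 4) 2 (by norm_num))
        (by norm_num) (by norm_num) (by norm_num)
    · exact ((hc 2).dn (c := 6) 1 (by norm_num)).mul (hb.dn (c := 2) 3 (by norm_num))
        (by norm_num) (by norm_num) (by norm_num)
    · rw [mul_assoc]
      exact T1.mul H_JF_inv (by norm_num) (T1_b0F_mul_D_three (hb.dn (c := 2) 3 (by norm_num)))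

variable (A₀ ρ₁ ρ₂) in
/-- The good unknown of the total pressure. -/
def QQ : Fam A₀ ρ₁ ρ₂ := dn 4 (QF A₀ ρ₁ ρ₂) - ∑ k, dn 4 (𝐞 k) * 𝐖 k

/-- Since `∂₃Q = ∂₃η·W`, subtracting `∂₃⁴η·W` removes the term with four derivatives on η; at most
three normal derivatives of either factor remain. -/
theorem QQ_eq : QQ A₀ ρ₁ ρ₂ = ∑ k, (3 * (dn 3 (𝐞 k) * dn 1 (𝐖 k)) + 3 * (dn 2 (𝐞 k) * dn 2 (𝐖 k))
    + 𝐗 2 k * dn 3 (𝐖 k)) := by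
  have h := sum_X_mul_WF (A₀ := A₀) (ρ₁ := ρ₁) (ρ₂ := ρ₂) 2
  have rx : ∀ k, Reg 3 (𝐗 2 k) := fun k => (Reg_X 2 k).mono (by norm_num)
  have rw' : ∀ k, Reg 3 (𝐖 k) := fun k => (H_WF k).1.mono (by norm_num)
  have h4 : dn 4 (QF A₀ ρ₁ ρ₂) = ∑ k, dn 3 (𝐗 2 k * 𝐖 k) := by
    rw [← dn_sum 3 fun k _ => (rx k).mul (rw' k), h]
    rfl
  rw [QQ, h4, ← Finset.sum_sub_distrib]
  refine Finset.sum_congr rfl fun k _ => ?_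
  rw [dn_three_mul (rx k) (rw' k)]
  have e : ∀ j, dn j (𝐗 2 k) = dn (j + 1) (𝐞 k) := fun j => rfl
  simp only [e]
  ring

theorem T1_QQ : T1 (QQ A₀ ρ₁ ρ₂) := by
  rw [QQ_eq]
  refine T1.sum fun k _ => T1.add (H.t1 ((H.ofNat_mul 3 ?_).add (H.ofNat_mul 3 ?_))) ?_
  · exact ((H_etaF k).dn (c := 2) 3 le_rfl).mul ((H_WF k).dn (c := 4) 1 le_rfl) (by norm_num)
      (by norm_num) (by norm_num)
  · exact ((H_etaF k).dn (c := 4) 2 le_rfl).mul ((H_WF k).dn (c := 2) 2 le_rfl) (by norm_num)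
      (by norm_num) (by norm_num)
  · exact T1.mul (HT_X 2 k).h le_rfl (T1_dn_three_WF k)

theorem dl_lt {l : Fin 3} (hl : l ≠ 2) : dl l < 3 := by
  fin_cases l <;> first | decide | exact absurd rfl hl

/-- The tangential components of the pressure gradient gain a derivative. -/
theorem H_sum_X_mul_dn_four_WF {l : Fin 3} (hl : l ≠ 2) : H 0 (∑ k, 𝐗 l k * dn 4 (𝐖 k)) := by
  have rx : ∀ k, Reg 4 (𝐗 l k) := fun k => (Reg_X l k).mono (by norm_num)
  have rW : ∀ k, Reg 4 (𝐖 k) := fun k => (H_WF k).1.mono (by norm_num)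
  have rN : ∀ k, Reg 1 (dn 4 (𝐞 k)) := fun k => (Reg_dn_four_etaF k).mono (by norm_num)
  have rW1 : ∀ k, Reg 1 (𝐖 k) := fun k => (rW k).mono (by norm_num)
  have h1 : D (dl l) (dn 4 (QF A₀ ρ₁ ρ₂)) = ∑ k, (D (dl l) (dn 4 (𝐞 k)) * 𝐖 k
      + 𝐗 l k * dn 4 (𝐖 k) + comm4 (𝐗 l k) (𝐖 k)) := by
    rw [D_dn (dl_lt hl) 4 (H_QF.1.mono (by norm_num)), ← sum_X_mul_WF,
      dn_sum 4 fun k _ => (rx k).mul (rW k)]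
    refine Finset.sum_congr rfl fun k _ => ?_
    rw [dn_four_mul (rx k) (rW k), D_dn (dl_lt hl) 4 ((H_etaF k).1.mono (by norm_num))]
    rfl
  have h2 : D (dl l) (QQ A₀ ρ₁ ρ₂) = D (dl l) (dn 4 (QF A₀ ρ₁ ρ₂))
      - ∑ k, (D (dl l) (dn 4 (𝐞 k)) * 𝐖 k + dn 4 (𝐞 k) * D (dl l) (𝐖 k)) := by
    rw [QQ, D_sub _ ((H_QF.1.dn 4 le_rfl).mono (by norm_num))
      (Reg.sum fun k _ => (rN k).mul (rW1 k)), D_sum _ fun k _ => (rN k).mul (rW1 k)]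
    congr 1
    exact Finset.sum_congr rfl fun k _ => D_mul _ (rN k) (rW1 k)
  -- Differentiating ∂₃⁴Q tangentially and expanding `∂₃⁴(∂_lη·W)` both produce `∂_l∂₃⁴η·W`, the one
  -- uncontrolled term. It cancels, which is the purpose of the good unknown.
  have e : ∑ k, 𝐗 l k * dn 4 (𝐖 k) = D (dl l) (QQ A₀ ρ₁ ρ₂)
      + ∑ k, (dn 4 (𝐞 k) * D (dl l) (𝐖 k) - comm4 (𝐗 l k) (𝐖 k)) := by
    rw [h2, h1, ← Finset.sum_sub_distrib, ← Finset.sum_add_distrib]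
    exact Finset.sum_congr rfl fun k _ => by ring
  rw [e]
  have hw : wt (dl l) ≤ 2 := by fin_cases l <;> decide
  refine (T1_QQ.2.2 _ (dl_lt hl)).add (H.sum fun k _ => H.sub ?_ ?_)
  · exact (HT_dn_four_etaF k).h.mul ((H_WF k).D (dl l) (k := 4) (by omega)) le_rfl (by norm_num)
      (by norm_num)
  · exact H_comm4 (HT_X_tangential hl k).h (H_WF k) (by norm_num) (by norm_num) (by norm_num)

/-- Four normal derivatives of `J W = (b₀·∂)b - ρ₀∂_t v`; only the three terms with a derivative of
a top-order unknown survive modulo order zero. -/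
theorem H_momentum (k : Fin 3) : H 0 (rho0 A₀ ρ₁ ρ₂ * D 0 (dn 4 (𝐯 k))
    - (Db (dn 4 (𝐛 k)) - 𝐉 * dn 4 (𝐖 k))) := by
  have h := congrArg (dn 4) (JF_mul_WF (A₀ := A₀) (ρ₁ := ρ₁) (ρ₂ := ρ₂) k)
  have hv : H 7 (D 0 (𝐯 k)) := (H_velF k).D 0 le_rfl
  have hb : H 6 (Db (𝐛 k)) := (H_magF k).Db_of_le le_rfl le_rfl
  have rρ : Reg 4 (rho0 A₀ ρ₁ ρ₂) := H_rho0.1.mono (by norm_num)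
  have rv : Reg 4 (D 0 (𝐯 k)) := hv.1.mono (by norm_num)
  rw [dn_four_mul (H_JF.1.mono (by norm_num)) ((H_WF k).1.mono (by norm_num)),
    dn_sub 4 (hb.1.mono (by norm_num)) (rρ.mul rv), dn_four_mul rρ rv,
    ← D_dn (by decide) 4 ((H_velF k).1.mono (by norm_num))] at h
  have e : rho0 A₀ ρ₁ ρ₂ * D 0 (dn 4 (𝐯 k)) - (Db (dn 4 (𝐛 k)) - 𝐉 * dn 4 (𝐖 k))
      = (dn 4 (Db (𝐛 k)) - Db (dn 4 (𝐛 k))) - dn 4 (rho0 A₀ ρ₁ ρ₂) * D 0 (𝐯 k)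
        - comm4 (rho0 A₀ ρ₁ ρ₂) (D 0 (𝐯 k)) - dn 4 𝐉 * 𝐖 k - comm4 𝐉 (𝐖 k) := by
    linear_combination h
  rw [e]
  refine ((((H_dn_four_Db (H_magF k)).sub ?_).sub ?_).sub ?_).sub ?_
  · exact (H_rho0.dn (c := 0) 4 le_rfl).mul hv le_rfl (by norm_num) (by norm_num)
  · exact H_comm4 H_rho0 hv (by norm_num) (by norm_num) (by norm_num)
  · exact (H_JF.dn (c := 0) 4 le_rfl).mul (H_WF k) le_rfl (by norm_num) (by norm_num)
  · exact H_comm4 H_JF (H_WF k) (by norm_num) (by norm_num) (by norm_num)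

/-- The time derivative of `J b = (b₀·∂)η`, differentiated four times. The term with ∂₃⁴∂_t J is not
of order zero and is kept for later cancellation. -/
theorem H_induction (i : Fin 3) : H 0 (Db (dn 4 (𝐯 i)) - 𝐉 * D 0 (dn 4 (𝐛 i))
    - 𝐛 i * dn 4 (D 0 𝐉)) := by
  have hb := H_magF (A₀ := A₀) (ρ₁ := ρ₁) (ρ₂ := ρ₂) i
  have hb' : H 7 (D 0 (𝐛 i)) := hb.D 0 le_rfl
  have hJ' : H 7 (D 0 𝐉) := H_JF.D 0 le_rfl
  have r : ∀ {m : ℕ} {f : Fam A₀ ρ₁ ρ₂}, H m f → 4 ≤ m → Reg 4 f := fun h hm => h.1.mono hm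
  have h0 : Db (𝐯 i) = D 0 𝐉 * 𝐛 i + 𝐉 * D 0 (𝐛 i) := by
    rw [← D_mul 0 (H_JF.1.mono (by norm_num)) (hb.1.mono (by norm_num)), ← Db_etaF,
      D_zero_Db ((H_etaF i).1.mono (by norm_num)), D_zero_etaF]
  have h := congrArg (dn 4) h0
  rw [dn_add 4 ((r hJ' (by norm_num)).mul (r hb (by norm_num)))
      ((r H_JF (by norm_num)).mul (r hb' (by norm_num))),
    dn_four_mul (r hJ' (by norm_num)) (r hb (by norm_num)),
    dn_four_mul (r H_JF (by norm_num)) (r hb' (by norm_num)),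
    ← D_dn (by decide) 4 (hb.1.mono (by norm_num))] at h
  have e : Db (dn 4 (𝐯 i)) - 𝐉 * D 0 (dn 4 (𝐛 i)) - 𝐛 i * dn 4 (D 0 𝐉)
      = D 0 𝐉 * dn 4 (𝐛 i) + comm4 (D 0 𝐉) (𝐛 i) + dn 4 𝐉 * D 0 (𝐛 i) + comm4 𝐉 (D 0 (𝐛 i))
        - (dn 4 (Db (𝐯 i)) - Db (dn 4 (𝐯 i))) := by
    linear_combination h
  rw [e]
  refine ((((?_ : H 0 _).add ?_).add ?_).add ?_).sub (H_dn_four_Db (H_velF i))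
  · exact hJ'.smul (H_dn_four_magF i) (by norm_num) (by norm_num)
  · exact H_comm4 hJ' hb (by norm_num) (by norm_num) (by norm_num)
  · exact (H_JF.dn (c := 0) 4 le_rfl).mul hb' le_rfl (by norm_num) (by norm_num)
  · exact H_comm4 H_JF hb' (by norm_num) (by norm_num) (by norm_num)

variable (A₀ ρ₁ ρ₂) in
/-- The magnetic part of four normal derivatives of the magnetic pressure. -/
def beta : Fam A₀ ρ₁ ρ₂ := ∑ i, 𝐛 i * dn 4 (𝐛 i)

theorem Reg_beta : Reg 4 (beta A₀ ρ₁ ρ₂) :=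
  Reg.sum fun i _ => ((H_magF i).1.mono (by norm_num)).mul (Reg_dn_four_magF i)

theorem H_beta : H 0 (beta A₀ ρ₁ ρ₂) :=
  H.sum fun i _ => (H_magF i).smul (H_dn_four_magF i) (by norm_num) (by norm_num)

theorem Reg_half (n : ℕ) : Reg n (half : Fam A₀ ρ₁ ρ₂) := Reg.const n _

theorem D_half (d : Fin 5) : D d (half : Fam A₀ ρ₁ ρ₂) = 0 := D_const d _

theorem D_half_mul (d : Fin 5) {f : Fam A₀ ρ₁ ρ₂} (hf : Reg 1 f) :
    D d (half * f) = half * D d f := by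
  rw [D_mul d (Reg_half 1) hf, D_half, zero_mul, zero_add]

theorem dn_half_mul (j : ℕ) {f : Fam A₀ ρ₁ ρ₂} (hf : Reg j f) :
    dn j (half * f) = half * dn j f := by
  induction j with
  | zero => rfl
  | succ j ih =>
    rw [← D_three_dn, ih (hf.mono (by omega)), D_half_mul 3 (hf.dn j (by omega)), D_three_dn]

theorem dn_four_qF_add_beta : dn 4 (qF A₀ ρ₁ ρ₂) + beta A₀ ρ₁ ρ₂
    = QQ A₀ ρ₁ ρ₂ + ∑ k, dn 4 (𝐞 k) * 𝐖 k - half * ∑ i, comm4 (𝐛 i) (𝐛 i) := by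
  have rb : ∀ i, Reg 4 (𝐛 i) := fun i => (H_magF i).1.mono (by norm_num)
  have hs : Reg 4 (∑ i, 𝐛 i * 𝐛 i) := Reg.sum fun i _ => (rb i).mul (rb i)
  have h := congrArg (dn 4) (QF_eq (A₀ := A₀) (ρ₁ := ρ₁) (ρ₂ := ρ₂))
  rw [dn_add 4 (H_qF.1.mono (by norm_num)) ((Reg_half 4).mul hs), dn_half_mul 4 hs,
    dn_sum 4 fun i _ => (rb i).mul (rb i)] at h
  have e : ∑ i, dn 4 (𝐛 i * 𝐛 i) = 2 * beta A₀ ρ₁ ρ₂ + ∑ i, comm4 (𝐛 i) (𝐛 i) := by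
    rw [beta, Finset.mul_sum, ← Finset.sum_add_distrib]
    refine Finset.sum_congr rfl fun i _ => ?_
    rw [dn_four_mul (rb i) (rb i)]
    ring
  have h2 := two_mul_half (A₀ := A₀) (ρ₁ := ρ₁) (ρ₂ := ρ₂)
  rw [e] at h
  rw [QQ]
  linear_combination (-1 : Fam A₀ ρ₁ ρ₂) * h - beta A₀ ρ₁ ρ₂ * h2

/-- The sum is ∂₃⁴Q up to lower terms, and the total pressure has the extra tangential derivative,
in particular in time. Neither summand is known to have it separately. -/
theorem HT_dn_four_qF_add_beta : HT 0 (dn 4 (qF A₀ ρ₁ ρ₂) + beta A₀ ρ₁ ρ₂) := by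
  rw [dn_four_qF_add_beta]
  refine HT.sub (HT.add ⟨T1_QQ.1, T1_QQ.2.1, T1_QQ.2.2 0 (by decide)⟩ (HT.sum fun k _ => ?_)) ?_
  · exact (HT_dn_four_etaF k).mul ((H_WF k).ht (m := 5)) le_rfl (by norm_num) (by norm_num)
  · have h : H 1 (half * ∑ i, comm4 (𝐛 i) (𝐛 i)) := H.const_smul _ (H.sum fun i _ =>
      H_comm4 (H_magF i) (H_magF i) (by norm_num) (by norm_num) (by norm_num))
    exact h.ht

variable (A₀ ρ₁ ρ₂) in
/-- The logarithmic sensitivity of the volume to the pressure. -/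
def kappa : Fam A₀ ρ₁ ρ₂ := (Rj A₀ ρ₁ ρ₂ 0)⁻¹ * (Rj A₀ ρ₁ ρ₂ 1 * 𝐉)

theorem H_Rj_one_mul_JF : H 7 (Rj A₀ ρ₁ ρ₂ 1 * 𝐉) :=
  (H_Rj 7 1 le_rfl).mul H_JF le_rfl (by norm_num) (by norm_num)

theorem H_kappa : H 7 (kappa A₀ ρ₁ ρ₂) :=
  H_Rj_inv.smul H_Rj_one_mul_JF (by norm_num) (by norm_num)

/-- The general count gives `R'(q)` order seven only, one short for four normal derivatives.
Carrying out the first ∂₃ explicitly leaves a product of order six. -/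
theorem H_dn_four_Rj_one : H 0 (dn 4 (Rj A₀ ρ₁ ρ₂ 1)) := by
  have h : H 6 (Rj A₀ ρ₁ ρ₂ 2 * D 3 (qF A₀ ρ₁ ρ₂)) :=
    (H_Rj 6 2 le_rfl).mul (H_qF.D 3 (k := 6) le_rfl) le_rfl le_rfl (by norm_num)
  rw [← dn_D_three, D_Rj]
  exact h.dn 3 le_rfl

/-- Time-differentiated mass conservation relates ∂_t J to ∂_t q; after four normal derivatives,
∂_t∂₃⁴q is replaced by -∂_tβ through the total pressure. -/
theorem H_dn_four_D_zero_JF : H 0 (dn 4 (D 0 𝐉) - kappa A₀ ρ₁ ρ₂ * D 0 (beta A₀ ρ₁ ρ₂)) := by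
  have hR0 := H_Rj (A₀ := A₀) (ρ₁ := ρ₁) (ρ₂ := ρ₂) 8 0 le_rfl
  have hR1 := H_Rj (A₀ := A₀) (ρ₁ := ρ₁) (ρ₂ := ρ₂) 7 1 le_rfl
  have hG := H_Rj_one_mul_JF (A₀ := A₀) (ρ₁ := ρ₁) (ρ₂ := ρ₂)
  have hq' : H 7 (D 0 (qF A₀ ρ₁ ρ₂)) := H_qF.D 0 le_rfl
  have hJ' : H 7 (D 0 𝐉) := H_JF.D 0 le_rfl
  have r : ∀ {m : ℕ} {f : Fam A₀ ρ₁ ρ₂}, H m f → 4 ≤ m → Reg 4 f := fun h hm => h.1.mono hm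
  have h0 : Rj A₀ ρ₁ ρ₂ 1 * 𝐉 * D 0 (qF A₀ ρ₁ ρ₂) + Rj A₀ ρ₁ ρ₂ 0 * D 0 𝐉 = 0 := by
    have h := congrArg (D 0) (Rj_mul_JF (A₀ := A₀) (ρ₁ := ρ₁) (ρ₂ := ρ₂))
    have hz : D 0 (rho0 A₀ ρ₁ ρ₂) = 0 := D_zero_atZ (hR0.1.mono (by norm_num))
    rw [D_mul 0 (hR0.1.mono (by norm_num)) (H_JF.1.mono (by norm_num)), D_Rj, hz] at h
    linear_combination h
  have hG4 : H 0 (dn 4 (Rj A₀ ρ₁ ρ₂ 1 * 𝐉)) := by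
    rw [dn_four_mul (r hR1 (by norm_num)) (r H_JF (by norm_num))]
    refine (H.add ?_ ?_).add (H_comm4 hR1 H_JF (by norm_num) (by norm_num) (by norm_num))
    · exact H_dn_four_Rj_one.mul H_JF le_rfl (by norm_num) (by norm_num)
    · exact hR1.smul (H_JF.dn (c := 0) 4 le_rfl) (by norm_num) (by norm_num)
  have h := congrArg (dn 4) h0
  rw [dn_add 4 ((r hG (by norm_num)).mul (r hq' (by norm_num)))
      ((r hR0 (by norm_num)).mul (r hJ' (by norm_num))),
    dn_four_mul (r hG (by norm_num)) (r hq' (by norm_num)),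
    dn_four_mul (r hR0 (by norm_num)) (r hJ' (by norm_num)), dn_fam_zero,
    ← D_dn (f := qF A₀ ρ₁ ρ₂) (by decide) 4 (H_qF.1.mono (by norm_num))] at h
  have hK := HT_dn_four_qF_add_beta (A₀ := A₀) (ρ₁ := ρ₁) (ρ₂ := ρ₂)
  have hK' := hK.2.2
  rw [D_add 0 ((H_qF.1.dn 4 le_rfl).mono (by norm_num)) (Reg_beta.mono (by norm_num))] at hK'
  have hi : (Rj A₀ ρ₁ ρ₂ 0)⁻¹ * Rj A₀ ρ₁ ρ₂ 0 = 1 := by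
    funext s z
    exact inv_mul_cancel₀ (Rj_zero_ne s z)
  have e : dn 4 (D 0 𝐉) - kappa A₀ ρ₁ ρ₂ * D 0 (beta A₀ ρ₁ ρ₂)
      = -((Rj A₀ ρ₁ ρ₂ 0)⁻¹ * (dn 4 (Rj A₀ ρ₁ ρ₂ 1 * 𝐉) * D 0 (qF A₀ ρ₁ ρ₂)
        + comm4 (Rj A₀ ρ₁ ρ₂ 1 * 𝐉) (D 0 (qF A₀ ρ₁ ρ₂)) + dn 4 (Rj A₀ ρ₁ ρ₂ 0) * D 0 𝐉
        + comm4 (Rj A₀ ρ₁ ρ₂ 0) (D 0 𝐉)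
        + Rj A₀ ρ₁ ρ₂ 1 * 𝐉 * (D 0 (dn 4 (qF A₀ ρ₁ ρ₂)) + D 0 (beta A₀ ρ₁ ρ₂)))) := by
    rw [kappa]
    linear_combination (Rj A₀ ρ₁ ρ₂ 0)⁻¹ * h - dn 4 (D 0 𝐉) * hi
  rw [e]
  refine (H_Rj_inv.smul (((((?_ : H 0 _).add ?_).add ?_).add ?_).add ?_) (by norm_num)
    (by norm_num)).neg
  · exact hG4.mul hq' le_rfl (by norm_num) (by norm_num)
  · exact H_comm4 hG hq' (by norm_num) (by norm_num) (by norm_num)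
  · exact (hR0.dn (c := 0) 4 le_rfl).mul hJ' le_rfl (by norm_num) (by norm_num)
  · exact H_comm4 hR0 hJ' (by norm_num) (by norm_num) (by norm_num)
  · exact hG.smul hK' (by norm_num) (by norm_num)

end Pressure

/-! ### The energy identity for four normal derivatives -/

section EnergyIdentity

variable {A₀ ρ₁ ρ₂ : ℝ}

local notation "𝐉" => JF A₀ ρ₁ ρ₂
local notation "𝐗" => X A₀ ρ₁ ρ₂
local notation "𝐖" => WF A₀ ρ₁ ρ₂
local notation "𝐯" => velF A₀ ρ₁ ρ₂
local notation "𝐛" => magF A₀ ρ₁ ρ₂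
local notation "𝐙" => ZF A₀ ρ₁ ρ₂
local notation "𝐘" => YF A₀ ρ₁ ρ₂

variable (A₀ ρ₁ ρ₂) in
/-- The density of the energy of the four normal derivatives. -/
def energyDensity : Fam A₀ ρ₁ ρ₂ :=
  ∑ k, half * (rho0 A₀ ρ₁ ρ₂ * (𝐙 k * 𝐙 k) + 𝐉 * (dn 4 (𝐛 k) * dn 4 (𝐛 k)))
    + half * (kappa A₀ ρ₁ ρ₂ * (beta A₀ ρ₁ ρ₂ * beta A₀ ρ₁ ρ₂))

theorem Reg_energyDensity : Reg 4 (energyDensity A₀ ρ₁ ρ₂) :=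
  (Reg.sum fun k _ => (Reg_half 4).mul
    (((H_rho0.1.mono (by norm_num)).mul ((Reg_ZF k).mul (Reg_ZF k))).add
      ((H_JF.1.mono (by norm_num)).mul ((Reg_dn_four_magF k).mul (Reg_dn_four_magF k))))).add
    ((Reg_half 4).mul ((H_kappa.1.mono (by norm_num)).mul (Reg_beta.mul Reg_beta)))

theorem L1_energyDensity : L1 (energyDensity A₀ ρ₁ ρ₂) := by
  have e : energyDensity A₀ ρ₁ ρ₂
      = ∑ k, ((half * (rho0 A₀ ρ₁ ρ₂ * 𝐙 k)) * 𝐙 k + (half * (𝐉 * dn 4 (𝐛 k))) * dn 4 (𝐛 k))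
        + (half * (kappa A₀ ρ₁ ρ₂ * beta A₀ ρ₁ ρ₂)) * beta A₀ ρ₁ ρ₂ := by
    rw [energyDensity]
    congr 1
    · exact Finset.sum_congr rfl fun k _ => by ring
    · ring
  rw [e]
  refine (L1.sum fun k _ => L1.add (H.mul_l1 (H.const_smul _ ?_) (H_ZF k))
    (H.mul_l1 (H.const_smul _ ?_) (H_dn_four_magF k))).add
    (H.mul_l1 (H.const_smul _ ?_) H_beta)
  · exact H_rho0.smul (H_ZF k) (by norm_num) (by norm_num)
  · exact H_JF.smul (H_dn_four_magF k) (by norm_num) (by norm_num)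
  · exact H_kappa.smul H_beta (by norm_num) (by norm_num)

/-- The time derivative of the energy density, up to products of residuals of order zero. -/
theorem D_zero_energyDensity : ∃ e₁ e₂ : Fin 3 → Fam A₀ ρ₁ ρ₂, ∃ e₃ : Fam A₀ ρ₁ ρ₂,
    (∀ k, H 0 (e₁ k)) ∧ (∀ k, H 0 (e₂ k)) ∧ H 0 e₃ ∧
    D 0 (energyDensity A₀ ρ₁ ρ₂) = Db (∑ k, 𝐙 k * dn 4 (𝐛 k))
      + ∑ k, (𝐙 k * (e₁ k - rho0 A₀ ρ₁ ρ₂ * D 0 (𝐘 k))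
        + dn 4 (𝐛 k) * (Db (𝐘 k) - e₂ k + half * (D 0 𝐉 * dn 4 (𝐛 k)))
        - 𝐙 k * (𝐉 * dn 4 (𝐖 k)))
      + beta A₀ ρ₁ ρ₂ * (half * (D 0 (kappa A₀ ρ₁ ρ₂) * beta A₀ ρ₁ ρ₂) - e₃) := by
  refine ⟨_, _, _, H_momentum, H_induction, H_dn_four_D_zero_JF, ?_⟩
  have rZ : ∀ k, Reg 1 (𝐙 k) := fun k => (Reg_ZF k).mono (by norm_num)
  have rB : ∀ k, Reg 1 (dn 4 (𝐛 k)) := fun k => (Reg_dn_four_magF k).mono (by norm_num)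
  have rV : ∀ k, Reg 1 (dn 4 (𝐯 k)) := fun k => (Reg_dn_four_velF k).mono (by norm_num)
  have rY : ∀ k, Reg 1 (𝐘 k) := fun k => (Reg_YF k).mono (by norm_num)
  have rJ : Reg 1 𝐉 := H_JF.1.mono (by norm_num)
  have rρ : Reg 1 (rho0 A₀ ρ₁ ρ₂) := H_rho0.1.mono (by norm_num)
  have rβ : Reg 1 (beta A₀ ρ₁ ρ₂) := Reg_beta.mono (by norm_num)
  have rκ : Reg 1 (kappa A₀ ρ₁ ρ₂) := H_kappa.1.mono (by norm_num)
  have h0 : D 0 (rho0 A₀ ρ₁ ρ₂) = 0 := D_zero_atZ (Reg_Rj 0 1 (by norm_num))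
  have h2 := two_mul_half (A₀ := A₀) (ρ₁ := ρ₁) (ρ₂ := ρ₂)
  have r1 : ∀ k, Reg 1 (rho0 A₀ ρ₁ ρ₂ * (𝐙 k * 𝐙 k)) := fun k => rρ.mul ((rZ k).mul (rZ k))
  have r2 : ∀ k, Reg 1 (𝐉 * (dn 4 (𝐛 k) * dn 4 (𝐛 k))) := fun k => rJ.mul ((rB k).mul (rB k))
  have hL : D 0 (energyDensity A₀ ρ₁ ρ₂)
      = ∑ k, (rho0 A₀ ρ₁ ρ₂ * 𝐙 k * (D 0 (dn 4 (𝐯 k)) - D 0 (𝐘 k))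
          + 𝐉 * dn 4 (𝐛 k) * D 0 (dn 4 (𝐛 k)) + half * (D 0 𝐉 * (dn 4 (𝐛 k) * dn 4 (𝐛 k))))
        + (kappa A₀ ρ₁ ρ₂ * beta A₀ ρ₁ ρ₂ * D 0 (beta A₀ ρ₁ ρ₂)
          + half * (D 0 (kappa A₀ ρ₁ ρ₂) * (beta A₀ ρ₁ ρ₂ * beta A₀ ρ₁ ρ₂))) := by
    rw [energyDensity, D_add 0 (Reg.sum fun k _ => (Reg_half 1).mul ((r1 k).add (r2 k)))
      ((Reg_half 1).mul (rκ.mul (rβ.mul rβ))), D_sum 0 fun k _ => (Reg_half 1).mul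
      ((r1 k).add (r2 k)), D_half_mul 0 (rκ.mul (rβ.mul rβ)), D_mul 0 rκ (rβ.mul rβ),
      D_mul 0 rβ rβ]
    congr 1
    · refine Finset.sum_congr rfl fun k _ => ?_
      rw [D_half_mul 0 ((r1 k).add (r2 k)), D_add 0 (r1 k) (r2 k), D_mul 0 rρ ((rZ k).mul (rZ k)),
        D_mul 0 (rZ k) (rZ k), D_mul 0 rJ ((rB k).mul (rB k)), D_mul 0 (rB k) (rB k), h0]
      have hz : D 0 (𝐙 k) = D 0 (dn 4 (𝐯 k)) - D 0 (𝐘 k) := D_sub 0 (rV k) (rY k)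
      rw [hz]
      linear_combination (rho0 A₀ ρ₁ ρ₂ * 𝐙 k * (D 0 (dn 4 (𝐯 k)) - D 0 (𝐘 k))
          + 𝐉 * dn 4 (𝐛 k) * D 0 (dn 4 (𝐛 k))) * h2
    · linear_combination (kappa A₀ ρ₁ ρ₂ * beta A₀ ρ₁ ρ₂ * D 0 (beta A₀ ρ₁ ρ₂)) * h2
  have hβ : beta A₀ ρ₁ ρ₂ * dn 4 (D 0 𝐉) = ∑ k, 𝐛 k * dn 4 (𝐛 k) * dn 4 (D 0 𝐉) := by
    rw [beta, Finset.sum_mul]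
  have hD : Db (∑ k, 𝐙 k * dn 4 (𝐛 k)) = ∑ k, ((Db (dn 4 (𝐯 k)) - Db (𝐘 k)) * dn 4 (𝐛 k)
      + 𝐙 k * Db (dn 4 (𝐛 k))) := by
    rw [Db_sum fun k _ => (rZ k).mul (rB k)]
    refine Finset.sum_congr rfl fun k _ => ?_
    have hz : Db (𝐙 k) = Db (dn 4 (𝐯 k)) - Db (𝐘 k) := Db_sub (rV k) (rY k)
    rw [Db_mul (rZ k) (rB k), hz]
  rw [hL, hD, ← Finset.sum_add_distrib]
  -- The volume terms left by the induction equation add up to β∂₃⁴∂_t J and cancel against κβ∂_tβ;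
  -- this dictates the weight κ in the energy.
  have hsum : ∀ {F G : Fin 3 → Fam A₀ ρ₁ ρ₂} {a b : Fam A₀ ρ₁ ρ₂},
      (∀ k, F k = G k + 𝐛 k * dn 4 (𝐛 k) * dn 4 (D 0 𝐉)) →
      a = b - beta A₀ ρ₁ ρ₂ * dn 4 (D 0 𝐉) → (∑ k, G k) + b = (∑ k, F k) + a := by
    intro F G a b h h'
    rw [h', hβ, Finset.sum_congr rfl fun k _ => h k, Finset.sum_add_distrib]
    ring
  refine hsum (fun k => ?_) ?_
  · ring
  · ring

theorem L1_D_zero_energyDensity : L1 (D 0 (energyDensity A₀ ρ₁ ρ₂)) := by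
  obtain ⟨e₁, e₂, e₃, h₁, h₂, h₃, h⟩ := D_zero_energyDensity (A₀ := A₀) (ρ₁ := ρ₁) (ρ₂ := ρ₂)
  have hB : ∀ k, H 0 (dn 4 (𝐛 k)) := H_dn_four_magF
  have hJ' : H 7 (D 0 𝐉) := H_JF.D 0 le_rfl
  have hκ' : H 6 (D 0 (kappa A₀ ρ₁ ρ₂)) := H_kappa.D 0 le_rfl
  -- The magnetic coupling between Z and ∂₃⁴b, a total derivative along a divergence-free tangential
  -- field.
  have hD : L1 (Db (∑ k, 𝐙 k * dn 4 (𝐛 k))) := by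
    refine L1_Db (Reg.sum fun k _ => ((Reg_ZF k).mono (by norm_num)).mul
      ((Reg_dn_four_magF k).mono (by norm_num))) (Per.sum fun k _ => (Per_ZF k).mul ?_)
    exact (Per_magF k).dn 4 ((H_magF k).1.mono (by norm_num))
  -- Z lies in the span of ∂₁η and ∂₂η, so only the controlled components of ∂₃⁴W occur. There is no
  -- integration by parts and hence no boundary contribution.
  have hW : L1 (∑ k, 𝐙 k * (𝐉 * dn 4 (𝐖 k))) := by
    have e : ∑ k, 𝐙 k * (𝐉 * dn 4 (𝐖 k))
        = (𝐉 * zF A₀ ρ₁ ρ₂ 0) * (∑ k, 𝐗 0 k * dn 4 (𝐖 k))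
          + (𝐉 * zF A₀ ρ₁ ρ₂ 1) * (∑ k, 𝐗 1 k * dn 4 (𝐖 k)) := by
      rw [Finset.mul_sum, Finset.mul_sum, ← Finset.sum_add_distrib]
      refine Finset.sum_congr rfl fun k _ => ?_
      rw [ZF_eq k]
      ring
    rw [e]
    have hz : ∀ l, H 0 (𝐉 * zF A₀ ρ₁ ρ₂ l) := fun l =>
      H_JF.smul (H_zF l) (by norm_num) (by norm_num)
    exact ((hz 0).mul_l1 (H_sum_X_mul_dn_four_WF (by decide))).add
      ((hz 1).mul_l1 (H_sum_X_mul_dn_four_WF (by decide)))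
  rw [h, Finset.sum_sub_distrib]
  refine (hD.add (L1.sub (L1.sum fun k _ => L1.add ?_ ?_) hW)).add ?_
  · exact (H_ZF k).mul_l1 ((h₁ k).sub (H_rho0.smul (H_D_zero_YF k) (by norm_num) (by norm_num)))
  · exact (hB k).mul_l1 (((H_Db_YF k).sub (h₂ k)).add
      (H.const_smul _ (hJ'.smul (hB k) (by norm_num) (by norm_num))))
  · exact H_beta.mul_l1 ((H.const_smul _ (hκ'.smul H_beta (by norm_num) (by norm_num))).sub h₃)

end EnergyIdentity

/-! ### Continuity of the energy, for integrability in time -/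

section EnergyContinuity

variable {A₀ ρ₁ ρ₂ : ℝ}

theorem continuousOn_l2Sq {g : Sol A₀ ρ₁ ρ₂ → SpaceTime → ℝ} (hg : Reg 0 (resF g))
    (s : Sol A₀ ρ₁ ρ₂) : ContinuousOn (l2Sq (g s)) (Icc 0 s.T) :=
  (((hg s).mul (hg s)).continuousOn_cint s.T_pos).congr fun _ ht => (cint_resF g s ht).symm

theorem continuousOn_starSq {g : Sol A₀ ρ₁ ρ₂ → SpaceTime → ℝ} (hg : Reg 8 (resF g))
    (s : Sol A₀ ρ₁ ρ₂) : ContinuousOn (starSq s.T 8 (g s)) (Icc 0 s.T) := by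
  refine continuousOn_finsetSum _ fun I hI => ?_
  have hw := card_le_weight I
  have hI' := mem_indicesLE.1 hI
  have h := reg_dstarF hg I (n := 0) (by omega)
  rw [dstarF_resF] at h
  exact continuousOn_l2Sq h s

theorem continuousOn_bdrySq {g : Sol A₀ ρ₁ ρ₂ → SpaceTime → ℝ} (hg : Reg 0 (resF g))
    (s : Sol A₀ ρ₁ ρ₂) : ContinuousOn (bdrySq (g s)) (Icc 0 s.T) := by
  unfold bdrySq integralBdry
  refine continuousOn_finsetSum _ fun c hc => ?_
  have hc' : c = -1 ∨ c = 1 := by simpa using hc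
  have hcell : ∀ y' ∈ Icc (0 : Fin 2 → ℝ) 1, (![y' 0, y' 1, c] : Fin 3 → ℝ) ∈ cell := by
    intro y' hy
    have h0 := hy.1 0
    have h1 := hy.1 1
    have h2 := hy.2 0
    have h3 := hy.2 1
    simp only [Pi.zero_apply, Pi.one_apply] at h0 h1 h2 h3
    have h4 : -1 ≤ c ∧ c ≤ 1 := by rcases hc' with rfl | rfl <;> norm_num
    constructor
    · intro i; fin_cases i <;> simp [h0, h1, h4.1]
    · intro i; fin_cases i <;> simp [h2, h3, h4.2]
  have hcont : Continuous fun p : ℝ × (Fin 2 → ℝ) =>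
      ext (resF g s) (clamp s.T (p.1, ![p.2 0, p.2 1, c])) ^ 2 := by
    refine Continuous.pow (((hg s).continuous_clamp s.T_pos).comp
      (Continuous.prodMk continuous_fst (continuous_pi fun i => ?_))) 2
    fin_cases i
    · exact (continuous_apply (0 : Fin 2)).comp continuous_snd
    · exact (continuous_apply (1 : Fin 2)).comp continuous_snd
    · exact continuous_const
  have h := continuous_parametric_integral_of_continuous (μ := volume)
    (f := fun t y' => ext (resF g s) (clamp s.T (t, ![y' 0, y' 1, c])) ^ 2) hcont
    (isCompact_Icc (a := (0 : Fin 2 → ℝ)) (b := 1))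
  refine h.continuousOn.congr fun t ht => ?_
  refine setIntegral_congr_fun measurableSet_Icc fun y' hy => ?_
  have hy' := hcell y' hy
  simp only [clamp_of_mem ht hy', ext_of_mem _ (mem_cyl_of_cell ht hy')]
  rfl

theorem continuousOn_En (s : Sol A₀ ρ₁ ρ₂) : ContinuousOn (En s) (Icc 0 s.T) := by
  unfold En energy
  refine ContinuousOn.add (((ContinuousOn.add ?_ ?_).add ?_).add ?_) ?_
  · exact continuousOn_finsetSum _ fun i _ =>
      continuousOn_starSq (g := fun s z => s.η z i) (H_etaF i).1 s
  · exact continuousOn_finsetSum _ fun i _ =>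
      continuousOn_starSq (g := fun s z => s.v z i) (H_velF i).1 s
  · exact continuousOn_finsetSum _ fun i _ =>
      continuousOn_starSq (g := fun s z => mag s.T s.b₀ s.η z i) (H_magF i).1 s
  · exact continuousOn_starSq (g := fun s => totalP s.T s.b₀ s.η s.q) H_QF.1 s
  · refine continuousOn_finsetSum _ fun I hI => ?_
    refine continuousOn_bdrySq (g := fun s => bdryUnknown s.T s.η I) ?_ s
    have e : (resF fun s => bdryUnknown s.T s.η I : Fam A₀ ρ₁ ρ₂)
        = ∑ i, AF 2 i * dstarF I (etaF A₀ ρ₁ ρ₂ i) := by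
      funext s z
      simp only [etaF, dstarF_resF, Finset.sum_apply, Pi.mul_apply]
      rfl
    rw [e]
    have hw := card_le_weight I
    have hI' := mem_indicesEq.1 hI
    exact Reg.sum fun i _ => ((H_AF 2 i).1.mono (by norm_num)).mul
      (reg_dstarF (H_etaF i).1 I (by omega))

theorem continuousOn_Mg_pow (s : Sol A₀ ρ₁ ρ₂) (k : ℕ) :
    ContinuousOn (fun t => Mg s t ^ k) (Icc 0 s.T) :=
  (continuousOn_const.add (continuousOn_En s)).pow k

theorem intervalIntegrable_Mg_pow (s : Sol A₀ ρ₁ ρ₂) (k : ℕ) :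
    IntervalIntegrable (fun t => Mg s t ^ k) volume 0 s.T :=
  (continuousOn_Mg_pow s k).intervalIntegrable_of_Icc s.T_pos.le

end EnergyContinuity

/-! ### Quantities bounded by initial data and a time integral -/

section Growth

variable {A₀ ρ₁ ρ₂ : ℝ} {φ ψ : Sol A₀ ρ₁ ρ₂ → ℝ} {f g : Fam A₀ ρ₁ ρ₂}

/-- Quantities controlled by the initial data and a time integral. -/
def Good (φ : Sol A₀ ρ₁ ρ₂ → ℝ) : Prop := ∃ (C : ℝ) (k : ℕ), 0 ≤ C ∧
  ∀ s, φ s ≤ C * (Mg s 0 ^ k + ∫ t in (0 : ℝ)..s.T, Mg s t ^ k)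

theorem integral_Mg_pow_mono (s : Sol A₀ ρ₁ ρ₂) {k l : ℕ} (h : k ≤ l) :
    ∫ t in (0 : ℝ)..s.T, Mg s t ^ k ≤ ∫ t in (0 : ℝ)..s.T, Mg s t ^ l :=
  intervalIntegral.integral_mono_on s.T_pos.le (intervalIntegrable_Mg_pow s k)
    (intervalIntegrable_Mg_pow s l) fun t _ => pow_le_pow_right₀ (one_le_Mg s t) h

theorem integral_Mg_pow_nonneg (s : Sol A₀ ρ₁ ρ₂) (k : ℕ) :
    0 ≤ ∫ t in (0 : ℝ)..s.T, Mg s t ^ k :=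
  intervalIntegral.integral_nonneg s.T_pos.le fun t _ =>
    pow_nonneg (zero_le_one.trans (one_le_Mg s t)) _

theorem Good.raise {C : ℝ} {k l : ℕ} (hC : 0 ≤ C) (hkl : k ≤ l) (s : Sol A₀ ρ₁ ρ₂) :
    C * (Mg s 0 ^ k + ∫ t in (0 : ℝ)..s.T, Mg s t ^ k)
      ≤ C * (Mg s 0 ^ l + ∫ t in (0 : ℝ)..s.T, Mg s t ^ l) :=
  mul_le_mul_of_nonneg_left (add_le_add (pow_le_pow_right₀ (one_le_Mg s 0) hkl)
    (integral_Mg_pow_mono s hkl)) hC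

protected theorem Good.mono (h : Good ψ) (hle : ∀ s, φ s ≤ ψ s) : Good φ := by
  obtain ⟨C, k, hC, h⟩ := h
  exact ⟨C, k, hC, fun s => (hle s).trans (h s)⟩

protected theorem Good.add (h : Good φ) (h' : Good ψ) : Good fun s => φ s + ψ s := by
  obtain ⟨C, k, hC, h⟩ := h
  obtain ⟨C', k', hC', h'⟩ := h'
  refine ⟨C + C', k + k', by positivity, fun s => ?_⟩
  have h1 := (h s).trans (Good.raise hC (Nat.le_add_right k k') s)
  have h2 := (h' s).trans (Good.raise hC' (Nat.le_add_left k' k) s)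
  linarith

protected theorem Good.const_mul (h : Good φ) {c : ℝ} (hc : 0 ≤ c) : Good fun s => c * φ s := by
  obtain ⟨C, k, hC, h⟩ := h
  refine ⟨c * C, k, by positivity, fun s => ?_⟩
  rw [mul_assoc]
  exact mul_le_mul_of_nonneg_left (h s) hc

protected theorem Good.sum {ι : Type*} {t : Finset ι} {φ : ι → Sol A₀ ρ₁ ρ₂ → ℝ}
    (h : ∀ i ∈ t, Good (φ i)) : Good fun s => ∑ i ∈ t, φ i s := by
  classical
  induction t using Finset.induction_on with
  | empty =>
    refine ⟨0, 0, le_rfl, fun s => ?_⟩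
    simp
  | insert a t ha ih =>
    simp only [Finset.sum_insert ha]
    exact (h a (Finset.mem_insert_self _ _)).add
      (ih fun i hi => h i (Finset.mem_insert_of_mem hi))

/-- The fundamental theorem of calculus in time. -/
theorem Good.of_L1 (hr : Reg 1 f) (h0 : L1 f) (h1 : L1 (D 0 f)) :
    Good fun s => cint (f s) s.T := by
  obtain ⟨C, k, hC, hb⟩ := h0.2
  obtain ⟨C', k', hC', hb'⟩ := h1.2
  have hg0 : Good fun s : Sol A₀ ρ₁ ρ₂ => cint (f s) 0 := by
    refine ⟨C, k, hC, fun s => (le_abs_self _).trans ((hb s 0 ⟨le_rfl, s.T_pos.le⟩).trans ?_)⟩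
    exact mul_le_mul_of_nonneg_left (le_add_of_nonneg_right (integral_Mg_pow_nonneg s k)) hC
  have hg1 : Good fun s : Sol A₀ ρ₁ ρ₂ => ∫ t in (0 : ℝ)..s.T, cint (D 0 f s) t := by
    refine ⟨C', k', hC', fun s => ?_⟩
    have hi : IntervalIntegrable (fun t => cint (D 0 f s) t) volume 0 s.T :=
      ((h1.1 s).continuousOn_cint s.T_pos).intervalIntegrable_of_Icc s.T_pos.le
    have h2 := intervalIntegral.integral_mono_on s.T_pos.le hi
      ((intervalIntegrable_Mg_pow s k').const_mul C') fun t ht =>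
        (le_abs_self _).trans (hb' s t ht)
    rw [intervalIntegral.integral_const_mul] at h2
    refine h2.trans (mul_le_mul_of_nonneg_left (le_add_of_nonneg_left ?_) hC')
    exact pow_nonneg (zero_le_one.trans (one_le_Mg s 0)) _
  refine (hg0.add hg1).mono fun s => le_of_eq ?_
  have h2 := cint_sub_cint_zero s.T_pos (hr s)
  rw [D_zero_eq]
  change _ = _ + ∫ t in (0 : ℝ)..s.T, cint (pd eT (f s)) t
  rw [← h2]
  ring

theorem HT.mul_good (hf : HT 0 f) (hg : HT 0 g) : L1 (f * g) ∧ L1 (D 0 (f * g)) := by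
  refine ⟨hf.h.mul_l1 hg.h, ?_⟩
  rw [D_mul 0 hf.1 hg.1]
  exact (hf.2.2.mul_l1 hg.h).add (hf.h.mul_l1 hg.2.2)

theorem HT.good (hf : HT 0 f) : Good fun s => cint (f s * f s) s.T :=
  Good.of_L1 (hf.1.mul hf.1) (hf.mul_good hf).1 (hf.mul_good hf).2

/-- Transfer of control along a pointwise inequality. -/
theorem Good.of_le (hf : Reg 0 f) (hg : Reg 0 g) (h : Good fun s => cint (g s) s.T) {c : ℝ}
    (hc : 0 ≤ c) (hle : ∀ s z, f s z ≤ c * g s z) : Good fun s => cint (f s) s.T :=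
  (h.const_mul hc).mono fun s =>
    cint_le_of_le (hf s) (hg s) ⟨s.T_pos.le, le_rfl⟩ fun z _ _ => hle s z

theorem Good.sq_add (hf : Reg 0 f) (hg : Reg 0 g) (h : Good fun s => cint (f s * f s) s.T)
    (h' : Good fun s => cint (g s * g s) s.T) :
    Good fun s => cint ((f + g) s * (f + g) s) s.T := by
  refine ((h.add h').const_mul zero_le_two).mono fun s => ?_
  have ht : s.T ∈ Icc 0 s.T := ⟨s.T_pos.le, le_rfl⟩
  have h1 := (hf s).mul (hf s)
  have h2 := (hg s).mul (hg s)
  rw [← cint_add h1 h2 ht]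
  refine cint_le_of_le (((hf.add hg) s).mul ((hf.add hg) s)) (h1.add h2) ht fun z _ _ => ?_
  simp only [Pi.add_apply, Pi.mul_apply]
  nlinarith [sq_nonneg (f s z - g s z)]

end Growth

/-! ### Coercivity and the interior estimate -/

section Interior

variable {A₀ ρ₁ ρ₂ : ℝ}

local notation "𝐉" => JF A₀ ρ₁ ρ₂
local notation "𝐙" => ZF A₀ ρ₁ ρ₂
local notation "𝐛" => magF A₀ ρ₁ ρ₂

theorem kappa_ge (s : Sol A₀ ρ₁ ρ₂) (z : cyl s.T) :
    ρ₂⁻¹ * (A₀⁻¹ * (ρ₁ / ρ₂)) ≤ kappa A₀ ρ₁ ρ₂ s z := by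
  have h0 : 0 < ρ₂ := s.ρ₁_pos.trans s.ρ₁_lt
  have hA : 0 < A₀⁻¹ := inv_pos.2 (zero_lt_one.trans s.one_lt)
  have h1 : A₀⁻¹ ≤ Rj A₀ ρ₁ ρ₂ 1 s z := by
    have := s.liquid.deriv_lower z z.2
    simpa [Rj, iteratedDeriv_one] using this
  have h2 : ρ₂⁻¹ ≤ (Rj A₀ ρ₁ ρ₂ 0 s z)⁻¹ :=
    inv_anti₀ (s.ρ₁_pos.trans_le (Rj_zero_ge s z)) (Rj_zero_le s z)
  have h3 := JF_ge s z
  have h4 : 0 ≤ ρ₁ / ρ₂ := div_nonneg s.ρ₁_pos.le h0.le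
  exact mul_le_mul h2 (mul_le_mul h1 h3 h4 (hA.le.trans h1)) (mul_nonneg hA.le h4)
    ((inv_pos.2 h0).le.trans h2)

theorem energyDensity_apply (s : Sol A₀ ρ₁ ρ₂) (z : cyl s.T) : energyDensity A₀ ρ₁ ρ₂ s z
    = ∑ k, 1 / 2 * (rho0 A₀ ρ₁ ρ₂ s z * (𝐙 k s z * 𝐙 k s z)
        + 𝐉 s z * (dn 4 (𝐛 k) s z * dn 4 (𝐛 k) s z))
      + 1 / 2 * (kappa A₀ ρ₁ ρ₂ s z * (beta A₀ ρ₁ ρ₂ s z * beta A₀ ρ₁ ρ₂ s z)) := by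
  simp only [energyDensity, half, Pi.add_apply, Pi.mul_apply, Finset.sum_apply]

/-- The three weights ρ₀, J and κ have positive lower bounds depending only on the constants of the
equation of state. -/
theorem energyDensity_coercive (hA₀ : 1 < A₀) (hρ₁ : 0 < ρ₁) (hρ₂ : ρ₁ < ρ₂) :
    ∃ c, 0 ≤ c ∧ ∀ (s : Sol A₀ ρ₁ ρ₂) (z : cyl s.T) (k : Fin 3),
      𝐙 k s z * 𝐙 k s z ≤ c * energyDensity A₀ ρ₁ ρ₂ s z
      ∧ dn 4 (𝐛 k) s z * dn 4 (𝐛 k) s z ≤ c * energyDensity A₀ ρ₁ ρ₂ s z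
      ∧ beta A₀ ρ₁ ρ₂ s z * beta A₀ ρ₁ ρ₂ s z ≤ c * energyDensity A₀ ρ₁ ρ₂ s z := by
  have h0 : 0 < ρ₂ := hρ₁.trans hρ₂
  have hA : 0 < A₀ := zero_lt_one.trans hA₀
  set δ₂ := ρ₁ / ρ₂ with hδ₂
  set δ₃ := ρ₂⁻¹ * (A₀⁻¹ * (ρ₁ / ρ₂)) with hδ₃
  have p2 : 0 < δ₂ := by positivity
  have p3 : 0 < δ₃ := by positivity
  refine ⟨2 / ρ₁ + 2 / δ₂ + 2 / δ₃, by positivity, fun s z k => ?_⟩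
  have key : ∀ {x δ w : ℝ}, 0 < δ → 0 ≤ w → 1 / 2 * (δ * x) ≤ w → x ≤ 2 / δ * w := by
    intro x δ w hδ _ h
    rw [div_mul_eq_mul_div, le_div_iff₀ hδ]
    linarith
  have hρ := rho0_ge s z
  have hJ : δ₂ ≤ 𝐉 s z := JF_ge s z
  have hκ : δ₃ ≤ kappa A₀ ρ₁ ρ₂ s z := kappa_ge s z
  have hsq : ∀ x : ℝ, 0 ≤ x * x := mul_self_nonneg
  have hterm : ∀ k, 0 ≤ 1 / 2 * (rho0 A₀ ρ₁ ρ₂ s z * (𝐙 k s z * 𝐙 k s z)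
        + 𝐉 s z * (dn 4 (𝐛 k) s z * dn 4 (𝐛 k) s z)) := fun k => by
    have h1 := mul_nonneg (hρ₁.le.trans hρ) (hsq (𝐙 k s z))
    have h2 := mul_nonneg (p2.le.trans hJ) (hsq (dn 4 (𝐛 k) s z))
    linarith
  have hβ := mul_nonneg (p3.le.trans hκ) (hsq (beta A₀ ρ₁ ρ₂ s z))
  have hk := Finset.single_le_sum (fun k _ => hterm k) (Finset.mem_univ k)
  have hall := Finset.sum_nonneg (s := Finset.univ) fun k _ => hterm k
  have hw := energyDensity_apply s z
  have w0 : 0 ≤ energyDensity A₀ ρ₁ ρ₂ s z := by rw [hw]; linarith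
  have h1 := mul_nonneg (hρ₁.le.trans hρ) (hsq (𝐙 k s z))
  have h2 := mul_nonneg (p2.le.trans hJ) (hsq (dn 4 (𝐛 k) s z))
  have i1 : 0 ≤ 2 / ρ₁ * energyDensity A₀ ρ₁ ρ₂ s z := by positivity
  have i2 : 0 ≤ 2 / δ₂ * energyDensity A₀ ρ₁ ρ₂ s z := by positivity
  have i3 : 0 ≤ 2 / δ₃ * energyDensity A₀ ρ₁ ρ₂ s z := by positivity
  have j1 := key hρ₁ w0 (x := 𝐙 k s z * 𝐙 k s z) (by
    have := mul_le_mul_of_nonneg_right hρ (hsq (𝐙 k s z))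
    rw [hw]; linarith)
  have j2 := key p2 w0 (x := dn 4 (𝐛 k) s z * dn 4 (𝐛 k) s z) (by
    have := mul_le_mul_of_nonneg_right hJ (hsq (dn 4 (𝐛 k) s z))
    rw [hw]; linarith)
  have j3 := key p3 w0 (x := beta A₀ ρ₁ ρ₂ s z * beta A₀ ρ₁ ρ₂ s z) (by
    have := mul_le_mul_of_nonneg_right hκ (hsq (beta A₀ ρ₁ ρ₂ s z))
    rw [hw]; linarith)
  refine ⟨?_, ?_, ?_⟩ <;> linarith

theorem good_energyDensity : Good fun s => cint (energyDensity A₀ ρ₁ ρ₂ s) s.T :=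
  Good.of_L1 (Reg_energyDensity.mono (by norm_num)) L1_energyDensity L1_D_zero_energyDensity

/-- The velocity is recovered by adding back the transversal part, and the pressure by subtracting β
from ∂₃⁴q + β; both corrections have controlled time derivatives. -/
theorem good_interior (hA₀ : 1 < A₀) (hρ₁ : 0 < ρ₁) (hρ₂ : ρ₁ < ρ₂) :
    (∀ k, Good fun s : Sol A₀ ρ₁ ρ₂ =>
        cint (dn 4 (velF A₀ ρ₁ ρ₂ k) s * dn 4 (velF A₀ ρ₁ ρ₂ k) s) s.T)
    ∧ (∀ k, Good fun s : Sol A₀ ρ₁ ρ₂ => cint (dn 4 (𝐛 k) s * dn 4 (𝐛 k) s) s.T)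
    ∧ Good fun s : Sol A₀ ρ₁ ρ₂ => cint (dn 4 (qF A₀ ρ₁ ρ₂) s * dn 4 (qF A₀ ρ₁ ρ₂) s) s.T := by
  obtain ⟨c, hc, h⟩ := energyDensity_coercive hA₀ hρ₁ hρ₂
  have rw0 : Reg 0 (energyDensity A₀ ρ₁ ρ₂) := Reg_energyDensity.mono (by norm_num)
  have rZ : ∀ k, Reg 0 (𝐙 k) := fun k => (H_ZF k).1
  have rB : ∀ k, Reg 0 (dn 4 (𝐛 k)) := fun k => (H_dn_four_magF k).1
  have rβ : Reg 0 (beta A₀ ρ₁ ρ₂) := H_beta.1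
  have hg := good_energyDensity (A₀ := A₀) (ρ₁ := ρ₁) (ρ₂ := ρ₂)
  refine ⟨fun k => ?_, fun k => ?_, ?_⟩
  · have h1 : Good fun s : Sol A₀ ρ₁ ρ₂ => cint ((𝐙 k * 𝐙 k) s) s.T :=
      Good.of_le ((rZ k).mul (rZ k)) rw0 hg hc fun s z => (h s z k).1
    have h2 := Good.sq_add (rZ k) (H_YF k).1 h1 (HT_YF k).good
    have e : 𝐙 k + YF A₀ ρ₁ ρ₂ k = dn 4 (velF A₀ ρ₁ ρ₂ k) := by rw [ZF]; ring
    rw [e] at h2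
    exact h2
  · exact Good.of_le (f := dn 4 (𝐛 k) * dn 4 (𝐛 k)) ((rB k).mul (rB k)) rw0 hg hc
      fun s z => (h s z k).2.1
  · have h1 : Good fun s : Sol A₀ ρ₁ ρ₂ => cint ((beta A₀ ρ₁ ρ₂ * beta A₀ ρ₁ ρ₂) s) s.T :=
      Good.of_le (rβ.mul rβ) rw0 hg hc fun s z => (h s z 0).2.2
    have h1' : Good fun s : Sol A₀ ρ₁ ρ₂ => cint ((-beta A₀ ρ₁ ρ₂) s * (-beta A₀ ρ₁ ρ₂) s) s.T := by
      have e : -beta A₀ ρ₁ ρ₂ * -beta A₀ ρ₁ ρ₂ = beta A₀ ρ₁ ρ₂ * beta A₀ ρ₁ ρ₂ := by ring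
      rw [← e] at h1
      exact h1
    have h2 := Good.sq_add HT_dn_four_qF_add_beta.h.1 rβ.neg HT_dn_four_qF_add_beta.good h1'
    rw [add_neg_cancel_right] at h2
    exact h2

end Interior

/-! ### A class of functions with controlled boundary values -/

section BoundaryClass

variable {A₀ ρ₁ ρ₂ : ℝ} {f g : Fam A₀ ρ₁ ρ₂}

/-- Functions whose normal derivative is a tangential divergence of functions of order zero, up to
such a function. -/
def Dv (f : Fam A₀ ρ₁ ρ₂) : Prop := HT 1 f ∧ Reg 2 f ∧ Per f ∧
  ∃ x y e : Fam A₀ ρ₁ ρ₂, HT 0 x ∧ HT 0 y ∧ HT 0 e ∧ Per x ∧ Per y ∧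
    D 3 f = D 1 x + D 2 y + e

/-- At order two the normal derivative itself serves as the remainder, with no divergence part. -/
theorem Dv.of_HT (h : HT 2 f) (hr : Reg 2 f) (hp : Per f) : Dv f :=
  ⟨h.mono (by norm_num), hr, hp, 0, 0, D 3 f, HT.zero 0, HT.zero 0, h.dn 1 hr le_rfl, Per.zero,
    Per.zero, by rw [D_fam_zero, D_fam_zero]; ring⟩

theorem Dv.of_H (h : H 3 f) (hp : Per f) : Dv f := Dv.of_HT h.ht (h.1.mono (by norm_num)) hp

protected theorem Dv.add (hf : Dv f) (hg : Dv g) : Dv (f + g) := by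
  obtain ⟨hf1, hf2, hf3, x, y, e, hx, hy, he, px, py, h⟩ := hf
  obtain ⟨hg1, hg2, hg3, x', y', e', hx', hy', he', px', py', h'⟩ := hg
  refine ⟨hf1.add hg1, hf2.add hg2, hf3.add hg3, x + x', y + y', e + e', hx.add hx', hy.add hy',
    he.add he', px.add px', py.add py', ?_⟩
  rw [D_add 3 hf1.1 hg1.1, h, h', D_add 1 hx.1 hx'.1, D_add 2 hy.1 hy'.1]
  ring

protected theorem Dv.neg (hf : Dv f) : Dv (-f) := by
  obtain ⟨hf1, hf2, hf3, x, y, e, hx, hy, he, px, py, h⟩ := hf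
  refine ⟨hf1.neg, hf2.neg, hf3.neg, -x, -y, -e, hx.neg, hy.neg, he.neg, px.neg, py.neg, ?_⟩
  rw [D_neg 3 hf1.1, h, D_neg 1 hx.1, D_neg 2 hy.1]
  ring

protected theorem Dv.sub (hf : Dv f) (hg : Dv g) : Dv (f - g) := by
  rw [sub_eq_add_neg]; exact hf.add hg.neg

protected theorem Dv.sum {ι : Type*} {t : Finset ι} {f : ι → Fam A₀ ρ₁ ρ₂}
    (h : ∀ i ∈ t, Dv (f i)) : Dv (∑ i ∈ t, f i) := by
  classical
  induction t using Finset.induction_on with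
  | empty => simpa using Dv.of_H (H.zero 3) Per.zero
  | insert a t ha ih =>
    rw [Finset.sum_insert ha]
    exact (h a (Finset.mem_insert_self _ _)).add
      (ih fun i hi => h i (Finset.mem_insert_of_mem hi))

/-- The coefficient is moved inside the tangential divergence; its own tangential derivatives join
the remainder. -/
protected theorem Dv.mul (hf : HT 6 f) (hp : Per f) (hg : Dv g) : Dv (f * g) := by
  obtain ⟨hg1, hg2, hg3, x, y, e, hx, hy, he, px, py, h⟩ := hg
  have hr : Reg 2 f := hf.reg.mono (by norm_num)
  refine ⟨hf.mul hg1 (by norm_num) le_rfl (by norm_num), hr.mul hg2, hp.mul hg3, f * x, f * y,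
    D 3 f * g + f * e - D 1 f * x - D 2 f * y, hf.mul hx (by norm_num) le_rfl (by norm_num),
    hf.mul hy (by norm_num) le_rfl (by norm_num), ?_, hp.mul px, hp.mul py, ?_⟩
  · have h3 : HT 4 (D 3 f) := hf.dn 1 hr le_rfl
    have h1 : HT 5 (D 1 f) := hf.D (by decide) hr le_rfl
    have h2 : HT 5 (D 2 f) := hf.D (by decide) hr le_rfl
    exact (((h3.mul hg1 (by norm_num) (by norm_num) (by norm_num)).add
      (hf.mul he (by norm_num) le_rfl (by norm_num))).sub
      (h1.mul hx (by norm_num) le_rfl (by norm_num))).sub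
      (h2.mul hy (by norm_num) le_rfl (by norm_num))
  · rw [D_mul 3 hf.1 hg1.1, h, D_mul 1 hf.1 hx.1, D_mul 2 hf.1 hy.1]
    ring

theorem HT.Yc_mul (hf : HT 0 f) : HT 0 (Yc * f) := by
  refine ⟨(Reg.Yc 1).mul hf.1, H.li_mul LI.Yc (Reg.Yc 0) hf.h, ?_⟩
  rw [D_mul 0 (Reg.Yc 1) hf.1, D_tangential_Yc (by decide) (by decide), zero_mul, zero_add]
  exact H.li_mul LI.Yc (Reg.Yc 0) hf.2.2

theorem cint_D_tangential (s : Sol A₀ ρ₁ ρ₂) {t : ℝ} (ht : t ∈ Icc 0 s.T) (hf : Reg 1 f)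
    (hp : Per f) : cint (D 1 f s) t = 0 ∧ cint (D 2 f s) t = 0 := by
  rw [D_one_eq, D_two_eq]
  exact ⟨cint_pd_tangential s.T_pos (hf s) (hp s) ht (by decide),
    cint_pd_tangential s.T_pos (hf s) (hp s) ht (by decide)⟩

/-- The trace of a function of this class is controlled. -/
theorem Dv.good (hf : Dv f) :
    Good fun s => integralBdry fun y => ext (f s * f s) (s.T, y) := by
  obtain ⟨h1, h2, h3, x, y, e, hx, hy, he, px, py, h⟩ := hf
  have hf0 : HT 0 f := h1.mono (by norm_num)
  have hd1 : HT 0 (D 1 f) := h1.D (by decide) h2 le_rfl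
  have hd2 : HT 0 (D 2 f) := h1.D (by decide) h2 le_rfl
  have p1 := hf0.mul_good hf0
  have p2 := (HT.Yc_mul hf0).mul_good he
  have p3 := (HT.Yc_mul hd1).mul_good hx
  have p4 := (HT.Yc_mul hd2).mul_good hy
  have rY : Reg 1 (Yc : Fam A₀ ρ₁ ρ₂) := Reg.Yc 1
  have rx := rY.mul (h1.1.mul hx.1)
  have ry := rY.mul (h1.1.mul hy.1)
  have q1 : Reg 1 (f * f) := h1.1.mul h1.1
  have q2 : Reg 1 (Yc * f * e) := (rY.mul h1.1).mul he.1
  have q3 : Reg 1 (Yc * D 1 f * x) := (rY.mul hd1.1).mul hx.1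
  have q4 : Reg 1 (Yc * D 2 f * y) := (rY.mul hd2.1).mul hy.1
  -- What remains of `∂₃(y₃f²) = f² + 2y₃f∂₃f` after substituting the divergence form and
  -- integrating by parts tangentially. Every summand is a product of two functions whose time
  -- derivatives are square integrable.
  set Ψ : Fam A₀ ρ₁ ρ₂ := f * f + (Yc * f * e + Yc * f * e)
    - (Yc * D 1 f * x + Yc * D 1 f * x) - (Yc * D 2 f * y + Yc * D 2 f * y) with hΨ
  have hr : Reg 1 Ψ := ((q1.add (q2.add q2)).sub (q3.add q3)).sub (q4.add q4)
  have hL : L1 Ψ := ((p1.1.add (p2.1.add p2.1)).sub (p3.1.add p3.1)).sub (p4.1.add p4.1)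
  have hL' : L1 (D 0 Ψ) := by
    rw [hΨ, D_sub 0 ((q1.add (q2.add q2)).sub (q3.add q3)) (q4.add q4),
      D_sub 0 (q1.add (q2.add q2)) (q3.add q3), D_add 0 q1 (q2.add q2), D_add 0 q2 q2,
      D_add 0 q3 q3, D_add 0 q4 q4]
    exact ((p1.2.add (p2.2.add p2.2)).sub (p3.2.add p3.2)).sub (p4.2.add p4.2)
  have e1 : D 3 (Yc * (f * f)) = Ψ + (D 1 (Yc * (f * x) + Yc * (f * x))
      + D 2 (Yc * (f * y) + Yc * (f * y))) := by
    rw [D_mul 3 rY q1, D_three_Yc, D_mul 3 h1.1 h1.1, h, D_add 1 rx rx, D_add 2 ry ry,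
      D_mul 1 rY (h1.1.mul hx.1), D_mul 2 rY (h1.1.mul hy.1), D_mul 1 h1.1 hx.1,
      D_mul 2 h1.1 hy.1, D_tangential_Yc (d := 1) (by decide) (by decide),
      D_tangential_Yc (d := 2) (by decide) (by decide), hΨ]
    ring
  refine (Good.of_L1 hr hL hL').mono fun s => le_of_eq ?_
  have ht : s.T ∈ Icc 0 s.T := ⟨s.T_pos.le, le_rfl⟩
  rw [integralBdry_eq_cint s.T_pos ((h1.1 s).mul (h1.1 s)) ht]
  have e2 : pd (eX 2) (ycoord * (f s * f s)) = D 3 (Yc * (f * f)) s := by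
    rw [D_three_eq]; rfl
  have c1 := (cint_D_tangential s ht (rx.add rx) ((Per.Yc.mul (h3.mul px)).add
    (Per.Yc.mul (h3.mul px)))).1
  have c2 := (cint_D_tangential s ht (ry.add ry) ((Per.Yc.mul (h3.mul py)).add
    (Per.Yc.mul (h3.mul py)))).2
  have d1 : Reg 0 (D 1 (Yc * (f * x) + Yc * (f * x))) := (rx.add rx).D 1
  have d2 : Reg 0 (D 2 (Yc * (f * y) + Yc * (f * y))) := (ry.add ry).D 2
  have e3 : cint ((Ψ + (D 1 (Yc * (f * x) + Yc * (f * x))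
      + D 2 (Yc * (f * y) + Yc * (f * y))) : Fam A₀ ρ₁ ρ₂) s) s.T = cint (Ψ s) s.T
      + (cint (D 1 (Yc * (f * x) + Yc * (f * x)) s) s.T
        + cint (D 2 (Yc * (f * y) + Yc * (f * y)) s) s.T) := by
    rw [← cint_add (d1 s) (d2 s) ht, ← cint_add (hr.mono (Nat.zero_le 1) s) ((d1 s).add (d2 s)) ht]
    rfl
  rw [e2, e1, e3, c1, c2]
  ring

end BoundaryClass

/-! ### The trace of the normal displacement -/

section BoundaryTrace

variable {A₀ ρ₁ ρ₂ : ℝ}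

local notation "𝐉" => JF A₀ ρ₁ ρ₂
local notation "𝐗" => X A₀ ρ₁ ρ₂
local notation "𝐖" => WF A₀ ρ₁ ρ₂
local notation "𝐞" => etaF A₀ ρ₁ ρ₂
local notation "𝐛" => magF A₀ ρ₁ ρ₂
local notation "𝐚" => cof (A₀ := A₀) (ρ₁ := ρ₁) (ρ₂ := ρ₂) 2
local notation "𝐫" => Rj A₀ ρ₁ ρ₂
local notation "𝐪" => qF A₀ ρ₁ ρ₂
local notation "𝐛₀" => b0F A₀ ρ₁ ρ₂

theorem Per_qF : Per 𝐪 := fun s => Pr.of_res (f := s.q) fun k hk z hz => s.isSol.periodic_q k hk z hz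

theorem Per_Rj (j : ℕ) : Per (𝐫 j) := fun s =>
  Pr.of_res (f := fun z => iteratedDeriv j s.R (s.q z)) fun k hk z hz => by
    rw [s.isSol.periodic_q k hk z hz]

theorem Per_rho0 : Per (rho0 A₀ ρ₁ ρ₂) := by
  rw [← Rj_mul_JF]
  exact (Per_Rj 0).mul Per_JF

theorem Per_QF : Per (QF A₀ ρ₁ ρ₂) := by
  rw [QF_eq]
  exact Per_qF.add ((Per.const _).mul (Per.sum fun i _ => (Per_magF i).mul (Per_magF i)))

theorem Per_dn_etaF {j : ℕ} (hj : j ≤ 3) (i : Fin 3) : Per (dn (j + 1) (𝐞 i)) :=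
  (Per_X 2 i).dn j ((Reg_X 2 i).mono (by omega))

theorem HT_of_D_zero {f : Fam A₀ ρ₁ ρ₂} {m : ℕ} (hm : 1 ≤ m) (h : H m f) (h0 : D 0 f = 0) :
    HT m f := ⟨h.1.mono hm, h, by rw [h0]; exact H.zero m⟩

theorem HT_b0F (l : Fin 3) : HT 8 (𝐛₀ l) := HT_of_D_zero (by norm_num) (H_b0F l) (D_zero_b0F l)

theorem HT_rho0 : HT 8 (rho0 A₀ ρ₁ ρ₂) :=
  HT_of_D_zero (by norm_num) H_rho0 (D_zero_atZ (Reg_Rj 0 1 (by norm_num)))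

theorem HT_dn_etaF {j c : ℕ} (hj : c + 2 * j ≤ 8) (i : Fin 3) : HT c (dn j (𝐞 i)) :=
  (HT_etaF i).dn j ((H_etaF i).1.mono (by omega)) hj

/-- The normal derivative of ∂₃³∂_lη is the tangential derivative ∂_l of ∂₃⁴η, already in divergence
form. -/
theorem Dv_dn_three_X {l : Fin 3} (hl : l ≠ 2) (i : Fin 3) : Dv (dn 3 (𝐗 l i)) := by
  have hr := Reg_X (A₀ := A₀) (ρ₁ := ρ₁) (ρ₂ := ρ₂) l i
  have e : D 3 (dn 3 (𝐗 l i)) = D (dl l) (dn 4 (𝐞 i)) := by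
    rw [D_three_dn, D_dn (dl_lt hl) 4 ((H_etaF i).1.mono (by norm_num))]
    rfl
  have hN := HT_dn_four_etaF (A₀ := A₀) (ρ₁ := ρ₁) (ρ₂ := ρ₂) i
  have pN : Per (dn 4 (𝐞 i)) := Per_dn_etaF (j := 3) le_rfl i
  refine ⟨(HT_X_tangential hl i).dn 3 (hr.mono (by norm_num)) le_rfl, hr.dn 3 (by norm_num),
    (Per_X l i).dn 3 (hr.mono (by norm_num)), ?_⟩
  have hl' : l = 0 ∨ l = 1 := by fin_cases l <;> simp_all
  rcases hl' with rfl | rfl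
  · refine ⟨dn 4 (𝐞 i), 0, 0, hN, HT.zero 0, HT.zero 0, pN, Per.zero, ?_⟩
    rw [e, D_fam_zero, add_zero, add_zero]
    rfl
  · refine ⟨0, dn 4 (𝐞 i), 0, HT.zero 0, hN, HT.zero 0, Per.zero, pN, ?_⟩
    rw [e, D_fam_zero, zero_add, add_zero]
    rfl

theorem Dv_ofNat_mul (k : ℕ) [k.AtLeastTwo] {f : Fam A₀ ρ₁ ρ₂} (hf : Dv f) :
    Dv (OfNat.ofNat k * f) := Dv.mul ((H.ofNat 7 k).ht) (Per.ofNat k) hf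

theorem Dv_dn_three_mul_X {f : Fam A₀ ρ₁ ρ₂} (hf : HT 6 f) (hf3 : Dv (dn 3 f)) (hr : Reg 5 f)
    (hp : Per f) {l : Fin 3} (hl : l ≠ 2) (i : Fin 3) : Dv (dn 3 (f * 𝐗 l i)) := by
  have hX := HT_X_tangential (A₀ := A₀) (ρ₁ := ρ₁) (ρ₂ := ρ₂) hl i
  have rX := Reg_X (A₀ := A₀) (ρ₁ := ρ₁) (ρ₂ := ρ₂) l i
  have pX := Per_X (A₀ := A₀) (ρ₁ := ρ₁) (ρ₂ := ρ₂) l i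
  rw [dn_three_mul (hr.mono (by norm_num)) (rX.mono (by norm_num))]
  refine (Dv.add (Dv.add ?_ (Dv_ofNat_mul 3 ?_)) (Dv_ofNat_mul 3 ?_)).add
    (Dv.mul hf hp (Dv_dn_three_X hl i))
  · rw [mul_comm]
    exact Dv.mul (hX.mono (by norm_num)) pX hf3
  · refine Dv.of_HT ?_ ((hr.dn 2 (by norm_num)).mul (rX.dn 1 (by norm_num)))
      ((hp.dn 2 (hr.mono (by norm_num))).mul (pX.dn 1 (rX.mono (by norm_num))))
    exact (hf.dn (c := 2) 2 (hr.mono (by norm_num)) le_rfl).mul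
      (hX.dn (c := 5) 1 (rX.mono (by norm_num)) le_rfl) le_rfl (by norm_num) (by norm_num)
  · refine Dv.of_HT ?_ ((hr.dn 1 (by norm_num)).mul (rX.dn 2 (by norm_num)))
      ((hp.dn 1 (hr.mono (by norm_num))).mul (pX.dn 2 (rX.mono (by norm_num))))
    exact (hf.dn (c := 4) 1 (hr.mono (by norm_num)) le_rfl).mul
      (hX.dn (c := 3) 2 (rX.mono (by norm_num)) le_rfl) (by norm_num) (by norm_num) (by norm_num)

theorem Dv_dn_three_b0F (l : Fin 3) : Dv (dn 3 (𝐛₀ l)) :=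
  Dv.of_HT ((HT_b0F l).dn 3 ((H_b0F l).1.mono (by norm_num)) le_rfl)
    ((H_b0F l).1.dn 3 (by norm_num)) ((Per_b0F l).dn 3 ((H_b0F l).1.mono (by norm_num)))

theorem Dv_dn_three_cof (i : Fin 3) : Dv (dn 3 (𝐚 i)) := by
  have r : ∀ l i, Reg 3 (𝐗 l i) := fun l i => (Reg_X l i).mono (by norm_num)
  rw [cof_two, dn_sub 3 ((r _ _).mul (r _ _)) ((r _ _).mul (r _ _))]
  have h : ∀ j k, Dv (dn 3 (𝐗 0 j * 𝐗 1 k)) := fun j k =>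
    Dv_dn_three_mul_X (HT_X 0 j) (Dv_dn_three_X (by decide) j) ((Reg_X 0 j).mono (by norm_num))
      (Per_X 0 j) (by decide) k
  exact (h _ _).sub (h _ _)

/-- The part of `∂₃³(J b)` that contains no fourth normal derivative of the flow map. -/
theorem exists_dn_three_JF_mul_magF (i : Fin 3) : ∃ f : Fam A₀ ρ₁ ρ₂, Dv f ∧
    dn 3 (𝐉 * 𝐛 i) = f + 𝐛₀ 2 * dn 4 (𝐞 i) := by
  have rb : ∀ l, Reg 8 (𝐛₀ l) := fun l => (H_b0F l).1
  have rx : ∀ l, Reg 7 (𝐗 l i) := fun l => Reg_X l i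
  have hb := HT_b0F (A₀ := A₀) (ρ₁ := ρ₁) (ρ₂ := ρ₂)
  have r3 : ∀ l, Reg 3 (𝐛₀ l * 𝐗 l i) := fun l =>
    ((rb l).mono (by norm_num)).mul ((rx l).mono (by norm_num))
  refine ⟨dn 3 (𝐛₀ 0 * 𝐗 0 i) + dn 3 (𝐛₀ 1 * 𝐗 1 i) + (dn 3 (𝐛₀ 2) * 𝐗 2 i
    + 3 * (dn 2 (𝐛₀ 2) * dn 2 (𝐞 i)) + 3 * (dn 1 (𝐛₀ 2) * dn 3 (𝐞 i))), ?_, ?_⟩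
  · have hl : ∀ {l : Fin 3}, l ≠ 2 → Dv (dn 3 (𝐛₀ l * 𝐗 l i)) := fun {l} hl =>
      Dv_dn_three_mul_X ((hb l).mono (by norm_num)) (Dv_dn_three_b0F l)
        ((rb l).mono (by norm_num)) (Per_b0F l) hl i
    have re : Reg 8 (𝐞 i) := (H_etaF i).1
    have pb : ∀ j, j ≤ 8 → Per (dn j (𝐛₀ 2)) := fun j hj => (Per_b0F 2).dn j ((rb 2).mono hj)
    refine ((hl (by decide)).add (hl (by decide))).add
      ((Dv.add ?_ (Dv_ofNat_mul 3 ?_)).add (Dv_ofNat_mul 3 ?_))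
    · rw [mul_comm]
      exact Dv.mul (HT_X 2 i) (Per_X 2 i) (Dv_dn_three_b0F 2)
    · refine Dv.of_HT ?_ (((rb 2).dn 2 (by norm_num)).mul (re.dn 2 (by norm_num)))
        ((pb 2 (by norm_num)).mul (Per_dn_etaF (j := 1) (by norm_num) i))
      exact ((hb 2).dn (c := 4) 2 ((rb 2).mono (by norm_num)) le_rfl).mul
        (HT_dn_etaF (c := 4) (j := 2) le_rfl i) (by norm_num) (by norm_num) (by norm_num)
    · refine Dv.of_HT ?_ (((rb 2).dn 1 (by norm_num)).mul (re.dn 3 (by norm_num)))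
        ((pb 1 (by norm_num)).mul (Per_dn_etaF (j := 2) (by norm_num) i))
      exact ((hb 2).dn (c := 6) 1 ((rb 2).mono (by norm_num)) le_rfl).mul
        (HT_dn_etaF (c := 2) (j := 3) le_rfl i) (by norm_num) (by norm_num) (by norm_num)
  · rw [JF_mul_magF, dn_sum 3 fun l _ => r3 l, Fin.sum_univ_three,
      dn_three_mul ((rb 2).mono (by norm_num)) ((rx 2).mono (by norm_num))]
    have e : ∀ j, dn j (𝐗 2 i) = dn (j + 1) (𝐞 i) := fun j => rfl
    simp only [e]
    ring

/-- ∂₃⁴Q is the good unknown plus `∂₃⁴η·W`, and both are of order zero with their time derivatives.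
-/
theorem Dv_dn_three_QF : Dv (dn 3 (QF A₀ ρ₁ ρ₂)) := by
  have h2 : H 2 (dn 3 (QF A₀ ρ₁ ρ₂)) := H_QF.dn 3 le_rfl
  refine ⟨h2.ht, h2.1, Per_QF.dn 3 (H_QF.1.mono (by norm_num)), 0, 0,
    QQ A₀ ρ₁ ρ₂ + ∑ k, dn 4 (𝐞 k) * 𝐖 k, HT.zero 0, HT.zero 0, ?_, Per.zero, Per.zero, ?_⟩
  · refine HT.add ⟨T1_QQ.1, T1_QQ.2.1, T1_QQ.2.2 0 (by decide)⟩ (HT.sum fun k _ => ?_)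
    exact (HT_dn_four_etaF k).mul ((H_WF k).ht (m := 5)) le_rfl (by norm_num) (by norm_num)
  · rw [D_three_dn, QQ, D_fam_zero, D_fam_zero]
    ring

variable (A₀ ρ₁ ρ₂) in
/-- The coefficient of the third normal derivative of the Jacobian on the boundary. -/
def Rb : Fam A₀ ρ₁ ρ₂ := 𝐫 0 + 𝐫 1 * ∑ i, 𝐛 i * 𝐛 i

/-- Positivity of R' makes the magnetic contribution nonnegative, so the coefficient of ∂₃³J is
invertible with a bound free of b. -/
theorem Rb_ge (s : Sol A₀ ρ₁ ρ₂) (z : cyl s.T) : ρ₁ ≤ Rb A₀ ρ₁ ρ₂ s z := by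
  have h0 := Rj_zero_ge s z
  have h1 : A₀⁻¹ ≤ 𝐫 1 s z := by
    have := s.liquid.deriv_lower z z.2
    simpa [Rj, iteratedDeriv_one] using this
  have h2 : 0 < A₀⁻¹ := inv_pos.2 (zero_lt_one.trans s.one_lt)
  have h3 : 0 ≤ ∑ i, 𝐛 i s z * 𝐛 i s z := Finset.sum_nonneg fun i _ => mul_self_nonneg _
  have h4 := mul_nonneg (h2.le.trans h1) h3
  have h5 : Rb A₀ ρ₁ ρ₂ s z = 𝐫 0 s z + 𝐫 1 s z * ∑ i, 𝐛 i s z * 𝐛 i s z := by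
    simp only [Rb, Pi.add_apply, Pi.mul_apply, Finset.sum_apply]
  linarith

theorem H_Rb_inv : H 7 (Rb A₀ ρ₁ ρ₂)⁻¹ := by
  have h : H 7 (Rb A₀ ρ₁ ρ₂) := by
    refine ((H_Rj 8 0 le_rfl).mono (by norm_num)).add ((H_Rj 7 1 le_rfl).mul
      (H.sum (m := 8) fun i _ => (H_magF i).smul (H_magF i) (by norm_num) le_rfl) le_rfl
      (by norm_num) (by norm_num))
  by_cases h0 : 0 < ρ₁
  · exact h.inv (by norm_num) h0 Rb_ge
  · have : (Rb A₀ ρ₁ ρ₂)⁻¹ = 0 := funext fun s => absurd s.ρ₁_pos h0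
    rw [this]
    exact H.zero 7

theorem Per_Rb : Per (Rb A₀ ρ₁ ρ₂) :=
  (Per_Rj 0).add ((Per_Rj 1).mul (Per.sum fun i _ => (Per_magF i).mul (Per_magF i)))

/-- The lower order terms in three normal derivatives of a product. -/
theorem Dv_middle {f g : Fam A₀ ρ₁ ρ₂} (hf : H 7 f) (hg : H 7 g) (pf : Per f) (pg : Per g) :
    Dv (dn 2 f * dn 1 g) ∧ Dv (dn 1 f * dn 2 g) := by
  have r1 : Reg 2 f := hf.1.mono (by norm_num)
  have r2 : Reg 2 g := hg.1.mono (by norm_num)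
  have p1 := fun j (hj : j ≤ 2) => pf.dn j (r1.mono hj)
  have p2 := fun j (hj : j ≤ 2) => pg.dn j (r2.mono hj)
  refine ⟨Dv.of_H ?_ ((p1 2 le_rfl).mul (p2 1 (by norm_num))),
    Dv.of_H ?_ ((p1 1 (by norm_num)).mul (p2 2 le_rfl))⟩
  · exact (hf.dn (c := 3) 2 le_rfl).mul (hg.dn (c := 5) 1 le_rfl) le_rfl (by norm_num)
      (by norm_num)
  · exact (hf.dn (c := 5) 1 le_rfl).mul (hg.dn (c := 3) 2 le_rfl) (by norm_num) le_rfl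
      (by norm_num)

/-- On the boundary, the third normal derivative of the Jacobian is of the good class. -/
theorem exists_dn_three_JF : ∃ S w : Fam A₀ ρ₁ ρ₂, Dv S ∧
    Rb A₀ ρ₁ ρ₂ * dn 3 𝐉 = S + 𝐛₀ 2 * w := by
  choose F hF hFe using exists_dn_three_JF_mul_magF (A₀ := A₀) (ρ₁ := ρ₁) (ρ₂ := ρ₂)
  have hJ7 : H 7 𝐉 := H_JF.mono (by norm_num)
  have hb7 : ∀ i, H 7 (𝐛 i) := fun i => (H_magF i).mono (by norm_num)
  have hR0 : H 7 (𝐫 0) := H_Rj 7 0 (by norm_num)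
  have hR1 : H 7 (𝐫 1) := H_Rj 7 1 le_rfl
  have hq7 : H 7 𝐪 := H_qF.mono (by norm_num)
  have r : ∀ {f : Fam A₀ ρ₁ ρ₂}, H 7 f → Reg 3 f := fun h => h.1.mono (by norm_num)
  have rb : ∀ i, Reg 3 (𝐛 i) := fun i => r (hb7 i)
  -- The four relations `h1` to `h4` are linear in the third normal derivatives of J, b, R(q) and q.
  -- Eliminating those of b, R(q) and q leaves ∂₃³J with coefficient R + R'|b|²; ∂₃⁴η appears
  -- explicitly only with the factor b₀³.
  have h1 : ∀ i, 𝐉 * dn 3 (𝐛 i) = F i + 𝐛₀ 2 * dn 4 (𝐞 i) - dn 3 𝐉 * 𝐛 i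
      - 3 * (dn 2 𝐉 * dn 1 (𝐛 i)) - 3 * (dn 1 𝐉 * dn 2 (𝐛 i)) := fun i => by
    have h := hFe i
    rw [dn_three_mul (r hJ7) (rb i)] at h
    linear_combination h
  have h2 : dn 3 (rho0 A₀ ρ₁ ρ₂) = dn 3 (𝐫 0) * 𝐉 + 3 * (dn 2 (𝐫 0) * dn 1 𝐉)
      + 3 * (dn 1 (𝐫 0) * dn 2 𝐉) + 𝐫 0 * dn 3 𝐉 := by
    rw [← Rj_mul_JF, dn_three_mul (r hR0) (r hJ7)]
  have h3 : dn 3 (𝐫 0) = dn 2 (𝐫 1) * dn 1 𝐪 + 2 * (dn 1 (𝐫 1) * dn 2 𝐪) + 𝐫 1 * dn 3 𝐪 := by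
    rw [← dn_D_three, D_Rj, dn_two_mul ((r hR1).mono (by norm_num)) ((hq7.1.mono (by norm_num)).D 3)]
    rfl
  have h4 : dn 3 (QF A₀ ρ₁ ρ₂) = dn 3 𝐪
      + ∑ i, (𝐛 i * dn 3 (𝐛 i) + 3 * (dn 2 (𝐛 i) * dn 1 (𝐛 i))) := by
    have hs : Reg 3 (∑ i, 𝐛 i * 𝐛 i) := Reg.sum fun i _ => (rb i).mul (rb i)
    rw [QF_eq, dn_add 3 (r hq7) ((Reg_half 3).mul hs), dn_half_mul 3 hs,
      dn_sum 3 fun i _ => (rb i).mul (rb i), Finset.mul_sum]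
    congr 1
    refine Finset.sum_congr rfl fun i _ => ?_
    rw [dn_three_mul (rb i) (rb i)]
    have := two_mul_half (A₀ := A₀) (ρ₁ := ρ₁) (ρ₂ := ρ₂)
    linear_combination (𝐛 i * dn 3 (𝐛 i) + 3 * (dn 2 (𝐛 i) * dn 1 (𝐛 i))) * this
  refine ⟨dn 3 (rho0 A₀ ρ₁ ρ₂) - 3 * (dn 2 (𝐫 0) * dn 1 𝐉) - 3 * (dn 1 (𝐫 0) * dn 2 𝐉)
    - 𝐉 * (dn 2 (𝐫 1) * dn 1 𝐪 + 2 * (dn 1 (𝐫 1) * dn 2 𝐪))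
    - 𝐉 * (𝐫 1 * (dn 3 (QF A₀ ρ₁ ρ₂) - ∑ i, 3 * (dn 2 (𝐛 i) * dn 1 (𝐛 i))))
    + 𝐫 1 * ∑ i, 𝐛 i * (F i - 3 * (dn 2 𝐉 * dn 1 (𝐛 i)) - 3 * (dn 1 𝐉 * dn 2 (𝐛 i))),
    𝐫 1 * ∑ i, 𝐛 i * dn 4 (𝐞 i), ?_, ?_⟩
  · have m1 := Dv_middle hR0 hJ7 (Per_Rj 0) Per_JF
    have m2 := Dv_middle hR1 hq7 (Per_Rj 1) Per_qF
    have m3 := fun i => (Dv_middle (hb7 i) (hb7 i) (Per_magF i) (Per_magF i)).1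
    have m4 := fun i => Dv_middle hJ7 (hb7 i) Per_JF (Per_magF i)
    have hρ : Dv (dn 3 (rho0 A₀ ρ₁ ρ₂)) :=
      Dv.of_HT (HT_rho0.dn 3 (H_rho0.1.mono (by norm_num)) le_rfl) (H_rho0.1.dn 3 (by norm_num))
        (Per_rho0.dn 3 (H_rho0.1.mono (by norm_num)))
    have cJ : HT 6 𝐉 := hJ7.ht
    have cR : HT 6 (𝐫 1) := hR1.ht
    refine ((((hρ.sub (Dv_ofNat_mul 3 m1.1)).sub (Dv_ofNat_mul 3 m1.2)).sub ?_).sub ?_).add ?_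
    · exact Dv.mul cJ Per_JF (m2.1.add (Dv_ofNat_mul 2 m2.2))
    · exact Dv.mul cJ Per_JF (Dv.mul cR (Per_Rj 1)
        (Dv_dn_three_QF.sub (Dv.sum fun i _ => Dv_ofNat_mul 3 (m3 i))))
    · exact Dv.mul cR (Per_Rj 1) (Dv.sum fun i _ => Dv.mul (hb7 i).ht (Per_magF i)
        (((hF i).sub (Dv_ofNat_mul 3 (m4 i).1)).sub (Dv_ofNat_mul 3 (m4 i).2)))
  · simp only [Fin.sum_univ_three] at h4 ⊢
    rw [Rb]
    simp only [Fin.sum_univ_three]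
    linear_combination (-1 : Fam A₀ ρ₁ ρ₂) * h2 - 𝐉 * h3 + 𝐉 * 𝐫 1 * h4
      + 𝐫 1 * 𝐛 0 * h1 0 + 𝐫 1 * 𝐛 1 * h1 1 + 𝐫 1 * 𝐛 2 * h1 2

/-- The trace of the normal displacement is the trace of a function of the good class. -/
theorem exists_trace : ∃ g : Fam A₀ ρ₁ ρ₂, Dv g ∧ ∀ s (z : cyl s.T),
    (z.1.2 2 = -1 ∨ z.1.2 2 = 1) → (𝐉⁻¹ * UF A₀ ρ₁ ρ₂) s z = g s z := by
  obtain ⟨S, w, hS, h⟩ := exists_dn_three_JF (A₀ := A₀) (ρ₁ := ρ₁) (ρ₂ := ρ₂)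
  have hRb : (Rb A₀ ρ₁ ρ₂)⁻¹ * Rb A₀ ρ₁ ρ₂ = 1 := by
    funext s z
    exact inv_mul_cancel₀ (s.ρ₁_pos.trans_le (Rb_ge s z)).ne'
  have ha := HT_cof_two (A₀ := A₀) (ρ₁ := ρ₁) (ρ₂ := ρ₂)
  have ra := Reg_cof (A₀ := A₀) (ρ₁ := ρ₁) (ρ₂ := ρ₂) 2
  have pa := Per_cof (A₀ := A₀) (ρ₁ := ρ₁) (ρ₂ := ρ₂) 2
  have re : ∀ i, Reg 8 (𝐞 i) := fun i => (H_etaF i).1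
  refine ⟨𝐉⁻¹ * ((Rb A₀ ρ₁ ρ₂)⁻¹ * S - ∑ i, (3 * (dn 1 (𝐚 i) * dn 3 (𝐞 i))
    + 3 * (dn 2 (𝐚 i) * dn 2 (𝐞 i)) + dn 3 (𝐚 i) * dn 1 (𝐞 i))), ?_, fun s z hz => ?_⟩
  · refine Dv.mul ((H_JF_inv.mono (by norm_num : 7 ≤ 8)).ht) Per_JF.inv
      ((Dv.mul H_Rb_inv.ht Per_Rb.inv hS).sub (Dv.sum fun i _ =>
        ((Dv_ofNat_mul 3 ?_).add (Dv_ofNat_mul 3 ?_)).add ?_))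
    · refine Dv.of_HT ?_ (((ra i).dn 1 (by norm_num)).mul ((re i).dn 3 (by norm_num)))
        (((pa i).dn 1 ((ra i).mono (by norm_num))).mul (Per_dn_etaF (j := 2) (by norm_num) i))
      exact ((ha i).dn (c := 5) 1 ((ra i).mono (by norm_num)) le_rfl).mul
        (HT_dn_etaF (c := 2) (j := 3) le_rfl i) (by norm_num) (by norm_num) (by norm_num)
    · refine Dv.of_HT ?_ (((ra i).dn 2 (by norm_num)).mul ((re i).dn 2 (by norm_num)))
        (((pa i).dn 2 ((ra i).mono (by norm_num))).mul (Per_dn_etaF (j := 1) (by norm_num) i))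
      exact ((ha i).dn (c := 3) 2 ((ra i).mono (by norm_num)) le_rfl).mul
        (HT_dn_etaF (c := 4) (j := 2) le_rfl i) (by norm_num) (by norm_num) (by norm_num)
    · rw [mul_comm]
      exact Dv.mul (HT_X 2 i) (Per_X 2 i) (Dv_dn_three_cof i)
  -- The discrepancy carries the factor b₀³ and so disappears on Γ.
  · have e : 𝐉⁻¹ * UF A₀ ρ₁ ρ₂ = 𝐉⁻¹ * ((Rb A₀ ρ₁ ρ₂)⁻¹ * S
        - ∑ i, (3 * (dn 1 (𝐚 i) * dn 3 (𝐞 i)) + 3 * (dn 2 (𝐚 i) * dn 2 (𝐞 i))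
          + dn 3 (𝐚 i) * dn 1 (𝐞 i))) + 𝐛₀ 2 * (𝐉⁻¹ * (Rb A₀ ρ₁ ρ₂)⁻¹ * w) := by
      rw [UF_eq]
      linear_combination 𝐉⁻¹ * (Rb A₀ ρ₁ ρ₂)⁻¹ * h - 𝐉⁻¹ * dn 3 𝐉 * hRb
    rw [e]
    simp only [Pi.add_apply, Pi.mul_apply, b0F_boundary s z hz, zero_mul, add_zero]

end BoundaryTrace

/-! ### Assembly of the bounds, for short and for long times -/

section Conclusion

variable {A₀ ρ₁ ρ₂ : ℝ}

local notation "𝐞" => etaF A₀ ρ₁ ρ₂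

/-- The boundary term of the estimate. -/
def bdryTerm (s : Sol A₀ ρ₁ ρ₂) : ℝ :=
  bdrySq (fun z => ∑ i, invGrad s.T s.η z 2 i * (dx s.T 2)^[4] (fun w => s.η w i) z) s.T

/-- The interior terms of the estimate. -/
def interiorTerm (s : Sol A₀ ρ₁ ρ₂) : ℝ :=
  (∑ i, l2Sq ((dx s.T 2)^[4] fun z => s.v z i) s.T)
    + (∑ i, l2Sq ((dx s.T 2)^[4] fun z => mag s.T s.b₀ s.η z i) s.T)
    + l2Sq ((dx s.T 2)^[4] s.q) s.T

theorem l2Sq_iterate_dx (g : Sol A₀ ρ₁ ρ₂ → SpaceTime → ℝ) (s : Sol A₀ ρ₁ ρ₂) :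
    l2Sq ((dx s.T 2)^[4] (g s)) s.T = cint (dn 4 (resF g) s * dn 4 (resF g) s) s.T := by
  rw [dn, iterate_D_three_resF]
  exact (cint_resF (fun s => (dx s.T 2)^[4] (g s)) s ⟨s.T_pos.le, le_rfl⟩).symm

theorem interiorTerm_eq (s : Sol A₀ ρ₁ ρ₂) : interiorTerm s
    = (∑ i, cint (dn 4 (velF A₀ ρ₁ ρ₂ i) s * dn 4 (velF A₀ ρ₁ ρ₂ i) s) s.T)
      + (∑ i, cint (dn 4 (magF A₀ ρ₁ ρ₂ i) s * dn 4 (magF A₀ ρ₁ ρ₂ i) s) s.T)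
      + cint (dn 4 (qF A₀ ρ₁ ρ₂) s * dn 4 (qF A₀ ρ₁ ρ₂) s) s.T := by
  have h1 : ∀ i, l2Sq ((dx s.T 2)^[4] fun z => s.v z i) s.T = _ := fun i =>
    l2Sq_iterate_dx (fun s z => s.v z i) s
  have h2 : ∀ i, l2Sq ((dx s.T 2)^[4] fun z => mag s.T s.b₀ s.η z i) s.T = _ := fun i =>
    l2Sq_iterate_dx (fun s z => mag s.T s.b₀ s.η z i) s
  have h3 := l2Sq_iterate_dx (fun s => s.q) s
  simp only [interiorTerm, h1, h2, h3]
  rfl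

theorem good_interiorTerm (hA₀ : 1 < A₀) (hρ₁ : 0 < ρ₁) (hρ₂ : ρ₁ < ρ₂) :
    Good (interiorTerm (A₀ := A₀) (ρ₁ := ρ₁) (ρ₂ := ρ₂)) := by
  obtain ⟨h1, h2, h3⟩ := good_interior hA₀ hρ₁ hρ₂
  exact (((Good.sum fun i _ => h1 i).add (Good.sum fun i _ => h2 i)).add h3).mono
    fun s => (interiorTerm_eq s).le

theorem PolyBd_sum {ι : Type*} {t : Finset ι} {φ : ι → Sol A₀ ρ₁ ρ₂ → ℝ → ℝ}
    (h : ∀ i ∈ t, PolyBd (φ i)) : PolyBd fun s τ => ∑ i ∈ t, φ i s τ := by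
  classical
  induction t using Finset.induction_on with
  | empty => simpa using PolyBd.const 0
  | insert a t ha ih =>
    simp only [Finset.sum_insert ha]
    exact (h a (Finset.mem_insert_self _ _)).add
      (ih fun i hi => h i (Finset.mem_insert_of_mem hi))

theorem interiorTerm_le : ∃ (C : ℝ) (k : ℕ), 0 ≤ C ∧
    ∀ s : Sol A₀ ρ₁ ρ₂, interiorTerm s ≤ C * Mg s s.T ^ k := by
  have h := ((PolyBd_sum (t := Finset.univ) fun i _ =>
    (H_dn_four_velF (A₀ := A₀) (ρ₁ := ρ₁) (ρ₂ := ρ₂) i).l2).add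
    (PolyBd_sum (t := Finset.univ) fun i _ =>
      (H_dn_four_magF (A₀ := A₀) (ρ₁ := ρ₁) (ρ₂ := ρ₂) i).l2)).add
    (H_qF.dn (c := 0) 4 le_rfl).l2
  obtain ⟨C, k, hC, h⟩ := h
  refine ⟨C, k, hC, fun s => ?_⟩
  rw [interiorTerm_eq]
  exact h s s.T ⟨s.T_pos.le, le_rfl⟩

/-- Four normal derivatives form a multi-index of weight eight, so the boundary term is one of the
summands of the energy. -/
theorem bdryTerm_le (s : Sol A₀ ρ₁ ρ₂) : bdryTerm s ≤ Mg s s.T := by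
  have h1 := (En_eta_le s 0 s.T).2.2.2.2
  obtain ⟨I, hI⟩ : ∃ I : Fin 5 → ℕ, I = ![0, 0, 0, 4, 0] := ⟨_, rfl⟩
  have hw : weight I = 8 := by rw [hI]; decide
  have h2 : bdrySq (bdryUnknown s.T s.η I) s.T
      ≤ ∑ I ∈ indicesEq 8, bdrySq (bdryUnknown s.T s.η I) s.T :=
    Finset.single_le_sum (f := fun I => bdrySq (bdryUnknown s.T s.η I) s.T)
      (fun _ _ => bdrySq_nonneg _ _) (mem_indicesEq.2 hw)
  have hd : ∀ f : SpaceTime → ℝ, dstar s.T I f = (dx s.T 2)^[4] f := fun f => by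
    simp [dstar, hI]
  have h3 : bdryTerm s = bdrySq (bdryUnknown s.T s.η I) s.T := by
    have e : bdryUnknown s.T s.η I = fun z => ∑ i, invGrad s.T s.η z 2 i
        * (dx s.T 2)^[4] (fun w => s.η w i) z := by
      funext z
      simp only [bdryUnknown, hd]
    rw [e, bdryTerm]
  have h4 := En_nonneg s 0
  rw [h3]
  unfold Mg
  linarith

theorem good_bdryTerm : Good (bdryTerm (A₀ := A₀) (ρ₁ := ρ₁) (ρ₂ := ρ₂)) := by
  obtain ⟨g, hg, h⟩ := exists_trace (A₀ := A₀) (ρ₁ := ρ₁) (ρ₂ := ρ₂)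
  refine hg.good.mono fun s => le_of_eq ?_
  have ht : s.T ∈ Icc 0 s.T := ⟨s.T_pos.le, le_rfl⟩
  have e : (JF A₀ ρ₁ ρ₂)⁻¹ * UF A₀ ρ₁ ρ₂ = ∑ i, AF 2 i * dn 4 (𝐞 i) := by
    rw [UF, Finset.mul_sum]
    exact Finset.sum_congr rfl fun i _ => by rw [AF_eq]; ring
  unfold bdryTerm bdrySq integralBdry
  refine Finset.sum_congr rfl fun c hc => ?_
  have hc' : c = -1 ∨ c = 1 := by simpa using hc
  congr 1
  funext y'
  have hmem : (s.T, (![y' 0, y' 1, c] : Fin 3 → ℝ)) ∈ cyl s.T := by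
    refine ⟨ht, ?_⟩
    change c ∈ Icc (-1 : ℝ) 1
    rcases hc' with rfl | rfl <;> norm_num
  have h1 := h s ⟨_, hmem⟩ hc'
  change (∑ i, invGrad s.T s.η (s.T, ![y' 0, y' 1, c]) 2 i
    * (dx s.T 2)^[4] (fun w => s.η w i) (s.T, ![y' 0, y' 1, c])) ^ 2
      = ext (g s * g s) (s.T, ![y' 0, y' 1, c])
  rw [ext_of_mem _ hmem, Pi.mul_apply, ← h1, e, sq]
  have h2 : (∑ i, AF 2 i * dn 4 (𝐞 i) : Fam A₀ ρ₁ ρ₂) s ⟨_, hmem⟩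
      = ∑ i, invGrad s.T s.η (s.T, ![y' 0, y' 1, c]) 2 i
        * (dx s.T 2)^[4] (fun w => s.η w i) (s.T, ![y' 0, y' 1, c]) := by
    simp only [dn, etaF, iterate_D_three_resF, Finset.sum_apply, Pi.mul_apply]
    rfl
  rw [h2]

/-- At a single boundary point the initial sign condition bounds c₀ by |∂₃Q|, which Sobolev
embedding bounds by the initial energy. This makes the final constants independent of c₀. -/
theorem c₀_le : ∃ (C : ℝ) (k : ℕ), 0 ≤ C ∧ ∀ s : Sol A₀ ρ₁ ρ₂, s.c₀ ≤ C * Mg s 0 ^ k := by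
  obtain ⟨C, k, hC, h⟩ := (H_QF.D 3 (k := 4) (by decide)).li (A₀ := A₀) (ρ₁ := ρ₁) (ρ₂ := ρ₂)
  refine ⟨C, k, hC, fun s => ?_⟩
  have h0 : (0 : ℝ) ∈ Icc 0 s.T := ⟨le_rfl, s.T_pos.le⟩
  have hcell : (![0, 0, 1] : Fin 3 → ℝ) ∈ cell := by
    constructor <;> intro i <;> fin_cases i <;> simp
  have h1 := s.isSol.sign_initial ![0, 0, 1] (Or.inr rfl)
  have h2 := h s ⟨(0, ![0, 0, 1]), mem_cyl_of_cell h0 hcell⟩ hcell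
  have h3 : D 3 (QF A₀ ρ₁ ρ₂) s ⟨(0, ![0, 0, 1]), mem_cyl_of_cell h0 hcell⟩
      = dx s.T 2 (totalP s.T s.b₀ s.η s.q) (0, ![0, 0, 1]) := by
    have := D_dl_resF (A₀ := A₀) (ρ₁ := ρ₁) (ρ₂ := ρ₂) 2 fun s => totalP s.T s.b₀ s.η s.q
    exact congrFun (congrFun this s) _
  rw [h3] at h2
  have h4 : normalDeriv s.T (totalP s.T s.b₀ s.η s.q) (0, ![0, 0, 1])
      = dx s.T 2 (totalP s.T s.b₀ s.η s.q) (0, ![0, 0, 1]) := one_mul _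
  rw [h4] at h1
  exact h1.trans ((neg_le_abs _).trans h2)

theorem bdryTerm_nonneg (s : Sol A₀ ρ₁ ρ₂) : 0 ≤ bdryTerm s := bdrySq_nonneg _ _

/-- The bound used for long times. -/
theorem total_le : ∃ (C : ℝ) (k : ℕ), 0 ≤ C ∧
    ∀ s : Sol A₀ ρ₁ ρ₂, interiorTerm s + s.c₀ / 4 * bdryTerm s ≤ C * Mg s s.T ^ k := by
  obtain ⟨C, k, hC, h⟩ := interiorTerm_le (A₀ := A₀) (ρ₁ := ρ₁) (ρ₂ := ρ₂)
  obtain ⟨C', k', hC', h'⟩ := c₀_le (A₀ := A₀) (ρ₁ := ρ₁) (ρ₂ := ρ₂)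
  refine ⟨C + C' * 2 ^ k', k + (k' + 1), by positivity, fun s => ?_⟩
  have hM := one_le_Mg s s.T
  have hM0 := zero_le_one.trans (one_le_Mg s 0)
  have h1 : Mg s s.T ^ k ≤ Mg s s.T ^ (k + (k' + 1)) := pow_le_pow_right₀ hM (by omega)
  have h2 : Mg s s.T ^ (k' + 1) ≤ Mg s s.T ^ (k + (k' + 1)) := pow_le_pow_right₀ hM (by omega)
  have h3 : s.c₀ ≤ C' * 2 ^ k' * Mg s s.T ^ k' := by
    refine (h' s).trans ?_
    rw [mul_assoc, ← mul_pow]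
    exact mul_le_mul_of_nonneg_left (pow_le_pow_left₀ hM0 (Mg_zero_le s s.T) k') hC'
  have h4 : s.c₀ / 4 * bdryTerm s ≤ C' * 2 ^ k' * Mg s s.T ^ (k' + 1) := by
    rw [pow_succ, ← mul_assoc]
    refine mul_le_mul ?_ (bdryTerm_le s) (bdryTerm_nonneg s) (by positivity)
    linarith [s.c₀_pos]
  have h5 := mul_le_mul_of_nonneg_left h1 hC
  have h6 := mul_le_mul_of_nonneg_left h2 (show 0 ≤ C' * 2 ^ k' by positivity)
  linarith [h s]

/-- The bound used for short times. -/
theorem good_total (hA₀ : 1 < A₀) (hρ₁ : 0 < ρ₁) (hρ₂ : ρ₁ < ρ₂) :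
    Good fun s : Sol A₀ ρ₁ ρ₂ => interiorTerm s + s.c₀ / 4 * bdryTerm s := by
  refine (good_interiorTerm hA₀ hρ₁ hρ₂).add ?_
  obtain ⟨C, k, hC, h⟩ := good_bdryTerm (A₀ := A₀) (ρ₁ := ρ₁) (ρ₂ := ρ₂)
  obtain ⟨C', k', hC', h'⟩ := c₀_le (A₀ := A₀) (ρ₁ := ρ₁) (ρ₂ := ρ₂)
  refine ⟨C' * C * 2 ^ k', k' + k, by positivity, fun s => ?_⟩
  have hM0 := one_le_Mg s 0
  have h1 : s.c₀ / 4 * bdryTerm s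
      ≤ (C' * Mg s 0 ^ k') * (C * (Mg s 0 ^ k + ∫ t in (0 : ℝ)..s.T, Mg s t ^ k)) := by
    refine mul_le_mul ?_ (h s) (bdryTerm_nonneg s) (by positivity)
    linarith [h' s, s.c₀_pos]
  -- The power of the initial size coming from c₀ moves under the time integral, since the initial
  -- size is at most twice the size at any time.
  have h2 : Mg s 0 ^ k' * ∫ t in (0 : ℝ)..s.T, Mg s t ^ k
      ≤ 2 ^ k' * ∫ t in (0 : ℝ)..s.T, Mg s t ^ (k' + k) := by
    rw [← intervalIntegral.integral_const_mul, ← intervalIntegral.integral_const_mul]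
    refine intervalIntegral.integral_mono_on s.T_pos.le
      ((intervalIntegrable_Mg_pow s k).const_mul _)
      ((intervalIntegrable_Mg_pow s (k' + k)).const_mul _) fun t _ => ?_
    have hMt := zero_le_one.trans (one_le_Mg s t)
    rw [pow_add, ← mul_assoc, ← mul_pow]
    exact mul_le_mul_of_nonneg_right
      (pow_le_pow_left₀ (zero_le_one.trans hM0) (Mg_zero_le s t) k') (pow_nonneg hMt k)
  have h3 : Mg s 0 ^ (k' + k) ≤ 2 ^ k' * Mg s 0 ^ (k' + k) :=
    le_mul_of_one_le_left (by positivity) (one_le_pow₀ one_le_two)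
  have h4 : Mg s 0 ^ k' * (Mg s 0 ^ k + ∫ t in (0 : ℝ)..s.T, Mg s t ^ k)
      ≤ 2 ^ k' * (Mg s 0 ^ (k' + k) + ∫ t in (0 : ℝ)..s.T, Mg s t ^ (k' + k)) := by
    rw [mul_add, mul_add, ← pow_add]
    linarith
  have h5 := mul_le_mul_of_nonneg_left h4 (mul_nonneg hC' hC)
  linarith

/-- Separates initial and current energy, as required by the form of the final estimate. -/
theorem Mg_pow_le (s : Sol A₀ ρ₁ ρ₂) (t : ℝ) (n : ℕ) :
    Mg s t ^ n ≤ 2 ^ n * ((1 + En s 0) ^ n + (1 + En s t) ^ n) := by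
  have h0 := En_nonneg s 0
  have h1 := En_nonneg s t
  have hM := zero_le_one.trans (one_le_Mg s t)
  rcases le_total (En s 0) (En s t) with h | h
  · have : Mg s t ^ n ≤ (2 * (1 + En s t)) ^ n :=
      pow_le_pow_left₀ hM (by unfold Mg; linarith) n
    rw [mul_pow] at this
    refine this.trans (mul_le_mul_of_nonneg_left ?_ (by positivity))
    have : 0 ≤ (1 + En s 0) ^ n := by positivity
    linarith
  · have : Mg s t ^ n ≤ (2 * (1 + En s 0)) ^ n :=
      pow_le_pow_left₀ hM (by unfold Mg; linarith) n
    rw [mul_pow] at this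
    refine this.trans (mul_le_mul_of_nonneg_left ?_ (by positivity))
    have : 0 ≤ (1 + En s t) ^ n := by positivity
    linarith

theorem total_bound (hA₀ : 1 < A₀) (hρ₁ : 0 < ρ₁) (hρ₂ : ρ₁ < ρ₂) :
    ∃ (C : ℝ) (n : ℕ), 0 < C ∧ ∀ s : Sol A₀ ρ₁ ρ₂,
      interiorTerm s + s.c₀ / 4 * bdryTerm s ≤ C * ((1 + En s 0) ^ n
        + (1 + En s s.T) ^ n * ∫ t in (0 : ℝ)..s.T, (1 + En s t) ^ n) := by
  obtain ⟨C₁, k₁, hC₁, h₁⟩ := total_le (A₀ := A₀) (ρ₁ := ρ₁) (ρ₂ := ρ₂)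
  obtain ⟨C₂, k₂, hC₂, h₂⟩ := good_total hA₀ hρ₁ hρ₂
  set n := k₁ + k₂ with hn
  -- `C₁` serves T ≥ 1 and `2 C₂` serves T ≤ 1; the power of 2 comes from separating the two
  -- energies, and the final 1 makes the constant positive.
  refine ⟨(C₁ + 2 * C₂) * 2 ^ n + 1, n, by positivity, fun s => ?_⟩
  have hE := En_nonneg s
  set I := ∫ t in (0 : ℝ)..s.T, (1 + En s t) ^ n with hI
  have hint : IntervalIntegrable (fun t => (1 + En s t) ^ n) volume 0 s.T :=
    ((continuousOn_const.add (continuousOn_En s)).pow n).intervalIntegrable_of_Icc s.T_pos.le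
  have one_le : ∀ t, 1 ≤ (1 + En s t) ^ n := fun t => one_le_pow₀ (by linarith [hE t])
  have hTI : s.T ≤ I := by
    have := intervalIntegral.integral_mono_on s.T_pos.le
      (f := fun _ => (1 : ℝ)) intervalIntegrable_const hint fun t _ => one_le t
    simpa using this
  have hI0 : 0 ≤ I := s.T_pos.le.trans hTI
  have e0 := one_le 0
  have eT := one_le s.T
  have hp : I ≤ (1 + En s s.T) ^ n * I := le_mul_of_one_le_left hI0 eT
  have key : interiorTerm s + s.c₀ / 4 * bdryTerm s
      ≤ (C₁ + 2 * C₂) * 2 ^ n * ((1 + En s 0) ^ n + (1 + En s s.T) ^ n * I) := by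
    -- Integrating powers of `Mg` over time yields T times a power of the initial energy, which the
    -- initial term absorbs only for T ≤ 1. For T ≥ 1 the integral is at least T ≥ 1, so the bound
    -- by the energies at times 0 and T can be multiplied by it.
    rcases le_total s.T 1 with hT | hT
    · have h3 := (h₂ s).trans (Good.raise hC₂ (show k₂ ≤ n by omega) s)
      have h4 : ∫ t in (0 : ℝ)..s.T, Mg s t ^ n ≤ 2 ^ n * (s.T * (1 + En s 0) ^ n + I) := by
        have h5 := intervalIntegral.integral_mono_on s.T_pos.le (intervalIntegrable_Mg_pow s n)
          ((intervalIntegrable_const.add hint).const_mul (2 ^ n)) fun t _ => Mg_pow_le s t n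
        refine h5.trans (le_of_eq ?_)
        rw [intervalIntegral.integral_const_mul, intervalIntegral.integral_add
          intervalIntegrable_const hint, intervalIntegral.integral_const]
        simp [hI]
      have h6 := Mg_pow_le s 0 n
      have h7 : s.T * (1 + En s 0) ^ n ≤ (1 + En s 0) ^ n := mul_le_of_le_one_left (by positivity) hT
      have h8 : Mg s 0 ^ n ≤ 2 ^ n * (1 + En s 0) ^ n := by
        rw [← mul_pow]
        exact pow_le_pow_left₀ (zero_le_one.trans (one_le_Mg s 0)) (by
          unfold Mg; linarith [hE 0]) n
      have h9 : Mg s 0 ^ n + ∫ t in (0 : ℝ)..s.T, Mg s t ^ n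
          ≤ 2 * 2 ^ n * ((1 + En s 0) ^ n + (1 + En s s.T) ^ n * I) := by
        have h10 : (2 : ℝ) ^ n * (s.T * (1 + En s 0) ^ n + I)
            ≤ 2 ^ n * ((1 + En s 0) ^ n + (1 + En s s.T) ^ n * I) :=
          mul_le_mul_of_nonneg_left (add_le_add h7 hp) (by positivity)
        have h11 : 0 ≤ (2 : ℝ) ^ n * ((1 + En s s.T) ^ n * I) := by positivity
        linarith
      have h12 := mul_le_mul_of_nonneg_left h9 hC₂
      have h13 : 0 ≤ C₁ * 2 ^ n * ((1 + En s 0) ^ n + (1 + En s s.T) ^ n * I) := by positivity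
      linarith
    · have h3 : Mg s s.T ^ k₁ ≤ Mg s s.T ^ n := pow_le_pow_right₀ (one_le_Mg s s.T) (by omega)
      have h4 := Mg_pow_le s s.T n
      have h5 : (1 + En s s.T) ^ n ≤ (1 + En s s.T) ^ n * I :=
        le_mul_of_one_le_right (by positivity) (hT.trans hTI)
      have h6 : Mg s s.T ^ k₁ ≤ 2 ^ n * ((1 + En s 0) ^ n + (1 + En s s.T) ^ n * I) :=
        h3.trans (h4.trans (mul_le_mul_of_nonneg_left (by linarith) (by positivity)))
      have h7 := mul_le_mul_of_nonneg_left h6 hC₁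
      have h8 : 0 ≤ 2 * C₂ * 2 ^ n * ((1 + En s 0) ^ n + (1 + En s s.T) ^ n * I) := by positivity
      linarith [h₁ s]
  have : 0 ≤ (1 + En s 0) ^ n + (1 + En s s.T) ^ n * I := by positivity
  linarith

end Conclusion

end FreeMHD

end

theorem proposition3p1 (A₀ ρ₁ ρ₂ : ℝ) (hA₀ : 1 < A₀) (hρ₁ : 0 < ρ₁) (hρ₂ : ρ₁ < ρ₂) :
    ∃ (C : ℝ) (P₀ P₁ P₂ : Polynomial ℝ), 0 < C ∧
      (∀ n, 0 ≤ P₀.coeff n) ∧ (∀ n, 0 ≤ P₁.coeff n) ∧ (∀ n, 0 ≤ P₂.coeff n) ∧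
      ∀ (T c₀ : ℝ) (R : ℝ → ℝ) (b₀ : (Fin 3 → ℝ) → Fin 3 → ℝ)
        (η v : FreeMHD.SpaceTime → Fin 3 → ℝ) (q : FreeMHD.SpaceTime → ℝ),
        0 < T → 0 < c₀ →
        FreeMHD.IsLiquid T A₀ ρ₁ ρ₂ R q →
        FreeMHD.IsSolution T c₀ R b₀ η v q →
        FreeMHD.SignCondition T c₀ b₀ η q →
        (∑ i, FreeMHD.l2Sq ((FreeMHD.dx T 2)^[4] fun z => v z i) T)
          + (∑ i, FreeMHD.l2Sq ((FreeMHD.dx T 2)^[4] fun z => FreeMHD.mag T b₀ η z i) T)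
          + FreeMHD.l2Sq ((FreeMHD.dx T 2)^[4] q) T
          + c₀ / 4 * FreeMHD.bdrySq (fun z => ∑ i, FreeMHD.invGrad T η z 2 i *
              (FreeMHD.dx T 2)^[4] (fun w => η w i) z) T
        ≤ C * (P₀.eval (FreeMHD.energy T b₀ η v q 0)
            + P₁.eval (FreeMHD.energy T b₀ η v q T) *
              ∫ t in (0 : ℝ)..T, P₂.eval (FreeMHD.energy T b₀ η v q t)) := by
  obtain ⟨C, n, hC, h⟩ := FreeMHD.total_bound hA₀ hρ₁ hρ₂
  have hP : ∀ m, 0 ≤ ((1 + Polynomial.X : Polynomial ℝ) ^ n).coeff m := fun m => by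
    rw [Polynomial.coeff_one_add_X_pow]
    exact Nat.cast_nonneg _
  refine ⟨C, (1 + Polynomial.X) ^ n, (1 + Polynomial.X) ^ n, (1 + Polynomial.X) ^ n, hC, hP, hP,
    hP, fun T c₀ R b₀ η v q hT hc₀ hliq hsol _ => ?_⟩
  have hs := h ⟨T, c₀, R, b₀, η, v, q, hA₀, hρ₁, hρ₂, hT, hc₀, hliq, hsol⟩
  simp only [Polynomial.eval_pow, Polynomial.eval_add, Polynomial.eval_one, Polynomial.eval_X]
  exact hs
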